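/- **Setting.** Let $\mathbb F$ be an algebraically closed field, $n\ge 1$ and $I=\{1,\dots,n\}$. Let $R$ be a ring which is a $\mathbb Z_+$-ring with unital $\mathbb Z_+$-basis $r_1=1,\dots,r_n$: the $r_i$ form a $\mathbb Z$-basis of $R$, and $r_ir_j=\sum_k c_{ijk}r_k$ with $c_{ijk}\in\mathbb N$. Assume $r_ir_j\ne 0$ for all $i,j$. Put $\mathbf c_{ij}=(c_{ij1},\dots,c_{ijn})\in\mathbb N^I$. Let $\mathbf e_i\in\mathbb N^I$ be the $i$-th unit vector, and let $\mathbf m\widehat\otimes\mathbf s=\sum_{i,j}m_is_j\mathbf c_{ij}$, an associative operation on $\mathbb N^I$ with unit $\mathbf e_1$ and $\mathbf e_i\widehat\otimes\mathbf e_j=\mathbf c_{ij}$. Let $A$ be a finite dimensional $\mathbb F$-algebra with a complete set of orthogonal primitive idempotents $e_1,\dots,e_n$ and $e_1Ae_1=\mathbb Fe_1$. For $\mathbf m,\mathbf s\in\mathbb N^I$ let $M_{\mathbf m\times\mathbf s}(A)$ be the space of $(\mathbf m,\mathbf s)$-type matrices, i.e. of block matrices $X=(X_{ij})_{i,j\in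 I}$ whose block $X_{ij}$ is an $m_i\times s_j$-matrix with entries in $e_iAe_j$ (it is $0$ if $\mathbf m=\mathbf 0$ or $\mathbf s=\mathbf 0$). $M_{\mathbf m}(A)=M_{\mathbf m\times\mathbf m}(A)$ is an algebra; its unity $E_{\mathbf m}$ is the diagonal matrix with $m_i$ diagonal entries $e_i$ in block $i$. An element $x\in e_iAe_j$ is also regarded as an element of $M_{\mathbf e_i\times\mathbf e_j}(A)$. For $1\le k\le m_i$ let $Y^{\mathbf m}_{i,k}\in M_{\mathbf e_i\times\mathbf m}(A)$ be the row whose entry at the $k$-th position of block $i$ is $e_i$ and whose other entries are $0$, and let $X^{\mathbf m}_{i,k}\in M_{\mathbf m\times\mathbf e_i}(A)$ be its transpose. A matrix $X\in M_{\mathbf m\times\mathbf s}(A)$ is *column-independent* if $XY=0$ implies $Y=0$ for all $\mathbf l$ and all $Y\in M_{\mathbf s\times\mathbf l}(A)$, and *row-independent* if $YX=0$ implies $Y=0$ for all $\mathbf l$ and all $Y\in M_{\mathbf l\times\mathbf m}(A)$. A matrix $Y\in M_{\mathbf s\times\mathbf t}(A)$ is a *right universal annihilator* of $X$ if $XY=0$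 and every $M\in M_{\mathbf s\times\mathbf l}(A)$ (any $\mathbf l$) with $XM=0$ equals $YZ$ for a unique $Z\in M_{\mathbf t\times\mathbf l}(A)$; a *left universal annihilator* $Y\in M_{\mathbf t\times\mathbf m}(A)$ of $X$ is defined symmetrically ($YX=0$, and $MX=0$ implies $M=ZY$ for a unique $Z$). Assume: * (KS) $e_iAe_jAe_i\subseteq \mathrm{rad}(e_iAe_i)$ for all $i\ne j$; * (Dec) every typed matrix $X$ is a product $X=X_1X_2$ with $X_1\in M_{\mathbf m\times\mathbf t}(A)$ column-independent and $X_2\in M_{\mathbf t\times\mathbf s}(A)$ row-independent for some $\mathbf t$; * (RUA), (LUA) every typed matrix has a right universal annihilator and a left universal annihilator; * (CI) if $X$ is column-independent and $Y$ is a left universal annihilator of $X$, then $X$ is a right universal annihilator of $Y$; * (RI) if $X$ is row-independent and $Y$ is a right universal annihilator of $X$, then $X$ is a left universal annihilator of $Y$. Let $M(R,A,I)=\bigoplus_{i,i',j,j'\in I}M_{\mathbf c_{i'j'}\times\mathbf c_{ij}}(A)$, an algebra under multiplication of block matrices: the product of an element of $M_{\mathbf c_{i'j'}\times\mathbf c_{ij}}(A)$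 with one of $M_{\mathbf c_{kl}\times\mathbf c_{k'l'}}(A)$ is the matrix product if $(i,j)=(k,l)$ and $0$ otherwise. Let $\phi:A\otimes_{\mathbb F}A\to M(R,A,I)$ be an $\mathbb F$-algebra map such that $\phi(e_i\otimes e_j)=E_{\mathbf c_{ij}}\in M_{\mathbf c_{ij}}(A)$ for all $i,j$, and such that $\phi(e_1\otimes a)=a\in M_{\mathbf c_{1i}\times\mathbf c_{1j}}(A)$ and $\phi(a\otimes e_1)=a\in M_{\mathbf c_{i1}\times\mathbf c_{j1}}(A)$ for all $a\in e_iAe_j$. Then $\phi$ maps $e_{i'}Ae_i\otimes e_{j'}Ae_j$ into $M_{\mathbf c_{i'j'}\times\mathbf c_{ij}}(A)$. For $X\in M_{\mathbf s_1\times\mathbf m_1}(A)$ and $Y\in M_{\mathbf s_2\times\mathbf m_2}(A)$ define $X\widehat\otimes Y\in M_{(\mathbf s_1\widehat\otimes\mathbf s_2)\times(\mathbf m_1\widehat\otimes\mathbf m_2)}(A)$ as follows. Replace every entry $x_{pp'}\otimes y_{qq'}$ of the matrix $X\otimes_{\mathbb F}Y$ by the typed matrix $\phi(x_{pp'}\otimes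 y_{qq'})$, and then reorder rows and columns so as to obtain a typed matrix: inside each block, the rows are ordered lexicographically by the position $q$ in $\mathbf s_2$, then the position $p$ in $\mathbf s_1$, then the position inside the block of the relevant $\mathbf c_{ij}$; the columns likewise. Finally let $a=(a_{i,j,l})_{i,j,l\in I}$ be a family of matrices $a_{i,j,l}\in M_{\mathbf e_i\widehat\otimes\mathbf e_j\widehat\otimes\mathbf e_l}(A)$ with: * (Ass 1) every $a_{i,j,l}$ is invertible in $M_{\mathbf e_i\widehat\otimes\mathbf e_j\widehat\otimes\mathbf e_l}(A)$; * (Ass 2) $(x\widehat\otimes(y\widehat\otimes z))\,a_{i,j,l}=a_{i',j',l'}\,((x\widehat\otimes y)\widehat\otimes z)$ for $x\in e_{i'}Ae_i$, $y\in e_{j'}Ae_j$, $z\in e_{l'}Ae_l$; * (Ass 3) $a_{i,1,j}=E_{\mathbf c_{ij}}$; * (Ass 4) for all $i_1,i_2,i_3,i_4\in I$, $$\sum_{j}\sum_{k\le c_{i_2i_3j}}\bigl(e_{i_1}\widehat\otimes a_{i_2,i_3,i_4}(X^{\mathbf c_{i_2i_3}}_{j,k}\widehat\otimes e_{i_4})\bigr)a_{i_1,j,i_4}\bigl((e_{i_1}\widehat\otimes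 Y^{\mathbf c_{i_2i_3}}_{j,k})a_{i_1,i_2,i_3}\widehat\otimes e_{i_4}\bigr)$$ $$=\sum_{j,j'}\sum_{k\le c_{i_3i_4j}}\sum_{k'\le c_{i_1i_2j'}}\bigl(e_{i_1}\widehat\otimes(e_{i_2}\widehat\otimes X^{\mathbf c_{i_3i_4}}_{j,k})\bigr)a_{i_1,i_2,j}\bigl(X^{\mathbf c_{i_1i_2}}_{j',k'}\widehat\otimes Y^{\mathbf c_{i_3i_4}}_{j,k}\bigr)a_{j',i_3,i_4}\bigl((Y^{\mathbf c_{i_1i_2}}_{j',k'}\widehat\otimes e_{i_3})\widehat\otimes e_{i_4}\bigr).$$ **The category.** The tensor category $\widehat{\mathcal C}$ has object set $\mathbb N^I$, morphisms $\mathrm{Hom}(\mathbf m,\mathbf s)=M_{\mathbf s\times\mathbf m}(A)$ with matrix multiplication as composition, tensor product $\widehat\otimes$, unit object $\mathbf e_1$, identities as unit constraints, and associativity constraint $(\mathbf m\widehat\otimes\mathbf s)\widehat\otimes\mathbf t\to\mathbf m\widehat\otimes(\mathbf s\widehat\otimes\mathbf t)$ given by $$a_{\mathbf m,\mathbf s,\mathbf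 t}=\sum_{i,j,l}\sum_{k_1\le m_i}\sum_{k_2\le s_j}\sum_{k_3\le t_l}\bigl(X^{\mathbf m}_{i,k_1}\widehat\otimes(X^{\mathbf s}_{j,k_2}\widehat\otimes X^{\mathbf t}_{l,k_3})\bigr)\,a_{i,j,l}\,\bigl((Y^{\mathbf m}_{i,k_1}\widehat\otimes Y^{\mathbf s}_{j,k_2})\widehat\otimes Y^{\mathbf t}_{l,k_3}\bigr).$$ Let $(R',A',\phi',a')$ be a second such quadruple over $\mathbb F$, with index set $I'=\{1,\dots,n'\}$, $n'\ge1$, and data $r'_i,\mathbf c'_{ij},e'_i,E',X',Y',\dots$, and let $\widehat{\mathcal C'}$ be its tensor category. Two tensor categories over $\mathbb F$ are *tensor equivalent* if there is an $\mathbb F$-linear equivalence between them which is a (strong) monoidal functor. For a bijection $\sigma:I\to I'$ and $\mathbf m\in\mathbb N^I$ put $\mathbf m^\sigma=(m_{\sigma^{-1}(1)},m_{\sigma^{-1}(2)},\dots)$, and let $P_\sigma(\mathbf m)$ be the permutation matrix with $\mathbf m^\sigma$-type rows and $\mathbf m$-type columns whose entry in row (block $\sigma(i)$, position $k$) and column (block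 $i$, position $k$) is $1$, all other entries being $0$. For a matrix $Z=(z_{pq})$ over $A$ and a map $\delta:A\to A'$ put $\delta(Z)=(\delta(z_{pq}))$. **Theorem.** $\widehat{\mathcal C}$ and $\widehat{\mathcal C'}$ are tensor equivalent if and only if $n'=n$ and there is a permutation $\sigma$ of $I=I'$ such that: 1. The additive map $R\to R'$, $r_i\mapsto r'_{\sigma(i)}$, is a ring isomorphism. (Consequently $\sigma(1)=1$ and $(\mathbf c_{ij})^\sigma=\mathbf c'_{\sigma(i)\sigma(j)}$.) 2. There is an $\mathbb F$-algebra isomorphism $\delta:A\to A'$ with $\delta(e_i)=e'_{\sigma(i)}$ for all $i\in I$. 3. For this $\delta$ there are a nonzero scalar $\alpha\in\mathbb F$ and invertible elements $\varphi_{i,j}\in M_{\mathbf c'_{\sigma(i)\sigma(j)}}(A')$ $(i,j\in I)$ such that for all $i,j,l,i',j'\in I$, $x\in e_{i'}Ae_i$ and $y\in e_{j'}Ae_j$: - (a) $\varphi_{1,i}=\varphi_{i,1}=\alpha\,e'_{\sigma(i)}$; - (b) $\varphi_{i',j'}\,(\delta(x)\widehat\otimes\delta(y))=P_\sigma(\mathbf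 c_{i'j'})\,\delta(x\widehat\otimes y)\,P_\sigma(\mathbf c_{ij})^T\,\varphi_{i,j}$; - (c) $$\sum_{t=1}^n\sum_{k\le c_{ijt}}\delta(a_{i,j,l})\,\delta\bigl(X^{\mathbf c_{ij}}_{t,k}\widehat\otimes e_l\bigr)P_\sigma(\mathbf c_{tl})^T\varphi_{t,l}\bigl(Y'^{\,\mathbf c'_{\sigma(i)\sigma(j)}}_{\sigma(t),k}\varphi_{i,j}\widehat\otimes e'_{\sigma(l)}\bigr)$$ $$=\sum_{t=1}^n\sum_{k\le c_{jlt}}\delta\bigl(e_i\widehat\otimes X^{\mathbf c_{jl}}_{t,k}\bigr)P_\sigma(\mathbf c_{it})^T\varphi_{i,t}\bigl(e'_{\sigma(i)}\widehat\otimes Y'^{\,\mathbf c'_{\sigma(j)\sigma(l)}}_{\sigma(t),k}\varphi_{j,l}\bigr)a'_{\sigma(i),\sigma(j),\sigma(l)}.$$ -/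

import Mathlib

open CategoryTheory MonoidalCategory TensorProduct

noncomputable section

namespace Recon

/-- Row (or column) positions of an `m`-type block matrix: a block `i` together with a position
inside that block.  Read lexicographically these are the positions `1, …, |m|`. -/
abbrev Idx {n : ℕ} (m : Fin n → ℕ) : Type := Σ i : Fin n, Fin (m i)

/-- The vector `𝐞ᵢ ∈ ℕ^I` (Kronecker symbols). -/
def unitVec {n : ℕ} (i : Fin n) : Fin n → ℕ := Pi.single i 1

theorem unitVec_self {n : ℕ} (i : Fin n) : unitVec i i = 1 := by simp [unitVec]

theorem eq_of_fin_unitVec {n : ℕ} {i j : Fin n} (u : Fin (unitVec i j)) : j = i := by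
  by_contra h
  have : unitVec i j = 0 := Pi.single_eq_of_ne h 1
  exact absurd u.2 (by omega)

instance {n : ℕ} (i : Fin n) : Subsingleton (Idx (unitVec i)) := by
  constructor
  rintro ⟨a, u⟩ ⟨b, v⟩
  obtain rfl := eq_of_fin_unitVec u
  obtain rfl := eq_of_fin_unitVec v
  have := unitVec_self b
  congr 1
  ext; omega

/-- The only position of `𝐞ᵢ`. -/
def pt {n : ℕ} (i : Fin n) : Idx (unitVec i) := ⟨i, ⟨0, by rw [unitVec_self]; exact one_pos⟩⟩

/-- A `ℤ₊`-ring structure on `R` with finite unital `ℤ₊`-basis `r₁, …, rₙ` (indexed from `0`, so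
that the unit is the basis element number `0`) such that `rᵢ rⱼ ≠ 0`.  The structure constants `c`
are determined by the basis. -/
structure ZPlusRing (n : ℕ) [NeZero n] (R : Type*) [Ring R] where
  r : Module.Basis (Fin n) ℤ R
  c : Fin n → Fin n → Fin n → ℕ
  r_mul_r : ∀ i j, r i * r j = ∑ k, (c i j k : ℤ) • r k
  r_zero : r 0 = 1
  r_mul_r_ne_zero : ∀ i j, r i * r j ≠ 0

namespace ZPlusRing

variable {n : ℕ} [NeZero n] {R : Type*} [Ring R] (Z : ZPlusRing n R)

/-- `m ⊗̂ s = ∑ᵢⱼ mᵢ sⱼ 𝐜ᵢⱼ`. -/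
def tObj (m s : Fin n → ℕ) : Fin n → ℕ := fun k => ∑ i, ∑ j, m i * s j * Z.c i j k

/-- The element `∑ᵢ mᵢ rᵢ` of `R`. -/
def toR (m : Fin n → ℕ) : R := ∑ i, (m i : ℤ) • Z.r i

theorem toR_injective : Function.Injective Z.toR := by
  intro m s h
  have h2 := Fintype.linearIndependent_iff.1 Z.r.linearIndependent (fun i => (m i : ℤ) - s i)
    (by simpa [toR, sub_smul, Finset.sum_sub_distrib, sub_eq_zero] using h)
  funext i
  have := h2 i
  omega

theorem toR_unitVec (i : Fin n) : Z.toR (unitVec i) = Z.r i := by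
  rw [toR, Finset.sum_eq_single i]
  · simp [unitVec]
  · intro j _ hj; simp [unitVec, Pi.single_eq_of_ne hj]
  · simp

theorem toR_tObj (m s : Fin n → ℕ) : Z.toR (Z.tObj m s) = Z.toR m * Z.toR s := by
  simp only [toR, tObj, Finset.sum_mul_sum, smul_mul_smul_comm, r_mul_r, Finset.smul_sum, smul_smul,
    Nat.cast_sum, Finset.sum_smul, Nat.cast_mul]
  rw [Finset.sum_comm]
  refine Finset.sum_congr rfl fun i _ => ?_
  rw [Finset.sum_comm]

theorem unit_tObj (m : Fin n → ℕ) : Z.tObj (unitVec 0) m = m :=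
  Z.toR_injective (by rw [toR_tObj, toR_unitVec, r_zero, one_mul])

theorem tObj_unit (m : Fin n → ℕ) : Z.tObj m (unitVec 0) = m :=
  Z.toR_injective (by rw [toR_tObj, toR_unitVec, r_zero, mul_one])

theorem tObj_assoc (m s t : Fin n → ℕ) : Z.tObj (Z.tObj m s) t = Z.tObj m (Z.tObj s t) :=
  Z.toR_injective (by simp only [toR_tObj, mul_assoc])

theorem tObj_unitVec (i j : Fin n) : Z.tObj (unitVec i) (unitVec j) = Z.c i j :=
  Z.toR_injective (by rw [toR_tObj, toR_unitVec, toR_unitVec, r_mul_r]; rfl)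

theorem c_zero_left (i : Fin n) : Z.c 0 i = unitVec i := by rw [← tObj_unitVec, unit_tObj]

theorem c_zero_right (i : Fin n) : Z.c i 0 = unitVec i := by rw [← tObj_unitVec, tObj_unit]

/-- The positions inside the block `k` of `m ⊗̂ s`: a position of `s` (running slowest), a position
of `m`, and a position inside the block `k` of the corresponding `𝐜ᵢⱼ`. -/
abbrev TLex (m s : Fin n → ℕ) (k : Fin n) : Type :=
  _root_.Lex (Σ q : _root_.Lex (Idx s),
    _root_.Lex (Σ p : _root_.Lex (Idx m), Fin (Z.c (ofLex p).1 (ofLex q).1 k)))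

theorem card_TLex (m s : Fin n → ℕ) (k : Fin n) : Fintype.card (Z.TLex m s k) = Z.tObj m s k := by
  have h : Fintype.card (Z.TLex m s k) =
      Fintype.card (Σ q : Idx s, Σ p : Idx m, Fin (Z.c p.1 q.1 k)) := rfl
  rw [h]
  simp only [Fintype.card_sigma, Fintype.card_fin, Fintype.sum_sigma, Finset.sum_const,
    Finset.card_univ, smul_eq_mul, tObj]
  rw [Finset.sum_comm]
  refine Finset.sum_congr rfl fun i _ => ?_
  rw [Finset.mul_sum]
  exact Finset.sum_congr rfl fun j _ => by ring

/-- The order in which the concatenation sums list the rows of a tensor product. -/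
def posIso (m s : Fin n → ℕ) (k : Fin n) : Fin (Z.tObj m s k) ≃o Z.TLex m s k :=
  Fintype.orderIsoFinOfCardEq _ (Z.card_TLex m s k)

/-- A position of `m ⊗̂ s` amounts to a position of `m`, a position of `s` and a position of the
corresponding `𝐜ᵢⱼ`. -/
def split (m s : Fin n → ℕ) :
    Idx (Z.tObj m s) ≃ Σ pq : Idx m × Idx s, Idx (Z.c pq.1.1 pq.2.1) where
  toFun P := ⟨((Z.posIso m s P.1 P.2).2.1, (Z.posIso m s P.1 P.2).1),
    ⟨P.1, (Z.posIso m s P.1 P.2).2.2⟩⟩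
  invFun t := ⟨t.2.1, (Z.posIso m s t.2.1).symm ⟨t.1.2, ⟨t.1.1, t.2.2⟩⟩⟩
  left_inv P := by
    rcases P with ⟨k, x⟩
    exact Sigma.ext rfl (heq_of_eq ((Z.posIso m s k).symm_apply_apply x))
  right_inv t := by
    rcases t with ⟨⟨p, q⟩, ⟨k, u⟩⟩
    have h := (Z.posIso m s k).apply_symm_apply ⟨q, ⟨p, u⟩⟩
    dsimp only
    generalize (Z.posIso m s k) ((Z.posIso m s k).symm ⟨q, ⟨p, u⟩⟩) = y at h
    subst h
    rfl

theorem posIso_eq {m s : Fin n → ℕ} {k : Fin n} {N : ℕ} (hN : Z.tObj m s k = N)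
    (f : Fin N → Z.TLex m s k) (hf : StrictMono f) (hs : Function.Surjective f)
    (x : Fin (Z.tObj m s k)) : Z.posIso m s k x = f (Fin.cast hN x) := by
  subst hN
  have h : Z.posIso m s k = StrictMono.orderIsoOfSurjective f hf hs := Subsingleton.elim _ _
  rw [h]; rfl

theorem split_unit_right (m : Fin n → ℕ) (P : Idx (Z.tObj m (unitVec 0))) :
    (Z.split m (unitVec 0) P).1.1 = ⟨P.1, Fin.cast (congrFun (Z.tObj_unit m) P.1) P.2⟩ := by
  rcases P with ⟨k, x⟩
  have hu : 0 < Z.c k 0 k := by rw [c_zero_right, unitVec_self]; exact one_pos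
  have h := Z.posIso_eq (congrFun (Z.tObj_unit m) k)
    (fun a => toLex ⟨toLex (pt 0), toLex ⟨toLex ⟨k, a⟩, ⟨0, hu⟩⟩⟩) ?_ ?_ x
  · change (Z.posIso m (unitVec 0) k x).2.1 = _
    rw [h]; rfl
  · intro a b hab
    refine Sigma.Lex.right _ _ ?_
    refine Sigma.Lex.left _ _ ?_
    exact Sigma.Lex.right _ _ hab
  · rintro ⟨q, ⟨⟨i, a⟩, u⟩⟩
    obtain rfl : q = toLex (pt 0) := Subsingleton.elim (α := Idx (unitVec (0 : Fin n))) _ _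
    have u' : Fin (Z.c i 0 k) := u
    obtain rfl : k = i := eq_of_fin_unitVec (Fin.cast (by rw [c_zero_right]) u')
    refine ⟨a, ?_⟩
    have : u = (⟨0, hu⟩ : Fin (Z.c k 0 k)) := by
      have h1 : Z.c k 0 k = 1 := by rw [c_zero_right, unitVec_self]
      have := (show Fin (Z.c k 0 k) from u).2
      apply Fin.ext
      change (show Fin (Z.c k 0 k) from u).1 = 0
      omega
    rw [this]; rfl

theorem split_unit_left (m : Fin n → ℕ) (P : Idx (Z.tObj (unitVec 0) m)) :
    (Z.split (unitVec 0) m P).1.2 = ⟨P.1, Fin.cast (congrFun (Z.unit_tObj m) P.1) P.2⟩ := by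
  rcases P with ⟨k, x⟩
  have hu : 0 < Z.c 0 k k := by rw [c_zero_left, unitVec_self]; exact one_pos
  have h := Z.posIso_eq (congrFun (Z.unit_tObj m) k)
    (fun a => toLex ⟨toLex ⟨k, a⟩, toLex ⟨toLex (pt 0), ⟨0, hu⟩⟩⟩) ?_ ?_ x
  · change (Z.posIso (unitVec 0) m k x).1 = _
    rw [h]; rfl
  · intro a b hab
    refine Sigma.Lex.left _ _ ?_
    exact Sigma.Lex.right _ _ hab
  · rintro ⟨⟨i, a⟩, ⟨q, u⟩⟩
    obtain rfl : q = toLex (pt 0) := Subsingleton.elim (α := Idx (unitVec (0 : Fin n))) _ _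
    have u' : Fin (Z.c 0 i k) := u
    obtain rfl : k = i := eq_of_fin_unitVec (Fin.cast (by rw [c_zero_left]) u')
    refine ⟨a, ?_⟩
    have : u = (⟨0, hu⟩ : Fin (Z.c 0 k k)) := by
      have h1 : Z.c 0 k k = 1 := by rw [c_zero_left, unitVec_self]
      have := (show Fin (Z.c 0 k k) from u).2
      apply Fin.ext
      change (show Fin (Z.c 0 k k) from u).1 = 0
      omega
    rw [this]; rfl

end ZPlusRing

/-- A complete family of orthogonal primitive idempotents `e₁, …, eₙ` of an `F`-algebra `A`. -/
structure IdempotentSystem (F A : Type*) (n : ℕ) [Field F] [Ring A] [Algebra F A] where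
  e : Fin n → A
  complete : CompleteOrthogonalIdempotents e
  ne_zero : ∀ i, e i ≠ 0
  primitive : ∀ i (f g : A), IsIdempotentElem f → IsIdempotentElem g → f * g = 0 → g * f = 0 →
    f + g = e i → f = 0 ∨ g = 0

namespace IdempotentSystem

variable {F A : Type*} {n : ℕ} [Field F] [Ring A] [Algebra F A] (S : IdempotentSystem F A n)

/-- The subspace `eᵢ A eⱼ` of `A`. -/
def peirce (i j : Fin n) : Submodule F A :=
  LinearMap.range (LinearMap.mulLeft F (S.e i) ∘ₗ LinearMap.mulRight F (S.e j))

variable {S} in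
theorem mem_peirce {i j : Fin n} {x : A} : x ∈ S.peirce i j ↔ ∃ a, S.e i * (a * S.e j) = x :=
  Iff.rfl

theorem e_mul_e (i j : Fin n) : S.e i * S.e j = if i = j then S.e i else 0 :=
  S.complete.mul_eq i j

theorem e_mul_self (i : Fin n) : S.e i * S.e i = S.e i := S.complete.idem i

variable {S} in
theorem e_mul_of_mem {i j : Fin n} {x : A} (h : x ∈ S.peirce i j) : S.e i * x = x := by
  obtain ⟨a, rfl⟩ := mem_peirce.1 h
  rw [← mul_assoc, e_mul_self]

variable {S} in
theorem mul_e_of_mem {i j : Fin n} {x : A} (h : x ∈ S.peirce i j) : x * S.e j = x := by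
  obtain ⟨a, rfl⟩ := mem_peirce.1 h
  rw [mul_assoc, mul_assoc, e_mul_self]

theorem sandwich_mem (i j : Fin n) (x : A) : S.e i * x * S.e j ∈ S.peirce i j :=
  mem_peirce.2 ⟨x, (mul_assoc _ _ _).symm⟩

theorem e_mem (i : Fin n) : S.e i ∈ S.peirce i i := by
  have := S.sandwich_mem i i 1
  rwa [mul_one, e_mul_self] at this

variable {S} in
theorem mul_mem {i j k : Fin n} {x y : A} (hx : x ∈ S.peirce i j) (hy : y ∈ S.peirce j k) :
    x * y ∈ S.peirce i k := by
  have := S.sandwich_mem i k (x * y)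
  rwa [mul_assoc, mul_assoc, mul_e_of_mem hy, ← mul_assoc, e_mul_of_mem hx] at this

/-- Matrices whose rows and columns carry labels in `I` and whose `(p, q)`-entry lies in
`eᵢ A eⱼ`, where `i` and `j` are the labels of `p` and `q`. -/
def typedMat {ι κ : Type} (t : ι → Fin n) (t' : κ → Fin n) : Submodule F (Matrix ι κ A) where
  carrier := {X | ∀ p q, X p q ∈ S.peirce (t p) (t' q)}
  add_mem' hX hY p q := Submodule.add_mem _ (hX p q) (hY p q)
  zero_mem' _ _ := Submodule.zero_mem _
  smul_mem' a _ hX p q := Submodule.smul_mem _ a (hX p q)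

/-- `M_{m×s}(A)`: the `(m, s)`-type matrices over `A`. -/
abbrev BlockMat (m s : Fin n → ℕ) : Type _ :=
  S.typedMat (Sigma.fst : Idx m → Fin n) (Sigma.fst : Idx s → Fin n)

instance (m s t : Fin n → ℕ) : HMul (S.BlockMat m s) (S.BlockMat s t) (S.BlockMat m t) where
  hMul X Y := ⟨X.1 * Y.1, fun p q => by
    rw [Matrix.mul_apply]
    exact Submodule.sum_mem _ fun r _ => mul_mem (X.2 p r) (Y.2 r q)⟩

/-- The identity `E_m` of `M_{m×m}(A)`. -/
def E (m : Fin n → ℕ) : S.BlockMat m m :=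
  ⟨fun p q => if p = q then S.e p.1 else 0, fun p q => by
    dsimp only
    split_ifs with h
    · subst h; exact S.e_mem _
    · exact Submodule.zero_mem _⟩

/-- For `m = s` the identity matrix, seen in `M_{m×s}(A)`. -/
def idOfEq {m s : Fin n → ℕ} (h : m = s) : S.BlockMat m s := h ▸ S.E m

/-- The column matrix `X^m_p ∈ M_{m×𝐞ᵢ}(A)` with entry `eᵢ` at the position `p` (in block `i`). -/
def inc {m : Fin n → ℕ} (p : Idx m) : S.BlockMat m (unitVec p.1) :=
  ⟨fun q _ => if q = p then S.e p.1 else 0, fun q u => by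
    dsimp only
    split_ifs with h
    · subst h; rw [eq_of_fin_unitVec u.2]; exact S.e_mem _
    · exact Submodule.zero_mem _⟩

/-- The row matrix `Y^m_p ∈ M_{𝐞ᵢ×m}(A)` with entry `eᵢ` at the position `p` (in block `i`). -/
def prj {m : Fin n → ℕ} (p : Idx m) : S.BlockMat (unitVec p.1) m :=
  ⟨fun _ q => if q = p then S.e p.1 else 0, fun u q => by
    dsimp only
    split_ifs with h
    · subst h; rw [eq_of_fin_unitVec u.2]; exact S.e_mem _
    · exact Submodule.zero_mem _⟩

/-- The `1 × 1`-matrix `eᵢ x eⱼ ∈ M_{𝐞ᵢ×𝐞ⱼ}(A)`; it is the matrix `(x)` if `x ∈ eᵢ A eⱼ`. -/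
def elt (i j : Fin n) (x : A) : S.BlockMat (unitVec i) (unitVec j) :=
  ⟨fun _ _ => S.e i * x * S.e j, fun p q => by
    rw [eq_of_fin_unitVec p.2, eq_of_fin_unitVec q.2]; exact S.sandwich_mem i j x⟩

section Conditions

variable {S} {m s t : Fin n → ℕ}

/-- Column-independent block matrices. -/
def ColIndep (X : S.BlockMat m s) : Prop :=
  ∀ (l : Fin n → ℕ) (Y : S.BlockMat s l), X * Y = 0 → Y = 0

/-- Row-independent block matrices. -/
def RowIndep (X : S.BlockMat m s) : Prop :=
  ∀ (l : Fin n → ℕ) (Y : S.BlockMat l m), Y * X = 0 → Y = 0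

/-- `Y` is a right universal annihilator of `X`. -/
def IsRightUnivAnn (X : S.BlockMat m s) (Y : S.BlockMat s t) : Prop :=
  X * Y = 0 ∧ ∀ (l : Fin n → ℕ) (M : S.BlockMat s l), X * M = 0 → ∃! Z : S.BlockMat t l, M = Y * Z

/-- `Y` is a left universal annihilator of `X`. -/
def IsLeftUnivAnn (X : S.BlockMat m s) (Y : S.BlockMat t m) : Prop :=
  Y * X = 0 ∧ ∀ (l : Fin n → ℕ) (M : S.BlockMat l m), M * X = 0 → ∃! Z : S.BlockMat l t, M = Z * Y

/-- The element `eᵢ a eⱼ b eᵢ` of the algebra `eᵢ A eᵢ`. -/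
def cornerElt (S : IdempotentSystem F A n) (i j : Fin n) (a b : A) : (S.complete.idem i).Corner :=
  ⟨S.e i * (a * S.e j * b) * S.e i, ⟨a * S.e j * b, rfl⟩⟩

end Conditions

section Algebra

variable {ι : Type} [Fintype ι] [DecidableEq ι] (t : ι → Fin n)

/-- The typed square matrices form an `F`-algebra, whose unit is the diagonal matrix with entry
`eᵢ` at the positions of label `i`. -/
abbrev TypedAlg : Type _ := S.typedMat t t

instance : Mul (S.TypedAlg t) where
  mul X Y := ⟨X.1 * Y.1, fun p q => by
    rw [Matrix.mul_apply]
    exact Submodule.sum_mem _ fun r _ => mul_mem (X.2 p r) (Y.2 r q)⟩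

instance : One (S.TypedAlg t) where
  one := ⟨Matrix.diagonal fun p => S.e (t p), fun p q => by
    rw [Matrix.diagonal_apply]
    split_ifs with h
    · subst h; exact S.e_mem _
    · exact Submodule.zero_mem _⟩

instance : Ring (S.TypedAlg t) :=
  { (inferInstance : AddCommGroup (S.TypedAlg t)),
    (inferInstance : Mul (S.TypedAlg t)), (inferInstance : One (S.TypedAlg t)) with
    left_distrib := fun X Y Z => Subtype.ext (Matrix.mul_add X.1 Y.1 Z.1)
    right_distrib := fun X Y Z => Subtype.ext (Matrix.add_mul X.1 Y.1 Z.1)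
    zero_mul := fun X => Subtype.ext (Matrix.zero_mul X.1)
    mul_zero := fun X => Subtype.ext (Matrix.mul_zero X.1)
    mul_assoc := fun X Y Z => Subtype.ext (Matrix.mul_assoc X.1 Y.1 Z.1)
    one_mul := fun X => Subtype.ext (by
      funext p q
      change (Matrix.diagonal (fun p => S.e (t p)) * X.1) p q = _
      rw [Matrix.diagonal_mul]
      exact e_mul_of_mem (X.2 p q))
    mul_one := fun X => Subtype.ext (by
      funext p q
      change (X.1 * Matrix.diagonal (fun p => S.e (t p))) p q = _
      rw [Matrix.mul_diagonal]
      exact mul_e_of_mem (X.2 p q)) }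

instance : Algebra F (S.TypedAlg t) :=
  Algebra.ofModule (fun r X Y => Subtype.ext (Matrix.smul_mul r X.1 Y.1))
    (fun r X Y => Subtype.ext (Matrix.mul_smul X.1 r Y.1))

end Algebra

end IdempotentSystem

/-- A complete set of orthogonal primitive idempotents with the conditions (KS), (Dec), (RUA),
(LUA), (CI), (RI), in this order, together with `e₁ A e₁ = F e₁`. -/
structure AuslanderData (F A : Type*) (n : ℕ) [NeZero n] [Field F] [Ring A] [Algebra F A] extends
    IdempotentSystem F A n where
  ks : ∀ i j, i ≠ j → ∀ a b,
    toIdempotentSystem.cornerElt i j a b ∈ Ring.jacobson (complete.idem i).Corner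
  dec : ∀ (m s : Fin n → ℕ) (X : toIdempotentSystem.BlockMat m s),
    ∃ (t : Fin n → ℕ) (X₁ : toIdempotentSystem.BlockMat m t)
      (X₂ : toIdempotentSystem.BlockMat t s), IdempotentSystem.ColIndep X₁ ∧ IdempotentSystem.RowIndep X₂ ∧ X = X₁ * X₂
  rua : ∀ (m s : Fin n → ℕ) (X : toIdempotentSystem.BlockMat m s),
    ∃ (t : Fin n → ℕ) (Y : toIdempotentSystem.BlockMat s t), IdempotentSystem.IsRightUnivAnn X Y
  lua : ∀ (m s : Fin n → ℕ) (X : toIdempotentSystem.BlockMat m s),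
    ∃ (t : Fin n → ℕ) (Y : toIdempotentSystem.BlockMat t m), IdempotentSystem.IsLeftUnivAnn X Y
  ci : ∀ (m s t : Fin n → ℕ) (X : toIdempotentSystem.BlockMat m s)
    (Y : toIdempotentSystem.BlockMat t m), IdempotentSystem.ColIndep X →
      IdempotentSystem.IsLeftUnivAnn X Y → IdempotentSystem.IsRightUnivAnn Y X
  ri : ∀ (m s t : Fin n → ℕ) (X : toIdempotentSystem.BlockMat m s)
    (Y : toIdempotentSystem.BlockMat s t), IdempotentSystem.RowIndep X →
      IdempotentSystem.IsRightUnivAnn X Y → IdempotentSystem.IsLeftUnivAnn Y X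
  unit_endo : ∀ x ∈ toIdempotentSystem.peirce 0 0, ∃ α : F, x = α • e 0

/-- The positions of the matrices in `M(R, A, I) = ⨁ M_{𝐜_{i'j'}×𝐜_{ij}}(A)`: a pair `(i, j)` and a
position of `𝐜ᵢⱼ`. -/
abbrev MPos {n : ℕ} (c : Fin n → Fin n → Fin n → ℕ) : Type :=
  Σ ij : Fin n × Fin n, Idx (c ij.1 ij.2)

/-- The algebra `M(R, A, I)`. An element `(X_{i'j',ij})` of the direct sum is written as a single
block matrix, whose product is the usual one. -/
abbrev MAlg {F A : Type*} {n : ℕ} [Field F] [Ring A] [Algebra F A] (S : IdempotentSystem F A n)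
    (c : Fin n → Fin n → Fin n → ℕ) : Type _ :=
  S.TypedAlg (fun P : MPos c => P.2.1)

/-- The triple `(R, A, φ)`: the algebra map `φ : A ⊗ A → M(R, A, I)` satisfies
`φ(eᵢ ⊗ eⱼ) = E_{𝐜ᵢⱼ}`, and `φ(e₁ ⊗ a) = a ∈ M_{𝐜₁ᵢ×𝐜₁ⱼ}(A)`, `φ(a ⊗ e₁) = a ∈ M_{𝐜ᵢ₁×𝐜ⱼ₁}(A)` for `a ∈ eᵢ A eⱼ`. -/
structure PreDatum (F : Type*) (n : ℕ) [NeZero n] (R A : Type*) [Field F] [Ring R] [Ring A]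
    [Algebra F A] where
  Z : ZPlusRing n R
  S : AuslanderData F A n
  φ : A ⊗[F] A →ₐ[F] MAlg S.toIdempotentSystem Z.c
  phi_e : ∀ (i j : Fin n) (P Q : MPos Z.c),
    (φ (S.e i ⊗ₜ S.e j)).1 P Q = if P = Q ∧ P.1 = (i, j) then S.e P.2.1 else 0
  phi_left : ∀ (i j : Fin n), ∀ a ∈ S.peirce i j, ∀ P Q : MPos Z.c,
    (φ (S.e 0 ⊗ₜ a)).1 P Q = if P.1 = (0, i) ∧ Q.1 = (0, j) then a else 0
  phi_right : ∀ (i j : Fin n), ∀ a ∈ S.peirce i j, ∀ P Q : MPos Z.c,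
    (φ (a ⊗ₜ S.e 0)).1 P Q = if P.1 = (i, 0) ∧ Q.1 = (j, 0) then a else 0

namespace IdempotentSystem

variable {F A : Type*} {n : ℕ} [Field F] [Ring A] [Algebra F A] {S : IdempotentSystem F A n}

theorem ext_entry {m s : Fin n → ℕ} {X Y : S.BlockMat m s} (h : ∀ p q, X.1 p q = Y.1 p q) : X = Y :=
  Subtype.ext (funext fun p => funext fun q => h p q)

theorem hmul_apply {m s t : Fin n → ℕ} (X : S.BlockMat m s) (Y : S.BlockMat s t) (p : Idx m)
    (q : Idx t) : (X * Y).1 p q = ∑ r, X.1 p r * Y.1 r q := Matrix.mul_apply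

theorem hmul_assoc {m s t u : Fin n → ℕ} (X : S.BlockMat m s) (Y : S.BlockMat s t)
    (W : S.BlockMat t u) : X * Y * W = X * (Y * W) := Subtype.ext (Matrix.mul_assoc X.1 Y.1 W.1)

theorem E_apply (m : Fin n → ℕ) (p q : Idx m) : (S.E m).1 p q = if p = q then S.e p.1 else 0 := rfl

theorem E_hmul {m s : Fin n → ℕ} (X : S.BlockMat m s) : S.E m * X = X := by
  refine ext_entry fun p q => ?_
  rw [hmul_apply, Finset.sum_eq_single p]
  · rw [E_apply, if_pos rfl]; exact e_mul_of_mem (X.2 p q)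
  · intro r _ hr; rw [E_apply, if_neg hr.symm, zero_mul]
  · simp

theorem hmul_E {m s : Fin n → ℕ} (X : S.BlockMat m s) : X * S.E s = X := by
  refine ext_entry fun p q => ?_
  rw [hmul_apply, Finset.sum_eq_single q]
  · rw [E_apply, if_pos rfl]; exact mul_e_of_mem (X.2 p q)
  · intro r _ hr; rw [E_apply, if_neg hr, mul_zero]
  · simp

theorem prj_inc_self {m : Fin n → ℕ} (p : Idx m) : S.prj p * S.inc p = S.E (unitVec p.1) := by
  refine ext_entry fun u v => ?_
  rw [hmul_apply, Finset.sum_eq_single p]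
  · obtain rfl : u = v := Subsingleton.elim _ _
    have h : u.1 = p.1 := eq_of_fin_unitVec u.2
    simp [E_apply, prj, inc, e_mul_self, h]
  · intro r _ hr; simp [prj, hr]
  · simp

theorem prj_inc_ne {m : Fin n → ℕ} {p q : Idx m} (h : p ≠ q) : S.prj p * S.inc q = 0 := by
  refine ext_entry fun u v => ?_
  rw [hmul_apply]
  refine Finset.sum_eq_zero fun r _ => ?_
  by_cases hr : r = p
  · subst hr; simp [inc, h]
  · simp [prj, hr]

theorem coe_sum {m s : Fin n → ℕ} {κ : Type*} (T : Finset κ) (f : κ → S.BlockMat m s) (p : Idx m)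
    (q : Idx s) : (∑ k ∈ T, f k).1 p q = ∑ k ∈ T, (f k).1 p q := by
  rw [AddSubmonoidClass.coe_finsetSum, Matrix.sum_apply]

theorem sum_inc_prj (m : Fin n → ℕ) : ∑ p : Idx m, S.inc p * S.prj p = S.E m := by
  refine ext_entry fun u v => ?_
  rw [coe_sum]
  have h : ∀ p : Idx m, (S.inc p * S.prj p).1 u v = if u = p ∧ v = p then S.e p.1 else 0 := by
    intro p
    rw [hmul_apply, Finset.sum_eq_single (pt p.1)]
    · by_cases h1 : u = p <;> by_cases h2 : v = p <;> simp [inc, prj, h1, h2, e_mul_self]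
    · intro b _ hb; exact absurd (Subsingleton.elim _ _) hb
    · simp
  simp only [h, E_apply]
  by_cases huv : u = v
  · subst huv
    rw [Finset.sum_eq_single u] <;> simp +contextual [eq_comm]
  · rw [if_neg huv]
    refine Finset.sum_eq_zero fun p _ => if_neg ?_
    rintro ⟨rfl, rfl⟩; exact huv rfl

theorem hmul_idOfEq_apply {m s t : Fin n → ℕ} (h : s = t) (X : S.BlockMat m s) (p : Idx m)
    (q : Idx t) :
    (X * S.idOfEq h).1 p q = X.1 p ⟨q.1, Fin.cast (congrFun h.symm q.1) q.2⟩ := by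
  subst h
  change (X * S.E s).1 p q = _
  rw [hmul_E]; rfl

theorem idOfEq_hmul_apply {m s t : Fin n → ℕ} (h : t = m) (X : S.BlockMat m s) (p : Idx t)
    (q : Idx s) :
    (S.idOfEq h * X).1 p q = X.1 ⟨p.1, Fin.cast (congrFun h p.1) p.2⟩ q := by
  subst h
  change (S.E t * X).1 p q = _
  rw [E_hmul]; rfl

theorem exists_eq_elt {i j : Fin n} (X : S.BlockMat (unitVec j) (unitVec i)) :
    ∃ x ∈ S.peirce j i, X = S.elt j i x := by
  have h : X.1 (pt j) (pt i) ∈ S.peirce j i := X.2 (pt j) (pt i)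
  refine ⟨X.1 (pt j) (pt i), h, ext_entry fun p q => ?_⟩
  obtain rfl : p = pt j := Subsingleton.elim _ _
  obtain rfl : q = pt i := Subsingleton.elim _ _
  change _ = S.e j * X.1 (pt j) (pt i) * S.e i
  rw [e_mul_of_mem h, mul_e_of_mem h]

theorem inc_pt (i : Fin n) : S.inc (pt i) = S.E (unitVec i) := by
  refine ext_entry fun p q => ?_
  obtain rfl : p = pt i := Subsingleton.elim _ _
  obtain rfl : q = pt i := Subsingleton.elim (α := Idx (unitVec i)) _ _
  simp [inc, E_apply]

theorem prj_pt (i : Fin n) : S.prj (pt i) = S.E (unitVec i) := by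
  refine ext_entry fun p q => ?_
  obtain rfl : q = pt i := Subsingleton.elim _ _
  obtain rfl : p = pt i := Subsingleton.elim (α := Idx (unitVec i)) _ _
  simp [prj, E_apply]

end IdempotentSystem

namespace PreDatum

variable {F R A : Type*} {n : ℕ} [NeZero n] [Field F] [Ring R] [Ring A] [Algebra F A]
  (D : PreDatum F n R A)

/-- `M_{m×s}(A)`. -/
abbrev Mat (m s : Fin n → ℕ) : Type _ := D.S.BlockMat m s

/-- The tensor product `m ⊗̂ s` of objects. -/
abbrev tObj (m s : Fin n → ℕ) : Fin n → ℕ := D.Z.tObj m s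

/-- The position in `M(R, A, I)` that belongs to a position of `m ⊗̂ s`. -/
def toM {m s : Fin n → ℕ} (P : Idx (D.tObj m s)) : MPos D.Z.c :=
  ⟨((D.Z.split m s P).1.1.1, (D.Z.split m s P).1.2.1), (D.Z.split m s P).2⟩

/-- The tensor product `X ⊗̂ Y = Π(φ(X ⊗ Y))` of block matrices. -/
def tHom {s₁ m₁ s₂ m₂ : Fin n → ℕ} (X : D.Mat s₁ m₁) (Y : D.Mat s₂ m₂) :
    D.Mat (D.tObj s₁ s₂) (D.tObj m₁ m₂) :=
  ⟨fun P Q => (D.φ (X.1 (D.Z.split s₁ s₂ P).1.1 (D.Z.split m₁ m₂ Q).1.1 ⊗ₜ[F]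
      Y.1 (D.Z.split s₁ s₂ P).1.2 (D.Z.split m₁ m₂ Q).1.2)).1 (D.toM P) (D.toM Q),
    fun P Q => (D.φ _).2 (D.toM P) (D.toM Q)⟩

theorem tHom_apply {s₁ m₁ s₂ m₂ : Fin n → ℕ} (X : D.Mat s₁ m₁) (Y : D.Mat s₂ m₂) (P : _) (Q : _) :
    (D.tHom X Y).1 P Q = (D.φ (X.1 (D.Z.split s₁ s₂ P).1.1 (D.Z.split m₁ m₂ Q).1.1 ⊗ₜ[F]
      Y.1 (D.Z.split s₁ s₂ P).1.2 (D.Z.split m₁ m₂ Q).1.2)).1 (D.toM P) (D.toM Q) := rfl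

theorem toM_symm {m s : Fin n → ℕ} (t : Σ pq : Idx m × Idx s, Idx (D.Z.c pq.1.1 pq.2.1)) :
    D.toM ((D.Z.split m s).symm t) = ⟨(t.1.1.1, t.1.2.1), t.2⟩ :=
  congrArg (fun t : Σ pq : Idx m × Idx s, Idx (D.Z.c pq.1.1 pq.2.1) =>
    (⟨(t.1.1.1, t.1.2.1), t.2⟩ : MPos D.Z.c)) ((D.Z.split m s).apply_symm_apply t)

theorem mAlg_mul_apply (X Y : MAlg D.S.toIdempotentSystem D.Z.c) (P Q : MPos D.Z.c) :
    (X * Y).1 P Q = ∑ T, X.1 P T * Y.1 T Q := Matrix.mul_apply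

theorem phi_col {i j i' j' : Fin n} {x y : A} (hx : x ∈ D.S.peirce i' i) (hy : y ∈ D.S.peirce j' j)
    (P Q : MPos D.Z.c) (hQ : Q.1 ≠ (i, j)) : (D.φ (x ⊗ₜ y)).1 P Q = 0 := by
  have h : D.φ (x ⊗ₜ y) = D.φ (x ⊗ₜ y) * D.φ (D.S.e i ⊗ₜ D.S.e j) := by
    rw [← map_mul, Algebra.TensorProduct.tmul_mul_tmul, IdempotentSystem.mul_e_of_mem hx,
      IdempotentSystem.mul_e_of_mem hy]
  rw [h, mAlg_mul_apply]
  refine Finset.sum_eq_zero fun T _ => ?_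
  rw [phi_e, if_neg, mul_zero]
  rintro ⟨rfl, h⟩; exact hQ h

theorem tHom_comp {s₁ m₁ s₂ m₂ t₁ t₂ : Fin n → ℕ} (X : D.Mat s₁ m₁) (Y : D.Mat s₂ m₂)
    (X' : D.Mat m₁ t₁) (Y' : D.Mat m₂ t₂) :
    D.tHom X Y * D.tHom X' Y' = D.tHom (X * X') (Y * Y') := by
  refine IdempotentSystem.ext_entry fun P Q => ?_
  rw [IdempotentSystem.hmul_apply, tHom_apply]
  simp only [IdempotentSystem.hmul_apply, TensorProduct.sum_tmul, TensorProduct.tmul_sum, map_sum]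
  have hc : ∀ (κ : Finset (Idx m₁ × Idx m₂)) (f : Idx m₁ × Idx m₂ → MAlg D.S.toIdempotentSystem D.Z.c)
      (P Q : MPos D.Z.c), (∑ k ∈ κ, f k).1 P Q = ∑ k ∈ κ, (f k).1 P Q := by
    intro κ f P Q
    rw [AddSubmonoidClass.coe_finsetSum, Matrix.sum_apply]
  rw [Finset.sum_comm, ← Finset.sum_product', Finset.univ_product_univ, hc,
    ← (D.Z.split m₁ m₂).symm.sum_comp, Fintype.sum_sigma]
  refine Finset.sum_congr rfl fun pq _ => ?_
  have hsig : ∀ g : MPos D.Z.c → A, ∑ T, g T = ∑ ij, ∑ r, g ⟨ij, r⟩ := fun g => Fintype.sum_sigma g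
  rw [← Algebra.TensorProduct.tmul_mul_tmul, map_mul, mAlg_mul_apply, hsig,
    Finset.sum_eq_single (pq.1.1, pq.2.1)]
  · refine Finset.sum_congr rfl fun r _ => ?_
    simp only [tHom_apply, toM_symm, Equiv.apply_symm_apply]
  · intro b _ hb
    refine Finset.sum_eq_zero fun r _ => ?_
    rw [D.phi_col (X.2 _ _) (Y.2 _ _) _ _ hb, zero_mul]
  · simp

theorem tHom_E (m s : Fin n → ℕ) :
    D.tHom (D.S.E m) (D.S.E s) = D.S.E (D.tObj m s) := by
  refine IdempotentSystem.ext_entry fun P Q => ?_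
  rw [tHom_apply]
  simp only [IdempotentSystem.E_apply]
  have key : P = Q ↔ (D.Z.split m s P) = (D.Z.split m s Q) := (D.Z.split m s).injective.eq_iff.symm
  have hl : (D.toM P).2.1 = P.1 := rfl
  by_cases h : P = Q
  · subst h
    rw [if_pos rfl, if_pos rfl, if_pos rfl, phi_e, if_pos ⟨rfl, rfl⟩, hl]
  · rw [if_neg h]
    by_cases h1 : (D.Z.split m s P).1.1 = (D.Z.split m s Q).1.1
    · by_cases h2 : (D.Z.split m s P).1.2 = (D.Z.split m s Q).1.2
      · rw [if_pos h1, if_pos h2, phi_e, if_neg]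
        rintro ⟨h3, -⟩
        apply h
        rw [key]
        unfold toM at h3
        revert h1 h2 h3
        generalize D.Z.split m s P = a
        generalize D.Z.split m s Q = b
        rcases a with ⟨⟨a1, a2⟩, a3⟩
        rcases b with ⟨⟨b1, b2⟩, b3⟩
        rintro rfl rfl h
        simpa using h
      · rw [if_neg h2, TensorProduct.tmul_zero, map_zero]; rfl
    · rw [if_neg h1, TensorProduct.zero_tmul, map_zero]; rfl

theorem tHom_add_left {s₁ m₁ s₂ m₂ : Fin n → ℕ} (X X' : D.Mat s₁ m₁) (Y : D.Mat s₂ m₂) :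
    D.tHom (X + X') Y = D.tHom X Y + D.tHom X' Y := by
  refine IdempotentSystem.ext_entry fun P Q => ?_
  change _ = (D.tHom X Y).1 P Q + (D.tHom X' Y).1 P Q
  simp only [tHom_apply]
  change (D.φ ((X.1 _ _ + X'.1 _ _) ⊗ₜ _)).1 _ _ = _
  rw [TensorProduct.add_tmul, map_add]; rfl

theorem tHom_add_right {s₁ m₁ s₂ m₂ : Fin n → ℕ} (X : D.Mat s₁ m₁) (Y Y' : D.Mat s₂ m₂) :
    D.tHom X (Y + Y') = D.tHom X Y + D.tHom X Y' := by
  refine IdempotentSystem.ext_entry fun P Q => ?_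
  change _ = (D.tHom X Y).1 P Q + (D.tHom X Y').1 P Q
  simp only [tHom_apply]
  change (D.φ (_ ⊗ₜ (Y.1 _ _ + Y'.1 _ _))).1 _ _ = _
  rw [TensorProduct.tmul_add, map_add]; rfl

theorem tHom_smul_left {s₁ m₁ s₂ m₂ : Fin n → ℕ} (r : F) (X : D.Mat s₁ m₁) (Y : D.Mat s₂ m₂) :
    D.tHom (r • X) Y = r • D.tHom X Y := by
  refine IdempotentSystem.ext_entry fun P Q => ?_
  change _ = r • (D.tHom X Y).1 P Q
  simp only [tHom_apply]
  change (D.φ ((r • X.1 _ _) ⊗ₜ _)).1 _ _ = _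
  rw [← TensorProduct.smul_tmul', map_smul]; rfl

theorem tHom_smul_right {s₁ m₁ s₂ m₂ : Fin n → ℕ} (r : F) (X : D.Mat s₁ m₁) (Y : D.Mat s₂ m₂) :
    D.tHom X (r • Y) = r • D.tHom X Y := by
  refine IdempotentSystem.ext_entry fun P Q => ?_
  change _ = r • (D.tHom X Y).1 P Q
  simp only [tHom_apply]
  change (D.φ (_ ⊗ₜ (r • Y.1 _ _))).1 _ _ = _
  rw [TensorProduct.tmul_smul, map_smul]; rfl

theorem tObj_unit_eq (m s : Fin n → ℕ) :
    D.tObj m (D.tObj (unitVec 0) s) = D.tObj (D.tObj m (unitVec 0)) s := by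
  rw [show D.tObj (unitVec 0) s = s from D.Z.unit_tObj s,
    show D.tObj m (unitVec 0) = m from D.Z.tObj_unit m]

theorem E_unit_apply (u v : Idx (unitVec (0 : Fin n))) :
    (D.S.E (unitVec 0)).1 u v = D.S.e 0 := by
  obtain rfl : u = v := Subsingleton.elim _ _
  rw [IdempotentSystem.E_apply, if_pos rfl, eq_of_fin_unitVec u.2]

theorem tHom_unit_right {m s : Fin n → ℕ} (X : D.Mat m s) :
    D.tHom X (D.S.E (unitVec 0)) * D.S.idOfEq (D.Z.tObj_unit s) =
      D.S.idOfEq (D.Z.tObj_unit m) * X := by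
  refine IdempotentSystem.ext_entry fun P Q => ?_
  rw [IdempotentSystem.hmul_idOfEq_apply, IdempotentSystem.idOfEq_hmul_apply, tHom_apply,
    E_unit_apply, D.phi_right _ _ _ (X.2 _ _), if_pos, D.Z.split_unit_right, D.Z.split_unit_right]
  · rfl
  · exact ⟨Prod.ext rfl (eq_of_fin_unitVec (D.Z.split m (unitVec 0) P).1.2.2),
      Prod.ext rfl (eq_of_fin_unitVec (D.Z.split s (unitVec 0) _).1.2.2)⟩

theorem tHom_unit_left {m s : Fin n → ℕ} (X : D.Mat m s) :
    D.tHom (D.S.E (unitVec 0)) X * D.S.idOfEq (D.Z.unit_tObj s) =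
      D.S.idOfEq (D.Z.unit_tObj m) * X := by
  refine IdempotentSystem.ext_entry fun P Q => ?_
  rw [IdempotentSystem.hmul_idOfEq_apply, IdempotentSystem.idOfEq_hmul_apply, tHom_apply,
    E_unit_apply, D.phi_left _ _ _ (X.2 _ _), if_pos, D.Z.split_unit_left, D.Z.split_unit_left]
  · rfl
  · exact ⟨Prod.ext (eq_of_fin_unitVec (D.Z.split (unitVec 0) m P).1.1.2) rfl,
      Prod.ext (eq_of_fin_unitVec (D.Z.split (unitVec 0) s _).1.1.2) rfl⟩

end PreDatum

/-- The quadruple `(R, A, φ, a)`.  As `𝐞ᵢ ⊗̂ (𝐞ⱼ ⊗̂ 𝐞ₗ) = (𝐞ᵢ ⊗̂ 𝐞ⱼ) ⊗̂ 𝐞ₗ` in `ℕ^I`, the matrix `aᵢⱼₗ`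
is a square block matrix of the type of this object. -/
structure Datum (F : Type*) (n : ℕ) [NeZero n] (R A : Type*) [Field F] [Ring R] [Ring A]
    [Algebra F A] extends PreDatum F n R A where
  a : ∀ i j l : Fin n, toPreDatum.Mat
    (toPreDatum.tObj (unitVec i) (toPreDatum.tObj (unitVec j) (unitVec l)))
    (toPreDatum.tObj (toPreDatum.tObj (unitVec i) (unitVec j)) (unitVec l))
  a_inv : ∀ i j l, ∃ b : toPreDatum.Mat
    (toPreDatum.tObj (toPreDatum.tObj (unitVec i) (unitVec j)) (unitVec l))
    (toPreDatum.tObj (unitVec i) (toPreDatum.tObj (unitVec j) (unitVec l))),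
    a i j l * b = S.E _ ∧ b * a i j l = S.E _
  a_nat : ∀ (i j l i' j' l' : Fin n), ∀ x ∈ S.peirce i' i, ∀ y ∈ S.peirce j' j,
    ∀ z ∈ S.peirce l' l,
    toPreDatum.tHom (S.elt i' i x) (toPreDatum.tHom (S.elt j' j y) (S.elt l' l z)) * a i j l =
      a i' j' l' * toPreDatum.tHom (toPreDatum.tHom (S.elt i' i x) (S.elt j' j y)) (S.elt l' l z)
  a_unit : ∀ i j, a i 0 j = S.idOfEq (toPreDatum.tObj_unit_eq (unitVec i) (unitVec j))
  a_pentagon : ∀ i₁ i₂ i₃ i₄ : Fin n,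
    ∑ p : Idx (toPreDatum.tObj (unitVec i₂) (unitVec i₃)),
      toPreDatum.tHom (S.E (unitVec i₁))
          (a i₂ i₃ i₄ * toPreDatum.tHom (S.inc p) (S.E (unitVec i₄))) *
        a i₁ p.1 i₄ *
        toPreDatum.tHom (toPreDatum.tHom (S.E (unitVec i₁)) (S.prj p) * a i₁ i₂ i₃)
          (S.E (unitVec i₄)) =
    ∑ p : Idx (toPreDatum.tObj (unitVec i₃) (unitVec i₄)),
      ∑ q : Idx (toPreDatum.tObj (unitVec i₁) (unitVec i₂)),
        toPreDatum.tHom (S.E (unitVec i₁)) (toPreDatum.tHom (S.E (unitVec i₂)) (S.inc p)) *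
          a i₁ i₂ p.1 *
          toPreDatum.tHom (S.inc q) (S.prj p) *
          a q.1 i₃ i₄ *
          toPreDatum.tHom (toPreDatum.tHom (S.prj q) (S.E (unitVec i₃))) (S.E (unitVec i₄))

namespace PreDatum

variable {F R A : Type*} {n : ℕ} [NeZero n] [Field F] [Ring R] [Ring A] [Algebra F A]
  (D : PreDatum F n R A)

/-- The objects of `Ĉ`: the elements of `ℕ^I`. -/
@[ext]
structure Ob (_ : PreDatum F n R A) : Type where
  vec : Fin n → ℕ

/-- The category `Ĉ`: `Hom(m, s) = M_{s×m}(A)`, and the composite of `Y` followed by `X` is the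
matrix product `X Y`. -/
instance : Category D.Ob where
  Hom m s := D.Mat s.vec m.vec
  id m := D.S.E m.vec
  comp Y X := X * Y
  id_comp X := IdempotentSystem.hmul_E X
  comp_id X := IdempotentSystem.E_hmul X
  assoc X Y W := (IdempotentSystem.hmul_assoc W Y X).symm

instance (m s : D.Ob) : AddCommGroup (m ⟶ s) := inferInstanceAs (AddCommGroup (D.Mat s.vec m.vec))
instance (m s : D.Ob) : Module F (m ⟶ s) := inferInstanceAs (Module F (D.Mat s.vec m.vec))

instance : Preadditive D.Ob where
  add_comp _ _ _ f f' g := Subtype.ext (Matrix.mul_add g.1 f.1 f'.1)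
  comp_add _ _ _ f g g' := Subtype.ext (Matrix.add_mul g.1 g'.1 f.1)

instance : Linear F D.Ob where
  smul_comp _ _ _ r f g := Subtype.ext (Matrix.mul_smul g.1 r f.1)
  comp_smul _ _ _ f r g := Subtype.ext (Matrix.smul_mul r g.1 f.1)

/-- The object `𝐞ᵢ`. -/
def u (i : Fin n) : D.Ob := ⟨unitVec i⟩

/-- `⊗̂` on objects. -/
def tO (m s : D.Ob) : D.Ob := ⟨D.tObj m.vec s.vec⟩

/-- `⊗̂` on morphisms. -/
def ten {m₁ s₁ m₂ s₂ : D.Ob} (f : m₁ ⟶ s₁) (g : m₂ ⟶ s₂) : D.tO m₁ m₂ ⟶ D.tO s₁ s₂ :=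
  D.tHom f g

/-- The inclusion of a summand. -/
def ι {m : D.Ob} (p : Idx m.vec) : D.u p.1 ⟶ m := D.S.inc p

/-- The projection to a summand. -/
def π {m : D.Ob} (p : Idx m.vec) : m ⟶ D.u p.1 := D.S.prj p

variable {D}

theorem ι_pt (i : Fin n) : D.ι (m := D.u i) (pt i) = 𝟙 (D.u i) :=
  IdempotentSystem.inc_pt (S := D.S.toIdempotentSystem) i

theorem ten_comp {m₁ s₁ t₁ m₂ s₂ t₂ : D.Ob} (f : m₁ ⟶ s₁) (f' : s₁ ⟶ t₁) (g : m₂ ⟶ s₂)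
    (g' : s₂ ⟶ t₂) : D.ten f g ≫ D.ten f' g' = D.ten (f ≫ f') (g ≫ g') :=
  D.tHom_comp _ _ _ _

theorem ten_id (m s : D.Ob) : D.ten (𝟙 m) (𝟙 s) = 𝟙 (D.tO m s) := D.tHom_E m.vec s.vec

theorem ten_add_left {m₁ s₁ m₂ s₂ : D.Ob} (f f' : m₁ ⟶ s₁) (g : m₂ ⟶ s₂) :
    D.ten (f + f') g = D.ten f g + D.ten f' g := D.tHom_add_left _ _ _

theorem ten_add_right {m₁ s₁ m₂ s₂ : D.Ob} (f : m₁ ⟶ s₁) (g g' : m₂ ⟶ s₂) :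
    D.ten f (g + g') = D.ten f g + D.ten f g' := D.tHom_add_right _ _ _

theorem ten_smul_left {m₁ s₁ m₂ s₂ : D.Ob} (r : F) (f : m₁ ⟶ s₁) (g : m₂ ⟶ s₂) :
    D.ten (r • f) g = r • D.ten f g := D.tHom_smul_left _ _ _

theorem ten_smul_right {m₁ s₁ m₂ s₂ : D.Ob} (r : F) (f : m₁ ⟶ s₁) (g : m₂ ⟶ s₂) :
    D.ten f (r • g) = r • D.ten f g := D.tHom_smul_right _ _ _

theorem ten_sum_left {m₁ s₁ m₂ s₂ : D.Ob} {κ : Type} (T : Finset κ) (f : κ → (m₁ ⟶ s₁))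
    (g : m₂ ⟶ s₂) : D.ten (∑ k ∈ T, f k) g = ∑ k ∈ T, D.ten (f k) g :=
  map_sum (AddMonoidHom.mk' (fun f => D.ten f g) (fun a b => ten_add_left a b g)) f T

theorem ten_sum_right {m₁ s₁ m₂ s₂ : D.Ob} {κ : Type} (T : Finset κ) (f : m₁ ⟶ s₁)
    (g : κ → (m₂ ⟶ s₂)) : D.ten f (∑ k ∈ T, g k) = ∑ k ∈ T, D.ten f (g k) :=
  map_sum (AddMonoidHom.mk' (fun g => D.ten f g) (fun a b => ten_add_right f a b)) g T

theorem ten_zero_left {m₁ s₁ m₂ s₂ : D.Ob} (g : m₂ ⟶ s₂) : D.ten (0 : m₁ ⟶ s₁) g = 0 :=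
  map_zero (AddMonoidHom.mk' (fun f => D.ten f g) (fun a b => ten_add_left a b g))

theorem ten_zero_right {m₁ s₁ m₂ s₂ : D.Ob} (f : m₁ ⟶ s₁) : D.ten f (0 : m₂ ⟶ s₂) = 0 :=
  map_zero (AddMonoidHom.mk' (fun g => D.ten f g) (fun a b => ten_add_right f a b))

theorem ι_π_self {m : D.Ob} (p : Idx m.vec) : D.ι p ≫ D.π p = 𝟙 _ := IdempotentSystem.prj_inc_self p

theorem ι_π_ne {m : D.Ob} {p q : Idx m.vec} (h : p ≠ q) : D.ι p ≫ D.π q = 0 :=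
  IdempotentSystem.prj_inc_ne h.symm

theorem sum_π_ι (m : D.Ob) : ∑ p : Idx m.vec, D.π p ≫ D.ι p = 𝟙 m := IdempotentSystem.sum_inc_prj m.vec

/-- A morphism out of `m` is determined by its restrictions to the summands. -/
theorem hom_ext {m s : D.Ob} {f g : m ⟶ s} (h : ∀ p : Idx m.vec, D.ι p ≫ f = D.ι p ≫ g) : f = g := by
  rw [← Category.id_comp f, ← Category.id_comp g, ← sum_π_ι, Preadditive.sum_comp,
    Preadditive.sum_comp]
  simp only [Category.assoc, h]

theorem ten_ext {m s t : D.Ob} {f g : D.tO m s ⟶ t}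
    (h : ∀ (p : Idx m.vec) (q : Idx s.vec), D.ten (D.ι p) (D.ι q) ≫ f = D.ten (D.ι p) (D.ι q) ≫ g) :
    f = g := by
  have key : ∀ f : D.tO m s ⟶ t, f = ∑ q : Idx s.vec, ∑ p : Idx m.vec,
      D.ten (D.π p) (D.π q) ≫ D.ten (D.ι p) (D.ι q) ≫ f := by
    intro f
    conv_lhs => rw [← Category.id_comp f, ← ten_id, ← sum_π_ι m, ← sum_π_ι s]
    simp only [ten_sum_left, ten_sum_right, Preadditive.sum_comp, ← ten_comp, Category.assoc]
  rw [key f, key g]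
  simp only [h]

theorem ten_ext_left {m s t l : D.Ob} {f g : D.tO (D.tO m s) t ⟶ l}
    (h : ∀ (p : Idx m.vec) (q : Idx s.vec) (r : Idx t.vec),
      D.ten (D.ten (D.ι p) (D.ι q)) (D.ι r) ≫ f = D.ten (D.ten (D.ι p) (D.ι q)) (D.ι r) ≫ g) :
    f = g := by
  have key : ∀ f : D.tO (D.tO m s) t ⟶ l, f = ∑ r : Idx t.vec, ∑ q : Idx s.vec, ∑ p : Idx m.vec,
      D.ten (D.ten (D.π p) (D.π q)) (D.π r) ≫ D.ten (D.ten (D.ι p) (D.ι q)) (D.ι r) ≫ f := by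
    intro f
    conv_lhs => rw [← Category.id_comp f, ← ten_id, ← ten_id, ← sum_π_ι m, ← sum_π_ι s, ← sum_π_ι t]
    simp only [ten_sum_left, ten_sum_right, Preadditive.sum_comp, ← ten_comp, Category.assoc]
  rw [key f, key g]
  simp only [h]

theorem ten_ext_left₄ {m s t v l : D.Ob} {f g : D.tO (D.tO (D.tO m s) t) v ⟶ l}
    (h : ∀ (p : Idx m.vec) (q : Idx s.vec) (r : Idx t.vec) (w : Idx v.vec),
      D.ten (D.ten (D.ten (D.ι p) (D.ι q)) (D.ι r)) (D.ι w) ≫ f =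
        D.ten (D.ten (D.ten (D.ι p) (D.ι q)) (D.ι r)) (D.ι w) ≫ g) :
    f = g := by
  have key : ∀ f : D.tO (D.tO (D.tO m s) t) v ⟶ l, f = ∑ w : Idx v.vec, ∑ r : Idx t.vec,
      ∑ q : Idx s.vec, ∑ p : Idx m.vec, D.ten (D.ten (D.ten (D.π p) (D.π q)) (D.π r)) (D.π w) ≫
        D.ten (D.ten (D.ten (D.ι p) (D.ι q)) (D.ι r)) (D.ι w) ≫ f := by
    intro f
    conv_lhs => rw [← Category.id_comp f, ← ten_id, ← ten_id, ← ten_id, ← sum_π_ι m, ← sum_π_ι s,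
      ← sum_π_ι t, ← sum_π_ι v]
    simp only [ten_sum_left, ten_sum_right, Preadditive.sum_comp, ← ten_comp, Category.assoc]
  rw [key f, key g]
  simp only [h]

theorem eqToHom_eq {m s : D.Ob} (h : m = s) :
    eqToHom h = (D.S.idOfEq (congrArg Ob.vec h.symm) : D.Mat s.vec m.vec) := by
  subst h; rfl

theorem ten_eqToHom_right (m : D.Ob) {s t : D.Ob} (h : s = t) :
    D.ten (𝟙 m) (eqToHom h) = eqToHom (by rw [h]) := by
  subst h; exact ten_id _ _

theorem ten_eqToHom_left {s t : D.Ob} (m : D.Ob) (h : s = t) :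
    D.ten (eqToHom h) (𝟙 m) = eqToHom (by rw [h]) := by
  subst h; exact ten_id _ _

variable (D) in
theorem unit_tO (m : D.Ob) : D.tO (D.u 0) m = m := Ob.ext (D.Z.unit_tObj m.vec)

variable (D) in
theorem tO_unit (m : D.Ob) : D.tO m (D.u 0) = m := Ob.ext (D.Z.tObj_unit m.vec)

theorem unit_nat_left {m s : D.Ob} (f : m ⟶ s) :
    D.ten (𝟙 (D.u 0)) f ≫ eqToHom (D.unit_tO s) = eqToHom (D.unit_tO m) ≫ f := by
  have h : eqToHom (D.unit_tO m).symm ≫ D.ten (𝟙 (D.u 0)) f =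
      f ≫ eqToHom (D.unit_tO s).symm := by
    rw [eqToHom_eq, eqToHom_eq]
    exact D.tHom_unit_left f
  rw [← cancel_epi (eqToHom (D.unit_tO m).symm), reassoc_of% h]
  simp

theorem unit_nat_right {m s : D.Ob} (f : m ⟶ s) :
    D.ten f (𝟙 (D.u 0)) ≫ eqToHom (D.tO_unit s) = eqToHom (D.tO_unit m) ≫ f := by
  have h : eqToHom (D.tO_unit m).symm ≫ D.ten f (𝟙 (D.u 0)) =
      f ≫ eqToHom (D.tO_unit s).symm := by
    rw [eqToHom_eq, eqToHom_eq]
    exact D.tHom_unit_right f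
  rw [← cancel_epi (eqToHom (D.tO_unit m).symm), reassoc_of% h]
  simp

end PreDatum

namespace Datum

variable {F R A : Type*} {n : ℕ} [NeZero n] [Field F] [Ring R] [Ring A] [Algebra F A]
  (D : Datum F n R A)

open PreDatum

/-- `aᵢⱼₗ` as a morphism of `Ĉ`. -/
def aHom (i j l : Fin n) : D.tO (D.tO (D.u i) (D.u j)) (D.u l) ⟶
    D.tO (D.u i) (D.tO (D.u j) (D.u l)) := D.a i j l

/-- The inverse of `aᵢⱼₗ`. -/
def aInv (i j l : Fin n) : D.tO (D.u i) (D.tO (D.u j) (D.u l)) ⟶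
    D.tO (D.tO (D.u i) (D.u j)) (D.u l) := (D.a_inv i j l).choose

theorem aHom_aInv (i j l : Fin n) : D.aHom i j l ≫ D.aInv i j l = 𝟙 _ :=
  (D.a_inv i j l).choose_spec.2

theorem aInv_aHom (i j l : Fin n) : D.aInv i j l ≫ D.aHom i j l = 𝟙 _ :=
  (D.a_inv i j l).choose_spec.1

/-- The associativity constraint
`a_{m,s,t} = ∑ (X ⊗̂ (X ⊗̂ X)) aᵢⱼₗ ((Y ⊗̂ Y) ⊗̂ Y)`. -/
def assoc (m s t : D.Ob) : D.tO (D.tO m s) t ⟶ D.tO m (D.tO s t) :=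
  ∑ p : Idx m.vec, ∑ q : Idx s.vec, ∑ r : Idx t.vec,
    D.ten (D.ten (D.π p) (D.π q)) (D.π r) ≫ D.aHom p.1 q.1 r.1 ≫ D.ten (D.ι p) (D.ten (D.ι q) (D.ι r))

/-- The inverse of the associativity constraint. -/
def assocInv (m s t : D.Ob) : D.tO m (D.tO s t) ⟶ D.tO (D.tO m s) t :=
  ∑ p : Idx m.vec, ∑ q : Idx s.vec, ∑ r : Idx t.vec,
    D.ten (D.π p) (D.ten (D.π q) (D.π r)) ≫ D.aInv p.1 q.1 r.1 ≫ D.ten (D.ten (D.ι p) (D.ι q)) (D.ι r)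

variable {D}

theorem ι_assoc {m s t : D.Ob} (p : Idx m.vec) (q : Idx s.vec) (r : Idx t.vec) :
    D.ten (D.ten (D.ι p) (D.ι q)) (D.ι r) ≫ D.assoc m s t =
      D.aHom p.1 q.1 r.1 ≫ D.ten (D.ι p) (D.ten (D.ι q) (D.ι r)) := by
  simp only [assoc, Preadditive.comp_sum]
  rw [Finset.sum_eq_single p, Finset.sum_eq_single q, Finset.sum_eq_single r]
  · rw [← Category.assoc, ten_comp, ten_comp, ι_π_self, ι_π_self, ι_π_self, ten_id, ten_id,
      Category.id_comp]
  · intro b _ hb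
    rw [← Category.assoc, ten_comp, ι_π_ne hb.symm, ten_zero_right, Limits.zero_comp]
  · simp
  · intro b _ hb
    refine Finset.sum_eq_zero fun c _ => ?_
    rw [← Category.assoc, ten_comp, ten_comp, ι_π_ne hb.symm, ten_zero_right, ten_zero_left,
      Limits.zero_comp]
  · simp
  · intro b _ hb
    refine Finset.sum_eq_zero fun c _ => Finset.sum_eq_zero fun d _ => ?_
    rw [← Category.assoc, ten_comp, ten_comp, ι_π_ne hb.symm, ten_zero_left, ten_zero_left,
      Limits.zero_comp]
  · simp

theorem ι_assocInv {m s t : D.Ob} (p : Idx m.vec) (q : Idx s.vec) (r : Idx t.vec) :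
    D.ten (D.ι p) (D.ten (D.ι q) (D.ι r)) ≫ D.assocInv m s t =
      D.aInv p.1 q.1 r.1 ≫ D.ten (D.ten (D.ι p) (D.ι q)) (D.ι r) := by
  simp only [assocInv, Preadditive.comp_sum]
  rw [Finset.sum_eq_single p, Finset.sum_eq_single q, Finset.sum_eq_single r]
  · rw [← Category.assoc, ten_comp, ten_comp, ι_π_self, ι_π_self, ι_π_self, ten_id, ten_id,
      Category.id_comp]
  · intro b _ hb
    rw [← Category.assoc, ten_comp, ten_comp, ι_π_ne hb.symm, ten_zero_right, ten_zero_right,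
      Limits.zero_comp]
  · simp
  · intro b _ hb
    refine Finset.sum_eq_zero fun c _ => ?_
    rw [← Category.assoc, ten_comp, ten_comp, ι_π_ne hb.symm, ten_zero_left, ten_zero_right,
      Limits.zero_comp]
  · simp
  · intro b _ hb
    refine Finset.sum_eq_zero fun c _ => Finset.sum_eq_zero fun d _ => ?_
    rw [← Category.assoc, ten_comp, ι_π_ne hb.symm, ten_zero_left, Limits.zero_comp]
  · simp

theorem ten_ext_right {m s t l : D.Ob} {f g : D.tO m (D.tO s t) ⟶ l}
    (h : ∀ (p : Idx m.vec) (q : Idx s.vec) (r : Idx t.vec),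
      D.ten (D.ι p) (D.ten (D.ι q) (D.ι r)) ≫ f = D.ten (D.ι p) (D.ten (D.ι q) (D.ι r)) ≫ g) :
    f = g := by
  have key : ∀ f : D.tO m (D.tO s t) ⟶ l, f = ∑ r : Idx t.vec, ∑ q : Idx s.vec, ∑ p : Idx m.vec,
      D.ten (D.π p) (D.ten (D.π q) (D.π r)) ≫ D.ten (D.ι p) (D.ten (D.ι q) (D.ι r)) ≫ f := by
    intro f
    conv_lhs => rw [← Category.id_comp f, ← ten_id, ← ten_id, ← sum_π_ι m, ← sum_π_ι s, ← sum_π_ι t]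
    simp only [ten_sum_left, ten_sum_right, Preadditive.sum_comp, ← ten_comp, Category.assoc]
  rw [key f, key g]
  simp only [h]

theorem assoc_assocInv (m s t : D.Ob) : D.assoc m s t ≫ D.assocInv m s t = 𝟙 _ := by
  refine ten_ext_left fun p q r => ?_
  rw [← Category.assoc, ι_assoc, Category.assoc, ι_assocInv, ← Category.assoc, aHom_aInv,
    Category.id_comp, Category.comp_id]

theorem assocInv_assoc (m s t : D.Ob) : D.assocInv m s t ≫ D.assoc m s t = 𝟙 _ := by
  refine ten_ext_right fun p q r => ?_
  rw [← Category.assoc, ι_assocInv, Category.assoc, ι_assoc, ← Category.assoc, aInv_aHom,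
    Category.id_comp, Category.comp_id]

/-- A morphism `𝐞ᵢ ⟶ 𝐞ⱼ` is given by an element of `eⱼ A eᵢ`. -/
theorem exists_elt {i j : Fin n} (f : D.u i ⟶ D.u j) :
    ∃ x ∈ D.S.peirce j i, f = D.S.elt j i x :=
  IdempotentSystem.exists_eq_elt (S := D.S.toIdempotentSystem) f

theorem aHom_nat {i j l i' j' l' : Fin n} (x : D.u i ⟶ D.u i') (y : D.u j ⟶ D.u j')
    (z : D.u l ⟶ D.u l') :
    D.ten (D.ten x y) z ≫ D.aHom i' j' l' = D.aHom i j l ≫ D.ten x (D.ten y z) := by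
  obtain ⟨x, hx, rfl⟩ := exists_elt x
  obtain ⟨y, hy, rfl⟩ := exists_elt y
  obtain ⟨z, hz, rfl⟩ := exists_elt z
  exact (D.a_nat i j l i' j' l' x hx y hy z hz).symm

theorem comp_π_ι {m s : D.Ob} (f : m ⟶ s) : f = ∑ p : Idx s.vec, (f ≫ D.π p) ≫ D.ι p := by
  conv_lhs => rw [← Category.comp_id f, ← sum_π_ι, Preadditive.comp_sum]
  simp only [Category.assoc]

theorem assoc_nat {m₁ m₂ m₃ s₁ s₂ s₃ : D.Ob} (f₁ : m₁ ⟶ s₁) (f₂ : m₂ ⟶ s₂) (f₃ : m₃ ⟶ s₃) :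
    D.ten (D.ten f₁ f₂) f₃ ≫ D.assoc s₁ s₂ s₃ = D.assoc m₁ m₂ m₃ ≫ D.ten f₁ (D.ten f₂ f₃) := by
  refine ten_ext_left fun p q r => ?_
  rw [← Category.assoc, ten_comp, ten_comp, ← Category.assoc, ι_assoc, Category.assoc, ten_comp,
    ten_comp, comp_π_ι (D.ι p ≫ f₁), comp_π_ι (D.ι q ≫ f₂), comp_π_ι (D.ι r ≫ f₃)]
  simp only [ten_sum_left, ten_sum_right, Preadditive.sum_comp, Preadditive.comp_sum, ← ten_comp]
  refine Finset.sum_congr rfl fun _ _ => Finset.sum_congr rfl fun _ _ =>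
    Finset.sum_congr rfl fun _ _ => ?_
  rw [Category.assoc, ι_assoc, ten_comp, ten_comp, ten_comp, ten_comp, ← Category.assoc, aHom_nat, Category.assoc]
  simp only [ten_comp]


theorem assoc_pt_eq (i j l : Fin n) : D.assoc (D.u i) (D.u j) (D.u l) = D.aHom i j l := by
  have h : D.ten (D.ten (𝟙 (D.u i)) (𝟙 (D.u j))) (𝟙 (D.u l)) ≫ D.assoc (D.u i) (D.u j) (D.u l) =
      D.aHom i j l ≫ D.ten (𝟙 (D.u i)) (D.ten (𝟙 (D.u j)) (𝟙 (D.u l))) := by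
    have h := ι_assoc (D := D) (m := D.u i) (s := D.u j) (t := D.u l) (pt i) (pt j) (pt l)
    rw [ι_pt, ι_pt, ι_pt] at h
    exact h
  simpa only [ten_id, Category.id_comp, Category.comp_id] using h

theorem assoc_mid (i l : Fin n) (m : D.Ob) : D.assoc (D.u i) m (D.u l) =
    ∑ p : Idx m.vec, D.ten (D.ten (𝟙 (D.u i)) (D.π p)) (𝟙 (D.u l)) ≫ D.aHom i p.1 l ≫
      D.ten (𝟙 (D.u i)) (D.ten (D.ι p) (𝟙 (D.u l))) := by
  have h : 𝟙 (D.tO (D.tO (D.u i) m) (D.u l)) = ∑ p : Idx m.vec,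
      D.ten (D.ten (𝟙 (D.u i)) (D.π p)) (𝟙 (D.u l)) ≫
        D.ten (D.ten (𝟙 (D.u i)) (D.ι p)) (𝟙 (D.u l)) := by
    rw [← ten_id, ← ten_id, ← sum_π_ι m]
    simp only [ten_sum_left, ten_sum_right, ten_comp, Category.comp_id]
  rw [← Category.id_comp (D.assoc _ _ _), h, Preadditive.sum_comp]
  refine Finset.sum_congr rfl fun p _ => ?_
  rw [Category.assoc, assoc_nat, assoc_pt_eq]

theorem assoc_left (j l : Fin n) (m : D.Ob) : D.assoc m (D.u j) (D.u l) =
    ∑ p : Idx m.vec, D.ten (D.ten (D.π p) (𝟙 (D.u j))) (𝟙 (D.u l)) ≫ D.aHom p.1 j l ≫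
      D.ten (D.ι p) (D.ten (𝟙 (D.u j)) (𝟙 (D.u l))) := by
  have h : 𝟙 (D.tO (D.tO m (D.u j)) (D.u l)) = ∑ p : Idx m.vec,
      D.ten (D.ten (D.π p) (𝟙 (D.u j))) (𝟙 (D.u l)) ≫
        D.ten (D.ten (D.ι p) (𝟙 (D.u j))) (𝟙 (D.u l)) := by
    rw [← ten_id, ← ten_id, ← sum_π_ι m]
    simp only [ten_sum_left, ten_comp, Category.comp_id]
  rw [← Category.id_comp (D.assoc _ _ _), h, Preadditive.sum_comp]
  refine Finset.sum_congr rfl fun p _ => ?_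
  rw [Category.assoc, assoc_nat, assoc_pt_eq]

theorem assoc_right (i j : Fin n) (m : D.Ob) : D.assoc (D.u i) (D.u j) m =
    ∑ p : Idx m.vec, D.ten (D.ten (𝟙 (D.u i)) (𝟙 (D.u j))) (D.π p) ≫ D.aHom i j p.1 ≫
      D.ten (𝟙 (D.u i)) (D.ten (𝟙 (D.u j)) (D.ι p)) := by
  have h : 𝟙 (D.tO (D.tO (D.u i) (D.u j)) m) = ∑ p : Idx m.vec,
      D.ten (D.ten (𝟙 (D.u i)) (𝟙 (D.u j))) (D.π p) ≫
        D.ten (D.ten (𝟙 (D.u i)) (𝟙 (D.u j))) (D.ι p) := by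
    rw [← ten_id, ← sum_π_ι m]
    simp only [ten_sum_right, ten_comp, ten_id, Category.comp_id]
  rw [← Category.id_comp (D.assoc _ _ _), h, Preadditive.sum_comp]
  refine Finset.sum_congr rfl fun p _ => ?_
  rw [Category.assoc, assoc_nat, assoc_pt_eq]

theorem pentagon_aux_left (i₁ i₂ i₃ i₄ : Fin n) (p : Idx (D.tObj (unitVec i₂) (unitVec i₃))) :
    (D.tHom (D.S.E (unitVec i₁)) (D.a i₂ i₃ i₄ * D.tHom (D.S.inc p) (D.S.E (unitVec i₄))) *
        D.a i₁ p.1 i₄ *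
        D.tHom (D.tHom (D.S.E (unitVec i₁)) (D.S.prj p) * D.a i₁ i₂ i₃) (D.S.E (unitVec i₄)) :
      D.Mat (D.tObj (unitVec i₁) (D.tObj (unitVec i₂) (D.tObj (unitVec i₃) (unitVec i₄))))
        (D.tObj (D.tObj (D.tObj (unitVec i₁) (unitVec i₂)) (unitVec i₃)) (unitVec i₄))) =
      D.ten (D.aHom i₁ i₂ i₃ ≫ D.ten (𝟙 (D.u i₁)) (D.π (m := D.tO (D.u i₂) (D.u i₃)) p)) (𝟙 (D.u i₄)) ≫ D.aHom i₁ p.1 i₄ ≫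
        D.ten (𝟙 (D.u i₁)) (D.ten (D.ι (m := D.tO (D.u i₂) (D.u i₃)) p) (𝟙 (D.u i₄)) ≫ D.aHom i₂ i₃ i₄) := by
  rfl

theorem pentagon_aux_right (i₁ i₂ i₃ i₄ : Fin n) (p : Idx (D.tObj (unitVec i₃) (unitVec i₄)))
    (q : Idx (D.tObj (unitVec i₁) (unitVec i₂))) :
    (D.tHom (D.S.E (unitVec i₁)) (D.tHom (D.S.E (unitVec i₂)) (D.S.inc p)) *
        D.a i₁ i₂ p.1 * D.tHom (D.S.inc q) (D.S.prj p) * D.a q.1 i₃ i₄ *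
        D.tHom (D.tHom (D.S.prj q) (D.S.E (unitVec i₃))) (D.S.E (unitVec i₄)) :
      D.Mat (D.tObj (unitVec i₁) (D.tObj (unitVec i₂) (D.tObj (unitVec i₃) (unitVec i₄))))
        (D.tObj (D.tObj (D.tObj (unitVec i₁) (unitVec i₂)) (unitVec i₃)) (unitVec i₄))) =
      D.ten (D.ten (D.π (m := D.tO (D.u i₁) (D.u i₂)) q) (𝟙 (D.u i₃))) (𝟙 (D.u i₄)) ≫ D.aHom q.1 i₃ i₄ ≫
        D.ten (D.ι (m := D.tO (D.u i₁) (D.u i₂)) q) (D.π (m := D.tO (D.u i₃) (D.u i₄)) p) ≫ D.aHom i₁ i₂ p.1 ≫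
        D.ten (𝟙 (D.u i₁)) (D.ten (𝟙 (D.u i₂)) (D.ι (m := D.tO (D.u i₃) (D.u i₄)) p)) := by
  rfl

theorem sum_eq {m s : D.Ob} {κ : Type} (T : Finset κ) (f : κ → (m ⟶ s)) :
    (∑ k ∈ T, f k : m ⟶ s) = (Finset.sum (M := D.Mat s.vec m.vec) T f) := rfl

theorem pentagon_aux (i₁ i₂ i₃ i₄ : Fin n) :
    ∑ p : Idx (D.tO (D.u i₂) (D.u i₃)).vec,
      D.ten (D.aHom i₁ i₂ i₃ ≫ D.ten (𝟙 (D.u i₁)) (D.π p)) (𝟙 (D.u i₄)) ≫ D.aHom i₁ p.1 i₄ ≫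
        D.ten (𝟙 (D.u i₁)) (D.ten (D.ι p) (𝟙 (D.u i₄)) ≫ D.aHom i₂ i₃ i₄) =
      ∑ p : Idx (D.tO (D.u i₃) (D.u i₄)).vec, ∑ q : Idx (D.tO (D.u i₁) (D.u i₂)).vec,
      D.ten (D.ten (D.π q) (𝟙 (D.u i₃))) (𝟙 (D.u i₄)) ≫ D.aHom q.1 i₃ i₄ ≫
        D.ten (D.ι q) (D.π p) ≫ D.aHom i₁ i₂ p.1 ≫
        D.ten (𝟙 (D.u i₁)) (D.ten (𝟙 (D.u i₂)) (D.ι p)) := by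
  refine Eq.trans ?_ ((D.a_pentagon i₁ i₂ i₃ i₄).trans ?_)
  · exact (sum_eq _ _).trans (Finset.sum_congr rfl fun p _ => (pentagon_aux_left i₁ i₂ i₃ i₄ p).symm)
  · refine Finset.sum_congr rfl fun p _ => ?_
    exact (Finset.sum_congr rfl fun q _ => (pentagon_aux_right i₁ i₂ i₃ i₄ p q))

theorem pentagon_left (i₁ i₂ i₃ i₄ : Fin n) (p : Idx (D.tO (D.u i₂) (D.u i₃)).vec) :
    D.ten (D.aHom i₁ i₂ i₃) (𝟙 (D.u i₄)) ≫
        (D.ten (D.ten (𝟙 (D.u i₁)) (D.π p)) (𝟙 (D.u i₄)) ≫ D.aHom i₁ p.1 i₄ ≫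
          D.ten (𝟙 (D.u i₁)) (D.ten (D.ι p) (𝟙 (D.u i₄)))) ≫
        D.ten (𝟙 (D.u i₁)) (D.aHom i₂ i₃ i₄) =
      D.ten (D.aHom i₁ i₂ i₃ ≫ D.ten (𝟙 (D.u i₁)) (D.π p)) (𝟙 (D.u i₄)) ≫ D.aHom i₁ p.1 i₄ ≫
        D.ten (𝟙 (D.u i₁)) (D.ten (D.ι p) (𝟙 (D.u i₄)) ≫ D.aHom i₂ i₃ i₄) := by
  rw [Category.assoc, Category.assoc, ten_comp, ← Category.assoc, ten_comp, Category.comp_id,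
    Category.comp_id]

theorem pentagon_right (i₁ i₂ i₃ i₄ : Fin n) (p : Idx (D.tO (D.u i₃) (D.u i₄)).vec)
    (q : Idx (D.tO (D.u i₁) (D.u i₂)).vec) :
    (D.ten (D.ten (D.π q) (𝟙 (D.u i₃))) (𝟙 (D.u i₄)) ≫ D.aHom q.1 i₃ i₄ ≫
        D.ten (D.ι q) (D.ten (𝟙 (D.u i₃)) (𝟙 (D.u i₄)))) ≫
      D.ten (D.ten (𝟙 (D.u i₁)) (𝟙 (D.u i₂))) (D.π p) ≫ D.aHom i₁ i₂ p.1 ≫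
        D.ten (𝟙 (D.u i₁)) (D.ten (𝟙 (D.u i₂)) (D.ι p)) =
      D.ten (D.ten (D.π q) (𝟙 (D.u i₃))) (𝟙 (D.u i₄)) ≫ D.aHom q.1 i₃ i₄ ≫
        D.ten (D.ι q) (D.π p) ≫ D.aHom i₁ i₂ p.1 ≫
        D.ten (𝟙 (D.u i₁)) (D.ten (𝟙 (D.u i₂)) (D.ι p)) := by
  rw [Category.assoc, Category.assoc, ← Category.assoc (D.ten (D.ι q) _), ten_comp, ten_id, ten_id,
    Category.comp_id, Category.id_comp]

theorem pentagon_u (i₁ i₂ i₃ i₄ : Fin n) :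
    D.ten (D.aHom i₁ i₂ i₃) (𝟙 (D.u i₄)) ≫
      D.assoc (D.u i₁) (D.tO (D.u i₂) (D.u i₃)) (D.u i₄) ≫
        D.ten (𝟙 (D.u i₁)) (D.aHom i₂ i₃ i₄) =
    D.assoc (D.tO (D.u i₁) (D.u i₂)) (D.u i₃) (D.u i₄) ≫
      D.assoc (D.u i₁) (D.u i₂) (D.tO (D.u i₃) (D.u i₄)) := by
  rw [assoc_mid, assoc_left, assoc_right, Preadditive.sum_comp, Preadditive.comp_sum,
    Preadditive.comp_sum, Finset.sum_congr rfl fun p _ => pentagon_left i₁ i₂ i₃ i₄ p, pentagon_aux]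
  refine Finset.sum_congr rfl fun p _ => ?_
  rw [Preadditive.sum_comp, Finset.sum_congr rfl fun q _ => pentagon_right i₁ i₂ i₃ i₄ p q]

theorem pentagon (m s t v : D.Ob) :
    D.ten (D.assoc m s t) (𝟙 v) ≫ D.assoc m (D.tO s t) v ≫ D.ten (𝟙 m) (D.assoc s t v) =
      D.assoc (D.tO m s) t v ≫ D.assoc m s (D.tO t v) := by
  refine ten_ext_left₄ fun p q r w => ?_
  have h1 : D.ten (D.ten (D.ten (D.ι p) (D.ι q)) (D.ι r)) (D.ι w) ≫
      D.ten (D.assoc m s t) (𝟙 v) ≫ D.assoc m (D.tO s t) v ≫ D.ten (𝟙 m) (D.assoc s t v) =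
      (D.ten (D.aHom p.1 q.1 r.1) (𝟙 (D.u w.1)) ≫
      D.assoc (D.u p.1) (D.tO (D.u q.1) (D.u r.1)) (D.u w.1) ≫
        D.ten (𝟙 (D.u p.1)) (D.aHom q.1 r.1 w.1)) ≫
        D.ten (D.ι p) (D.ten (D.ι q) (D.ten (D.ι r) (D.ι w))) := by
    rw [← Category.assoc, ten_comp, ι_assoc, Category.comp_id,
      ← Category.id_comp (D.ι w), ← ten_comp, Category.assoc, Category.id_comp,
      ← Category.assoc (D.ten (D.ten (D.ι p) (D.ten (D.ι q) (D.ι r))) (D.ι w)), assoc_nat]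
    simp only [Category.assoc, ten_comp]
    rw [ι_assoc, Category.comp_id, Category.id_comp]
  have h2 : D.ten (D.ten (D.ten (D.ι p) (D.ι q)) (D.ι r)) (D.ι w) ≫
      D.assoc (D.tO m s) t v ≫ D.assoc m s (D.tO t v) =
      (D.assoc (D.tO (D.u p.1) (D.u q.1)) (D.u r.1) (D.u w.1) ≫
      D.assoc (D.u p.1) (D.u q.1) (D.tO (D.u r.1) (D.u w.1))) ≫
        D.ten (D.ι p) (D.ten (D.ι q) (D.ten (D.ι r) (D.ι w))) := by
    rw [← Category.assoc, assoc_nat, Category.assoc, assoc_nat, Category.assoc]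
  rw [h1, h2, pentagon_u]

theorem triangle (m s : D.Ob) :
    D.assoc m (D.u 0) s ≫ D.ten (𝟙 m) (eqToHom (D.unit_tO s)) =
      D.ten (eqToHom (D.tO_unit m)) (𝟙 s) := by
  refine ten_ext_left fun p q r => ?_
  obtain rfl : q = pt 0 := Subsingleton.elim (α := Idx (unitVec (0 : Fin n))) _ _
  have ha : D.aHom p.1 0 r.1 = eqToHom (by rw [unit_tO, tO_unit]) := by
    rw [eqToHom_eq]; exact D.a_unit p.1 r.1
  have h : D.ten (D.ten (D.ι p) (𝟙 (D.u 0))) (D.ι r) ≫ D.assoc m (D.u 0) s =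
      D.aHom p.1 0 r.1 ≫ D.ten (D.ι p) (D.ten (𝟙 (D.u 0)) (D.ι r)) := by
    have h := ι_assoc (D := D) (m := m) (s := D.u 0) (t := s) p (pt 0) r
    rw [ι_pt] at h
    exact h
  rw [ι_pt]
  change D.ten (D.ten (D.ι p) (𝟙 (D.u 0))) (D.ι r) ≫ D.assoc m (D.u 0) s ≫
      D.ten (𝟙 m) (eqToHom (D.unit_tO s)) =
    D.ten (D.ten (D.ι p) (𝟙 (D.u 0))) (D.ι r) ≫ D.ten (eqToHom (D.tO_unit m)) (𝟙 s)
  rw [← Category.assoc, h, Category.assoc, ten_comp, unit_nat_left, Category.comp_id,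
    ten_comp, unit_nat_right, Category.comp_id, ha]
  have e1 : D.ten (D.ι p) (eqToHom (D.unit_tO (D.u r.1)) ≫ D.ι r) =
      eqToHom (by rw [unit_tO]) ≫ D.ten (D.ι p) (D.ι r) := by
    rw [← ten_eqToHom_right _ (D.unit_tO (D.u r.1)), ten_comp, Category.id_comp]
  have e2 : D.ten (eqToHom (D.tO_unit (D.u p.1)) ≫ D.ι p) (D.ι r) =
      eqToHom (by rw [tO_unit]) ≫ D.ten (D.ι p) (D.ι r) := by
    rw [← ten_eqToHom_left _ (D.tO_unit (D.u p.1)), ten_comp, Category.id_comp]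
  rw [e1, e2, ← Category.assoc, eqToHom_trans]

end Datum

/-- The tensor category `Ĉ` constructed from the quadruple `(R, A, φ, a)`. -/
def Chat {F R A : Type*} {n : ℕ} [NeZero n] [Field F] [Ring R] [Ring A] [Algebra F A]
    (D : Datum F n R A) : Type := D.toPreDatum.Ob

section Chat

variable {F R A : Type*} {n : ℕ} [NeZero n] [Field F] [Ring R] [Ring A] [Algebra F A]
  (D : Datum F n R A)

open PreDatum

instance : Category (Chat D) := inferInstanceAs (Category D.toPreDatum.Ob)
instance : Preadditive (Chat D) := inferInstanceAs (Preadditive D.toPreDatum.Ob)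
instance : Linear F (Chat D) := inferInstanceAs (Linear F D.toPreDatum.Ob)

instance : MonoidalCategoryStruct (Chat D) where
  tensorObj m s := D.tO m s
  tensorHom f g := D.ten f g
  whiskerLeft m _ _ f := D.ten (𝟙 (m : D.toPreDatum.Ob)) f
  whiskerRight f m := D.ten f (𝟙 (m : D.toPreDatum.Ob))
  tensorUnit := D.u 0
  associator m s t := ⟨D.assoc m s t, D.assocInv m s t, Datum.assoc_assocInv m s t,
    Datum.assocInv_assoc m s t⟩
  leftUnitor m := eqToIso (D.unit_tO m)
  rightUnitor m := eqToIso (D.tO_unit m)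

instance : MonoidalCategory (Chat D) :=
  MonoidalCategory.ofTensorHom
    (id_tensorHom_id := fun m s => ten_id (D := D.toPreDatum) m s)
    (id_tensorHom := fun _ _ _ _ => rfl)
    (tensorHom_id := fun _ _ => rfl)
    (tensorHom_comp_tensorHom := fun f₁ f₂ g₁ g₂ => ten_comp (D := D.toPreDatum) f₁ g₁ f₂ g₂)
    (associator_naturality := fun f₁ f₂ f₃ => Datum.assoc_nat (D := D) f₁ f₂ f₃)
    (leftUnitor_naturality := fun f => unit_nat_left (D := D.toPreDatum) f)
    (rightUnitor_naturality := fun f => unit_nat_right (D := D.toPreDatum) f)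
    (pentagon := fun m s t v => Datum.pentagon (D := D) m s t v)
    (triangle := fun m s => Datum.triangle (D := D) m s)

instance : MonoidalPreadditive (Chat D) where
  whiskerLeft_zero := ten_zero_right (D := D.toPreDatum) _
  zero_whiskerRight := ten_zero_left (D := D.toPreDatum) _
  whiskerLeft_add f g := ten_add_right (D := D.toPreDatum) _ f g
  add_whiskerRight f g := ten_add_left (D := D.toPreDatum) f g _

instance : MonoidalLinear F (Chat D) where
  whiskerLeft_smul _ _ _ r f := ten_smul_right (D := D.toPreDatum) r _ f
  smul_whiskerRight r _ _ f _ := ten_smul_left (D := D.toPreDatum) r f _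

end Chat

/-- Tensor equivalence of tensor categories over `F`: there is an `F`-linear equivalence which is
a (strong) monoidal functor. -/
def TensorEquivalent (F : Type*) [Field F] (C D : Type*) [Category C] [Preadditive C] [Linear F C]
    [MonoidalCategory C] [Category D] [Preadditive D] [Linear F D] [MonoidalCategory D] : Prop :=
  ∃ G : C ⥤ D, G.Additive ∧ G.Linear F ∧ G.IsEquivalence ∧ Nonempty G.Monoidal

/-- `m^σ = (m_{σ⁻¹(1)}, …, m_{σ⁻¹(n)})`. -/
def permVec {n n' : ℕ} (σ : Fin n ≃ Fin n') (m : Fin n → ℕ) : Fin n' → ℕ := fun i => m (σ.symm i)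

/-- The position of `m^σ` that corresponds to the position `(i, k)` of `m`: it is `(σ(i), k)`. -/
def permIdx {n n' : ℕ} (σ : Fin n ≃ Fin n') {m : Fin n → ℕ} (p : Idx m) : Idx (permVec σ m) :=
  ⟨σ p.1, Fin.cast (congrArg m (σ.symm_apply_apply p.1).symm) p.2⟩

/-- The permutation matrix `P_σ(m)`, with `m^σ`-type rows and `m`-type columns. -/
def permMat {n n' : ℕ} (B : Type*) [Ring B] (σ : Fin n ≃ Fin n') (m : Fin n → ℕ) :
    Matrix (Idx (permVec σ m)) (Idx m) B :=
  Matrix.of fun p q => if p = permIdx σ q then 1 else 0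

/-- For the position `p = (i, k)` of `m`, the row matrix `Y_{σ(i),k}` belonging to the position
`(σ(i), k)` of `m^σ`. -/
def IdempotentSystem.prjPerm {F B : Type*} {n n' : ℕ} [Field F] [Ring B] [Algebra F B]
    (S : IdempotentSystem F B n') (σ : Fin n ≃ Fin n') {m : Fin n → ℕ} (p : Idx m) :
    S.BlockMat (unitVec (σ p.1)) (permVec σ m) := S.prj (permIdx σ p)

end Recon

end

open Recon

/-! Every object `m` of `Ĉ` is the direct sum of `m_i` copies of the objects `𝐞ᵢ`, and an
endomorphism of `𝐞ᵢ` is an element of `eᵢ A eᵢ`. Primitivity of `eᵢ` makes `𝐞ᵢ` indecomposable, and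
every indecomposable object is some `𝐞ᵢ` (`exists_eq_u`). Moreover `Ĉ` is skeletal (`eq_of_iso`). By
(KS), modulo the Jacobson radical of `eᵢ A eᵢ`, the `(i, i)`-blocks of two inverse typed matrices
are themselves inverse to each other. A nonzero Noetherian ring has invariant basis number, so these
blocks are square.

Consequently a linear equivalence sends `𝐞ᵢ` to `𝐞_{σ(i)}`, as an equality of objects, for a
bijection `σ` (`exists_perm`). Its action on the spaces `Hom(𝐞ⱼ, 𝐞ᵢ) = eᵢ A eⱼ` glues along the
Peirce decomposition to an algebra isomorphism `δ` (`inducedEquiv`). Since an additive functor is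
determined up to isomorphism by its values on the `𝐞ᵢ`, the equivalence is isomorphic to the
standard functor `m ↦ m^σ`, `X ↦ P_σ δ(X) P_σᵀ` (`comparisonIso`), and a monoidal structure is
transported along that isomorphism. Conversely each pair `(σ, δ)` gives such a standard equivalence.
What remains is to describe the strong monoidal structures on the standard functor.

A natural tensor constraint `μ` is determined by its components `Φ i j` at the pairs `(𝐞ᵢ, 𝐞ⱼ)`. In
the other direction, an invertible family that is natural for `1 × 1`-matrices extends to all
objects (`tensorator`). The axioms can then be tested on summands. Naturality becomes (b)
(`matrix_natural_iff`). Associativity at `(𝐞ᵢ, 𝐞ⱼ, 𝐞ₗ)` becomes (c), once `μ` at a composite object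
is expanded over the summands of that object (`matrix_assoc_iff`). The unit constraint is a scalar
because `e'₁ A' e'₁ = F e'₁`; if it is `α⁻¹`, unitality says (a). Finally, since `Φ i j` is
invertible, skeletality gives `(𝐜ᵢⱼ)^σ = 𝐜'_{σ(i)σ(j)}`, which is (1). The two directions are
`exists_components` and `nonempty_monoidal`.

Identifications such as `(𝐞ᵢ)^σ = 𝐞_{σ(i)}` are propositional equalities of objects, so they appear
as explicit morphisms `uIso` and `eqToHom`. -/

noncomputable section

namespace Recon

/-! ### Skeletality of `Ĉ` and its indecomposable objects -/

section

namespace IdempotentSystem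

variable {F A : Type*} {n : ℕ} [Field F] [Ring A] [Algebra F A] (S : IdempotentSystem F A n)

/-- The map `x ↦ eᵢ x eᵢ` from `A` to the corner `eᵢ A eᵢ`. -/
def toCorner (i : Fin n) : A →+ (S.complete.idem i).Corner where
  toFun x := ⟨S.e i * x * S.e i, x, rfl⟩
  map_zero' := Subtype.ext (by
    change S.e i * 0 * S.e i = 0
    rw [mul_zero, zero_mul])
  map_add' x y := Subtype.ext (by
    change S.e i * (x + y) * S.e i = S.e i * x * S.e i + S.e i * y * S.e i
    rw [mul_add, add_mul])

theorem toCorner_mul {i : Fin n} {x y : A} (hx : x ∈ S.peirce i i) (hy : y ∈ S.peirce i i) :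
    S.toCorner i (x * y) = S.toCorner i x * S.toCorner i y := Subtype.ext (by
  change S.e i * (x * y) * S.e i = S.e i * x * S.e i * (S.e i * y * S.e i)
  rw [e_mul_of_mem hx, mul_e_of_mem hx, e_mul_of_mem hy, mul_e_of_mem hy,
    e_mul_of_mem (mul_mem hx hy), mul_e_of_mem (mul_mem hx hy)])

theorem toCorner_e (i : Fin n) : S.toCorner i (S.e i) = 1 := Subtype.ext (by
  change S.e i * S.e i * S.e i = S.e i
  rw [e_mul_self, e_mul_self])

theorem toCorner_mul_of_mem {i j : Fin n} {x y : A} (hx : x ∈ S.peirce i j) :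
    S.toCorner i (x * y) = S.cornerElt i j x y := Subtype.ext (by
  change S.e i * (x * y) * S.e i = S.e i * (x * S.e j * y) * S.e i
  rw [mul_e_of_mem hx])

instance (i : Fin n) : Nontrivial (S.complete.idem i).Corner :=
  ⟨⟨1, 0, fun h => S.ne_zero i (congrArg Subtype.val h)⟩⟩

/-- Finite dimension passes to the subspace `eᵢ A eᵢ`. The point of the Noetherian property is that
it gives invariant basis number for the quotients of the corner. -/
theorem isNoetherianRing_corner [FiniteDimensional F A] (i : Fin n) :
    IsNoetherianRing (S.complete.idem i).Corner := by
  have hmul : ∀ (r : F) (x : (S.complete.idem i).Corner),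
      (S.toCorner i (algebraMap F A r) * x).1 = r • x.1 := by
    intro r x
    change S.e i * algebraMap F A r * S.e i * x.1 = _
    rw [mul_assoc, ((Subsemigroup.mem_corner_iff (S.complete.idem i)).1 x.2).1,
      ← Algebra.commutes, mul_assoc, ((Subsemigroup.mem_corner_iff (S.complete.idem i)).1 x.2).1,
      Algebra.smul_def]
  -- The unit of the corner is `eᵢ`, so the scalar `r` is represented there by `eᵢ r eᵢ`; this ring
  -- map supplies the `F`-structure.
  let f : F →+* (S.complete.idem i).Corner :=
    { toFun r := S.toCorner i (algebraMap F A r)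
      map_one' := Subtype.ext (by
        change S.e i * algebraMap F A 1 * S.e i = S.e i
        rw [map_one, mul_one, e_mul_self])
      map_mul' r s := Subtype.ext (by
        rw [hmul]
        change S.e i * algebraMap F A (r * s) * S.e i = r • (S.e i * algebraMap F A s * S.e i)
        rw [map_mul, ← Algebra.smul_def, mul_smul_comm, smul_mul_assoc])
      map_zero' := by rw [map_zero, map_zero]
      map_add' r s := by rw [map_add, map_add] }
  let : Module F (S.complete.idem i).Corner := Module.compHom _ f
  have hsmul : ∀ (r : F) (x : (S.complete.idem i).Corner), (r • x).1 = r • x.1 := hmul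
  have : IsScalarTower F (S.complete.idem i).Corner (S.complete.idem i).Corner :=
    ⟨fun r x y => mul_assoc (f r) x y⟩
  let v : (S.complete.idem i).Corner →ₗ[F] A :=
    { toFun := Subtype.val
      map_add' _ _ := rfl
      map_smul' := hsmul }
  have : Module.Finite F (S.complete.idem i).Corner :=
    Module.Finite.of_injective v Subtype.val_injective
  exact IsNoetherianRing.of_finite F _

/-- An entry in block `(i, i)` of `X Y` is a sum over all intermediate blocks. The terms through a
block `j ≠ i` have the form `eᵢ a eⱼ b eᵢ` and are killed by `q`, so after `q` the `(i, i)`-blocks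
alone multiply to the identity. The statement is one-sided because it is applied both to `X Y` and
to `Y X`. -/
theorem map_toCorner_mul_eq_one {Q : Type*} [Ring Q] {i : Fin n}
    (q : (S.complete.idem i).Corner →+* Q)
    (hq : ∀ j, i ≠ j → ∀ a b, q (S.cornerElt i j a b) = 0) {m s : Fin n → ℕ} (X : S.BlockMat m s)
    (Y : S.BlockMat s m) (h : X * Y = S.E m) :
    (Matrix.of fun (a : Fin (m i)) (b : Fin (s i)) => q (S.toCorner i (X.1 ⟨i, a⟩ ⟨i, b⟩))) *
      (Matrix.of fun (a : Fin (s i)) (b : Fin (m i)) => q (S.toCorner i (Y.1 ⟨i, a⟩ ⟨i, b⟩))) =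
        1 := by
  ext a b
  rw [Matrix.mul_apply]
  have h1 : q (S.toCorner i ((X * Y).1 ⟨i, a⟩ ⟨i, b⟩)) =
      (1 : Matrix (Fin (m i)) (Fin (m i)) Q) a b := by
    rw [h, E_apply, Matrix.one_apply]
    by_cases hab : a = b
    · rw [if_pos (by rw [hab]), if_pos hab, toCorner_e, map_one]
    · rw [if_neg (fun h => hab (eq_of_heq (Sigma.mk.inj h).2) : (⟨i, a⟩ : Idx m) ≠ ⟨i, b⟩), if_neg hab, map_zero, map_zero]
  have h2 : q (S.toCorner i ((X * Y).1 ⟨i, a⟩ ⟨i, b⟩)) =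
      ∑ r : Idx s, q (S.toCorner i (X.1 ⟨i, a⟩ r * Y.1 r ⟨i, b⟩)) := by
    rw [hmul_apply]
    exact map_sum (q.toAddMonoidHom.comp (S.toCorner i)) _ _
  rw [← h1, h2, Fintype.sum_sigma, Finset.sum_eq_single i]
  · refine Finset.sum_congr rfl fun c _ => ?_
    exact ((congrArg q (S.toCorner_mul (X.2 ⟨i, a⟩ ⟨i, c⟩) (Y.2 ⟨i, c⟩ ⟨i, b⟩))).trans
      (q.map_mul _ _)).symm
  · intro j _ hj
    refine Finset.sum_eq_zero fun c _ => ?_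
    rw [S.toCorner_mul_of_mem (X.2 ⟨i, a⟩ ⟨j, c⟩), hq j hj.symm]
  · simp

/-- Under (KS), an invertible typed matrix is square: its types agree. -/
theorem eq_of_hmul_eq_E [FiniteDimensional F A]
    (ks : ∀ i j, i ≠ j → ∀ a b, S.cornerElt i j a b ∈ Ring.jacobson (S.complete.idem i).Corner)
    {m s : Fin n → ℕ} (X : S.BlockMat m s) (Y : S.BlockMat s m) (hXY : X * Y = S.E m)
    (hYX : Y * X = S.E s) : m = s := by
  funext i
  have := S.isNoetherianRing_corner i
  -- The corner modulo its Jacobson radical is a nonzero Noetherian ring. It therefore has invariant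
  -- basis number, and mutually inverse rectangular matrices over it are square.
  have : Nontrivial ((S.complete.idem i).Corner ⧸ Ring.jacobson (S.complete.idem i).Corner) :=
    Ideal.Quotient.nontrivial_iff.2 (Ring.jacobson_lt_top _).ne
  have : IsNoetherianRing ((S.complete.idem i).Corner ⧸ Ring.jacobson (S.complete.idem i).Corner) :=
    isNoetherian_of_tower (S.complete.idem i).Corner inferInstance
  have hq : ∀ j, i ≠ j → ∀ a b,
      Ideal.Quotient.mk (Ring.jacobson (S.complete.idem i).Corner) (S.cornerElt i j a b) = 0 :=
    fun j hj a b => Ideal.Quotient.eq_zero_iff_mem.2 (ks i j hj a b)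
  simpa using Matrix.square_of_invertible _ _ (S.map_toCorner_mul_eq_one _ hq X Y hXY)
    (S.map_toCorner_mul_eq_one _ hq Y X hYX)

theorem elt_apply (i j : Fin n) (x : A) (p : Idx (unitVec i)) (q : Idx (unitVec j)) :
    (S.elt i j x).1 p q = S.e i * x * S.e j := rfl

variable {S}

theorem unitVec_hom_ext {i j : Fin n} {X Y : S.BlockMat (unitVec i) (unitVec j)}
    (h : X.1 (pt i) (pt j) = Y.1 (pt i) (pt j)) : X = Y := by
  refine ext_entry fun p q => ?_
  obtain rfl : p = pt i := Subsingleton.elim _ _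
  obtain rfl : q = pt j := Subsingleton.elim _ _
  exact h

theorem elt_hmul_elt {i j k : Fin n} (x y : A) :
    S.elt i j x * S.elt j k y = S.elt i k (x * S.e j * y) := by
  refine unitVec_hom_ext ?_
  rw [hmul_apply, Finset.sum_eq_single (pt j), elt_apply, elt_apply, elt_apply]
  · rw [show S.e i * x * S.e j * (S.e j * y * S.e k) = S.e i * x * (S.e j * S.e j) * y * S.e k by
      noncomm_ring, e_mul_self]
    noncomm_ring
  · intro b _ hb; exact absurd (Subsingleton.elim _ _) hb
  · simp

theorem elt_e (i : Fin n) : S.elt i i (S.e i) = S.E (unitVec i) := by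
  refine unitVec_hom_ext ?_
  rw [elt_apply, E_apply, if_pos rfl, e_mul_self, e_mul_self]; rfl

/-- The entries of a typed matrix, seen as `1 × 1`-matrices. -/
theorem prj_hmul_hmul_inc {m s : Fin n → ℕ} (X : S.BlockMat m s) (p : Idx m) (q : Idx s) :
    S.prj p * X * S.inc q = S.elt p.1 q.1 (X.1 p q) := by
  refine unitVec_hom_ext ?_
  rw [hmul_apply, Finset.sum_eq_single q, hmul_apply, Finset.sum_eq_single p, elt_apply]
  · simp [prj, inc]
  · intro b _ hb; simp [prj, hb]
  · simp
  · intro b _ hb; simp [inc, hb]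
  · simp

end IdempotentSystem

namespace PreDatum

variable {F R A : Type*} {n : ℕ} [NeZero n] [Field F] [Ring R] [Ring A] [Algebra F A]
  {D : PreDatum F n R A}

/-- `Ĉ` is skeletal. This is where (KS) enters; afterwards isomorphisms of objects can be replaced
by equalities of vectors. -/
theorem eq_of_iso [FiniteDimensional F A] {m s : D.Ob} (f : m ≅ s) : m = s :=
  Ob.ext (D.S.toIdempotentSystem.eq_of_hmul_eq_E D.S.ks (m := m.vec) (s := s.vec) f.inv f.hom
    f.hom_inv_id f.inv_hom_id)

theorem u_injective : Function.Injective D.u := by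
  intro i j h
  have h1 : unitVec i j = unitVec j j := congrFun (congrArg Ob.vec h) j
  rw [unitVec_self] at h1
  exact (eq_of_fin_unitVec (⟨0, by omega⟩ : Fin (unitVec i j))).symm

theorem id_u_ne_zero (i : Fin n) : 𝟙 (D.u i) ≠ 0 := by
  intro h
  refine D.S.ne_zero i ?_
  have : (D.S.E (unitVec i)).1 (pt i) (pt i) = 0 := congrArg (fun f => f.1 (pt i) (pt i)) h
  rwa [IdempotentSystem.E_apply, if_pos rfl] at this

theorem elt_id (i : Fin n) : (D.S.elt i i (D.S.e i) : D.u i ⟶ D.u i) = 𝟙 (D.u i) :=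
  IdempotentSystem.elt_e i

theorem elt_comp {i j k : Fin n} (x y : A) :
    (show D.u k ⟶ D.u j from D.S.elt j k y) ≫ (show D.u j ⟶ D.u i from D.S.elt i j x) =
      D.S.elt i k (x * D.S.e j * y) :=
  IdempotentSystem.elt_hmul_elt x y

theorem ι_comp_π {m s : D.Ob} (f : m ⟶ s) (p : Idx m.vec) (q : Idx s.vec) :
    D.ι p ≫ f ≫ D.π q = D.S.elt q.1 p.1 (f.1 q p) :=
  IdempotentSystem.prj_hmul_hmul_inc f q p

theorem u_hom_ext {i j : Fin n} {f g : D.u i ⟶ D.u j}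
    (h : f.1 (pt j) (pt i) = g.1 (pt j) (pt i)) : f = g := IdempotentSystem.unitVec_hom_ext h

/-- The endomorphism ring of `𝐞ᵢ` is `eᵢ A eᵢ` with composition written in the opposite order, so
this is the primitivity of `eᵢ`. -/
theorem u_orthogonal {i : Fin n} {f g : D.u i ⟶ D.u i} (hf : f ≫ f = f) (hg : g ≫ g = g)
    (hfg : f ≫ g = 0) (hgf : g ≫ f = 0) (h : f + g = 𝟙 _) : f = 0 ∨ g = 0 := by
  have key : ∀ f g : D.u i ⟶ D.u i,
      (f ≫ g).1 (pt i) (pt i) = g.1 (pt i) (pt i) * f.1 (pt i) (pt i) := by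
    intro f g
    refine (IdempotentSystem.hmul_apply _ _ _ _).trans ?_
    refine Finset.sum_eq_single (pt i) (fun b _ hb => ?_) fun h => absurd (Finset.mem_univ _) h
    exact absurd (Subsingleton.elim (α := Idx (unitVec i)) _ _) hb
  have hE : (𝟙 (D.u i) : D.u i ⟶ D.u i).1 (pt i) (pt i) = D.S.e i :=
    if_pos rfl
  refine (D.S.primitive i (f.1 (pt i) (pt i)) (g.1 (pt i) (pt i)) ?_ ?_ ?_ ?_ ?_).imp ?_ ?_
  · exact (key f f).symm.trans (by rw [hf])
  · exact (key g g).symm.trans (by rw [hg])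
  · exact (key g f).symm.trans (by rw [hgf]; rfl)
  · exact (key f g).symm.trans (by rw [hfg]; rfl)
  · rw [← hE, ← h]; rfl
  · exact fun h => u_hom_ext h
  · exact fun h => u_hom_ext h

/-- An object that is nonzero and has no nontrivial decomposition of the identity is some `𝐞ᵢ`. -/
theorem exists_eq_u {m : D.Ob} (h0 : 𝟙 m ≠ 0)
    (h : ∀ f g : m ⟶ m, f ≫ f = f → g ≫ g = g → f ≫ g = 0 → g ≫ f = 0 → f + g = 𝟙 m →
      f = 0 ∨ g = 0) : ∃ i, m = D.u i := by
  have hne : ∀ p : Idx m.vec, D.π p ≫ D.ι p ≠ 0 := by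
    intro p hp
    apply id_u_ne_zero (D := D) p.1
    have : D.ι p ≫ (D.π p ≫ D.ι p) ≫ D.π p = 𝟙 _ := by
      rw [Category.assoc, ι_π_self, Category.comp_id, ι_π_self]
    rw [← this, hp, Limits.zero_comp, Limits.comp_zero]
  have hid : ∀ p : Idx m.vec, (D.π p ≫ D.ι p) ≫ D.π p ≫ D.ι p = D.π p ≫ D.ι p := by
    intro p
    rw [Category.assoc, ← Category.assoc (D.ι p), ι_π_self, Category.id_comp]
  -- Each `D.π p ≫ D.ι p` is a nonzero idempotent with an orthogonal complement, so
  -- indecomposability forces it to be the identity. Those of two different positions would be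
  -- orthogonal, hence there is exactly one position.
  have hone : ∀ p : Idx m.vec, D.π p ≫ D.ι p = 𝟙 m := by
    intro p
    have := (h (D.π p ≫ D.ι p) (𝟙 m - D.π p ≫ D.ι p) (hid p) ?_ ?_ ?_ ?_).resolve_left (hne p)
    · exact (sub_eq_zero.1 this).symm
    · simp [Preadditive.sub_comp, Preadditive.comp_sub, hid p]
    · simp [Preadditive.comp_sub, hid p]
    · simp [Preadditive.sub_comp, hid p]
    · abel
  have huniq : ∀ p q : Idx m.vec, p = q := by
    intro p q
    by_contra hpq
    apply hne p
    have : (D.π p ≫ D.ι p) ≫ D.π q ≫ D.ι q = 0 := by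
      rw [Category.assoc, ← Category.assoc (D.ι p), ι_π_ne hpq, Limits.zero_comp, Limits.comp_zero]
    rwa [hone q, Category.comp_id] at this
  have hex : ∃ p : Idx m.vec, True := by
    by_contra hn
    push Not at hn
    apply h0
    rw [← sum_π_ι m]
    exact Finset.sum_eq_zero fun p _ => (hn p).elim
  obtain ⟨⟨i, a⟩, -⟩ := hex
  refine ⟨i, Ob.ext (funext fun j => ?_)⟩
  change m.vec j = unitVec i j
  by_cases hj : j = i
  · subst hj
    rw [unitVec_self]
    have h1 := a.2
    by_contra hm
    have := huniq ⟨j, ⟨0, by omega⟩⟩ ⟨j, ⟨1, by omega⟩⟩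
    simp at this
  · rw [unitVec, Pi.single_eq_of_ne hj]
    by_contra hm
    exact hj (congrArg Sigma.fst (huniq ⟨j, ⟨0, by omega⟩⟩ ⟨i, a⟩))

end PreDatum

end

/-! ### The standard functor `m ↦ m^σ`, `X ↦ P_σ δ(X) P_σᵀ` -/

section

/-- The positions of `m` and of `m^σ` correspond to each other. -/
def permIdxEquiv {n n' : ℕ} (σ : Fin n ≃ Fin n') (m : Fin n → ℕ) :
    Idx m ≃ Idx (permVec σ m) where
  toFun := permIdx σ
  invFun P := ⟨σ.symm P.1, P.2⟩
  left_inv p := Sigma.ext (σ.symm_apply_apply p.1)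
    ((Fin.heq_ext_iff (congrArg m (σ.symm_apply_apply p.1))).2 rfl)
  right_inv P := Sigma.ext (σ.apply_symm_apply P.1)
    ((Fin.heq_ext_iff (congrArg (permVec σ m) (σ.apply_symm_apply P.1))).2 rfl)

theorem permIdx_injective {n n' : ℕ} (σ : Fin n ≃ Fin n') {m : Fin n → ℕ} :
    Function.Injective (permIdx σ (m := m)) := (permIdxEquiv σ m).injective

theorem permIdx_surjective {n n' : ℕ} (σ : Fin n ≃ Fin n') {m : Fin n → ℕ} :
    Function.Surjective (permIdx σ (m := m)) := (permIdxEquiv σ m).surjective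

theorem permIdxEquiv_symm_permIdx {n n' : ℕ} (σ : Fin n ≃ Fin n') {m : Fin n → ℕ} (p : Idx m) :
    (permIdxEquiv σ m).symm (permIdx σ p) = p := (permIdxEquiv σ m).symm_apply_apply p

theorem sum_permIdx {n n' : ℕ} (σ : Fin n ≃ Fin n') {m : Fin n → ℕ} {M : Type*} [AddCommMonoid M]
    (f : Idx (permVec σ m) → M) : ∑ P, f P = ∑ p, f (permIdx σ p) :=
  ((permIdxEquiv σ m).sum_comp f).symm

theorem permVec_unitVec {n n' : ℕ} (σ : Fin n ≃ Fin n') (i : Fin n) :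
    permVec σ (unitVec i) = unitVec (σ i) := by
  funext k
  by_cases h : σ.symm k = i
  · subst h; simp [permVec, unitVec]
  · have : k ≠ σ i := fun hk => h (by rw [hk, Equiv.symm_apply_apply])
    simp [permVec, unitVec, Pi.single_eq_of_ne h, Pi.single_eq_of_ne this]

section PermMat

variable {n n' : ℕ} (B : Type*) [Ring B] (σ : Fin n ≃ Fin n') (m : Fin n → ℕ)

theorem permMat_mul_apply {κ : Type*} (X : Matrix (Idx m) κ B) (p : Idx m) (q : κ) :
    (permMat B σ m * X) (permIdx σ p) q = X p q := by
  rw [Matrix.mul_apply, Finset.sum_eq_single p]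
  · simp [permMat]
  · intro r _ hr
    rw [permMat, Matrix.of_apply, if_neg fun h => hr (permIdx_injective σ h).symm, zero_mul]
  · simp

theorem mul_permMat_transpose_apply {κ : Type*} (X : Matrix κ (Idx m) B) (p : κ) (q : Idx m) :
    (X * (permMat B σ m).transpose) p (permIdx σ q) = X p q := by
  rw [Matrix.mul_apply, Finset.sum_eq_single q]
  · simp [permMat]
  · intro r _ hr
    rw [Matrix.transpose_apply, permMat, Matrix.of_apply,
      if_neg fun h => hr (permIdx_injective σ h).symm, mul_zero]
  · simp

variable {m}

/-- `P_σ(m)` only relabels rows. The two sides of (c) lack this left factor, and cancelling it makes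
them comparable with morphisms into `m^σ`. -/
theorem permMat_mul_injective {κ : Type*} {X Y : Matrix (Idx m) κ B}
    (h : permMat B σ m * X = permMat B σ m * Y) : X = Y := by
  ext p q
  rw [← permMat_mul_apply B σ m X, h, permMat_mul_apply]

end PermMat

/-- A bijection of index sets together with an algebra isomorphism that is compatible with it. -/
structure SystemEquiv {F A A' : Type*} {n n' : ℕ} [Field F] [Ring A] [Algebra F A] [Ring A']
    [Algebra F A'] (S : IdempotentSystem F A n) (S' : IdempotentSystem F A' n') where
  σ : Fin n ≃ Fin n'
  δ : A ≃ₐ[F] A'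
  map_e : ∀ i, δ (S.e i) = S'.e (σ i)

namespace SystemEquiv

section Blocks

variable {F A A' : Type*} {n n' : ℕ} [Field F] [Ring A] [Algebra F A] [Ring A']
  [Algebra F A'] {S : IdempotentSystem F A n} {S' : IdempotentSystem F A' n'} (T : SystemEquiv S S')

open IdempotentSystem

theorem map_mem {i j : Fin n} {x : A} (hx : x ∈ S.peirce i j) :
    T.δ x ∈ S'.peirce (T.σ i) (T.σ j) := by
  obtain ⟨a, rfl⟩ := mem_peirce.1 hx
  rw [map_mul, map_mul, T.map_e, T.map_e]
  exact ⟨T.δ a, rfl⟩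

/-- The matrix `P_σ(m) δ(X) P_σ(s)ᵀ`. -/
def block {m s : Fin n → ℕ} (X : S.BlockMat m s) :
    S'.BlockMat (permVec T.σ m) (permVec T.σ s) :=
  ⟨fun P Q => T.δ (X.1 ((permIdxEquiv T.σ m).symm P) ((permIdxEquiv T.σ s).symm Q)), fun P Q => by
    have := T.map_mem (X.2 ((permIdxEquiv T.σ m).symm P) ((permIdxEquiv T.σ s).symm Q))
    change _ ∈ S'.peirce (T.σ (T.σ.symm P.1)) (T.σ (T.σ.symm Q.1)) at this
    rwa [Equiv.apply_symm_apply, Equiv.apply_symm_apply] at this⟩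

theorem block_apply {m s : Fin n → ℕ} (X : S.BlockMat m s) (p : Idx m) (q : Idx s) :
    (T.block X).1 (permIdx T.σ p) (permIdx T.σ q) = T.δ (X.1 p q) := by
  change T.δ _ = _
  rw [permIdxEquiv_symm_permIdx, permIdxEquiv_symm_permIdx]

theorem block_ext {m s : Fin n → ℕ} {X Y : S'.BlockMat (permVec T.σ m) (permVec T.σ s)}
    (h : ∀ p q, X.1 (permIdx T.σ p) (permIdx T.σ q) = Y.1 (permIdx T.σ p) (permIdx T.σ q)) :
    X = Y := by
  refine ext_entry fun P Q => ?_
  obtain ⟨p, rfl⟩ := permIdx_surjective T.σ P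
  obtain ⟨q, rfl⟩ := permIdx_surjective T.σ Q
  exact h p q

/-- The definition of `block` relabels entries directly, which makes functoriality easy; this is the
way back to the permutation matrices of (b) and (c). -/
theorem block_val {m s : Fin n → ℕ} (X : S.BlockMat m s) :
    permMat A' T.σ m * X.1.map T.δ * (permMat A' T.σ s).transpose = (T.block X).1 := by
  ext P Q
  obtain ⟨p, rfl⟩ := permIdx_surjective T.σ P
  obtain ⟨q, rfl⟩ := permIdx_surjective T.σ Q
  rw [mul_permMat_transpose_apply, permMat_mul_apply, block_apply]
  rfl

theorem block_hmul {m s t : Fin n → ℕ} (X : S.BlockMat m s) (Y : S.BlockMat s t) :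
    T.block (X * Y) = T.block X * T.block Y := by
  refine T.block_ext fun p q => ?_
  rw [block_apply, hmul_apply, hmul_apply, sum_permIdx, map_sum]
  simp only [map_mul, block_apply]

theorem block_E (m : Fin n → ℕ) : T.block (S.E m) = S'.E (permVec T.σ m) := by
  refine T.block_ext fun p q => ?_
  rw [block_apply, E_apply, E_apply, apply_ite T.δ, T.map_e, map_zero]
  simp only [(permIdx_injective T.σ).eq_iff]
  rfl

theorem block_add {m s : Fin n → ℕ} (X Y : S.BlockMat m s) :
    T.block (X + Y) = T.block X + T.block Y :=
  ext_entry fun _ _ => map_add T.δ _ _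

theorem block_smul {m s : Fin n → ℕ} (r : F) (X : S.BlockMat m s) :
    T.block (r • X) = r • T.block X :=
  ext_entry fun _ _ => map_smul T.δ _ _

theorem block_injective {m s : Fin n → ℕ} {X Y : S.BlockMat m s} (h : T.block X = T.block Y) :
    X = Y := by
  refine ext_entry fun p q => T.δ.injective ?_
  rw [← block_apply, h, block_apply]

/-- The columns of the image of `S.inc p` have type `(𝐞ᵢ)^σ`, which is `𝐞_{σ(i)}` only up to a
propositional equality. The second factor performs this change of column type. -/
theorem block_inc_hmul {m : Fin n → ℕ} (p : Idx m) :
    T.block (S.inc p) * S'.inc (permIdx T.σ (pt p.1)) = S'.inc (permIdx T.σ p) := by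
  refine ext_entry fun P Q => ?_
  obtain ⟨r, rfl⟩ := permIdx_surjective T.σ P
  rw [hmul_apply, sum_permIdx, Finset.sum_eq_single (pt p.1), block_apply]
  · simp only [IdempotentSystem.inc, if_true, (permIdx_injective T.σ).eq_iff]
    rw [apply_ite T.δ, T.map_e, map_zero, ite_mul, zero_mul]
    congr 1
    exact S'.e_mul_self _
  · intro b _ hb; exact absurd (Subsingleton.elim _ _) hb
  · simp

theorem mem_of_map_mem {i j : Fin n} {x : A} (hx : T.δ x ∈ S'.peirce (T.σ i) (T.σ j)) :
    x ∈ S.peirce i j := by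
  have : x = S.e i * x * S.e j := T.δ.injective (by
    rw [map_mul, map_mul, T.map_e, T.map_e, e_mul_of_mem hx, mul_e_of_mem hx])
  rw [this]
  exact S.sandwich_mem i j x

theorem block_surjective {m s : Fin n → ℕ} (Y : S'.BlockMat (permVec T.σ m) (permVec T.σ s)) :
    ∃ X : S.BlockMat m s, T.block X = Y := by
  refine ⟨⟨fun p q => T.δ.symm (Y.1 (permIdx T.σ p) (permIdx T.σ q)), fun p q => ?_⟩, ?_⟩
  · refine T.mem_of_map_mem ?_
    rw [AlgEquiv.apply_symm_apply]
    exact Y.2 (permIdx T.σ p) (permIdx T.σ q)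
  · refine T.block_ext fun p q => ?_
    rw [block_apply]
    exact T.δ.apply_symm_apply _

end Blocks

section Functor

variable {F R A R' A' : Type*} {n n' : ℕ} [NeZero n] [NeZero n'] [Field F] [Ring R] [Ring A]
  [Algebra F A] [Ring R'] [Ring A'] [Algebra F A'] {D : PreDatum F n R A} {D' : PreDatum F n' R' A'}
  (T : SystemEquiv D.S.toIdempotentSystem D'.S.toIdempotentSystem)

open PreDatum

/-- The object `m^σ`. -/
def ob (m : D.Ob) : D'.Ob := ⟨permVec T.σ m.vec⟩

/-- The functor `m ↦ m^σ`, `X ↦ P_σ δ(X) P_σᵀ`. -/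
def functor : D.Ob ⥤ D'.Ob where
  obj := T.ob
  map f := T.block f
  map_id m := T.block_E m.vec
  map_comp f g := T.block_hmul g f

/-- The inclusion of the summand of `m^σ` that belongs to the position `p` of `m`. -/
def inc {m : D.Ob} (p : Idx m.vec) : D'.u (T.σ p.1) ⟶ T.functor.obj m :=
  D'.ι (m := T.ob m) (permIdx T.σ p)

/-- The projection to the summand of `m^σ` that belongs to the position `p` of `m`. -/
def prj {m : D.Ob} (p : Idx m.vec) : T.functor.obj m ⟶ D'.u (T.σ p.1) :=
  D'.π (m := T.ob m) (permIdx T.σ p)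

theorem inc_prj_self {m : D.Ob} (p : Idx m.vec) : T.inc p ≫ T.prj p = 𝟙 _ :=
  ι_π_self (D := D') (m := T.ob m) (permIdx T.σ p)

theorem inc_prj_ne {m : D.Ob} {p q : Idx m.vec} (h : p ≠ q) : T.inc p ≫ T.prj q = 0 :=
  ι_π_ne (D := D') (m := T.ob m) fun hpq => h (permIdx_injective T.σ hpq)

theorem sum_prj_inc (m : D.Ob) : ∑ p : Idx m.vec, T.prj p ≫ T.inc p = 𝟙 (T.functor.obj m) := by
  have h : ∑ P : Idx (T.ob m).vec, D'.π P ≫ D'.ι P = 𝟙 (T.ob m) := sum_π_ι (T.ob m)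
  refine Eq.trans ?_ h
  exact (permIdxEquiv T.σ m.vec).sum_comp
    fun P : Idx (permVec T.σ m.vec) => D'.π (m := T.ob m) P ≫ D'.ι (m := T.ob m) P

theorem comp_prj_inc {m : D.Ob} {s : D'.Ob} (f : s ⟶ T.functor.obj m) :
    f = ∑ p : Idx m.vec, (f ≫ T.prj p) ≫ T.inc p := by
  conv_lhs => rw [← Category.comp_id f, ← sum_prj_inc, Preadditive.comp_sum]
  simp only [Category.assoc]

theorem inc_ext {m : D.Ob} {s : D'.Ob} {f g : T.functor.obj m ⟶ s}
    (h : ∀ p : Idx m.vec, T.inc p ≫ f = T.inc p ≫ g) : f = g := by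
  rw [← Category.id_comp f, ← Category.id_comp g, ← sum_prj_inc, Preadditive.sum_comp,
    Preadditive.sum_comp]
  simp only [Category.assoc, h]

instance : T.functor.Additive where
  map_add := T.block_add _ _

instance : T.functor.Linear F where
  map_smul _ r := T.block_smul r _

instance : T.functor.Full where
  map_surjective f := T.block_surjective f

instance : T.functor.Faithful where
  map_injective h := T.block_injective h

instance : T.functor.EssSurj where
  -- The preimage of `m` is `m ∘ σ`, whose image equals `m`.
  mem_essImage m := ⟨⟨fun i => m.vec (T.σ i)⟩, ⟨eqToIso (Ob.ext (funext fun k =>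
    congrArg m.vec (T.σ.apply_symm_apply k)))⟩⟩

theorem functor_u (i : Fin n) : D'.u (T.σ i) = T.functor.obj (D.u i) :=
  Ob.ext (permVec_unitVec T.σ i).symm

theorem eqToHom_apply {m s : D.Ob} (h : m = s) {i : Fin n} (hm : m = D.u i) (p : Idx s.vec)
    (q : Idx m.vec) : (eqToHom h).1 p q = D.S.e i := by
  subst h; subst hm
  obtain rfl : p = pt i := Subsingleton.elim (α := Idx (unitVec i)) _ _
  obtain rfl : q = pt i := Subsingleton.elim (α := Idx (unitVec i)) _ _
  exact if_pos rfl

/-- Between one-summand objects an equality is the `1 × 1`-matrix `(eᵢ)`. This translates (a), which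
is stated entrywise, into scalar multiples of canonical identifications. -/
theorem eq_smul_eqToHom {m s : D.Ob} (h : m = s) {i : Fin n} (hm : m = D.u i) {f : m ⟶ s} {α : F}
    (hf : ∀ p q, f.1 p q = α • D.S.e i) : f = α • eqToHom h := by
  refine IdempotentSystem.ext_entry (S := D.S.toIdempotentSystem) fun p q => ?_
  rw [hf p q, ← eqToHom_apply h hm p q]
  rfl

/-- The identification of `𝐞_{σ(i)}` with `(𝐞ᵢ)^σ`. -/
def uIso (i : Fin n) : D'.u (T.σ i) ≅ T.functor.obj (D.u i) := eqToIso (T.functor_u i)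

theorem inc_pt (i : Fin n) : T.inc (m := D.u i) (pt i) = (T.uIso i).hom := by
  have h : ∀ p q, (T.inc (m := D.u i) (pt i)).1 p q = (1 : F) • D'.S.e (T.σ i) := by
    intro P q
    obtain ⟨p, rfl⟩ := permIdx_surjective (m := unitVec i) T.σ P
    obtain rfl : p = pt i := Subsingleton.elim (α := Idx (unitVec i)) _ _
    rw [one_smul]
    exact if_pos rfl
  rw [eq_smul_eqToHom (T.functor_u i) rfl h, one_smul]
  rfl

theorem prj_pt (i : Fin n) : T.prj (m := D.u i) (pt i) = (T.uIso i).inv := by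
  have h : (T.uIso i).hom ≫ T.prj (m := D.u i) (pt i) = 𝟙 (D'.u (T.σ i)) := by
    rw [← inc_pt]
    exact T.inc_prj_self _
  exact (cancel_epi (T.uIso i).hom).1 (h.trans (T.uIso i).hom_inv_id.symm)

/-- The functor carries inclusions of summands to inclusions of summands, up to `uIso`. Hence
naturality can be used to restrict a constraint to summands. -/
theorem uIso_hom_map_ι {m : D.Ob} (p : Idx m.vec) :
    (T.uIso p.1).hom ≫ T.functor.map (D.ι p) = T.inc p := by
  rw [← inc_pt]
  exact T.block_inc_hmul p

end Functor

end SystemEquiv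

end

/-! ### Extending a tensor constraint from the objects `𝐞ᵢ` to all objects -/

section

namespace SystemEquiv

variable {F R A R' A' : Type*} {n n' : ℕ} [NeZero n] [NeZero n'] [Field F] [Ring R] [Ring A]
  [Algebra F A] [Ring R'] [Ring A'] [Algebra F A']

open PreDatum

section PreDatum

variable {D : PreDatum F n R A} {D' : PreDatum F n' R' A'}
  (T : SystemEquiv D.S.toIdempotentSystem D'.S.toIdempotentSystem)

theorem _root_.Recon.PreDatum.eq_sum_comp_π_ι {m s : D.Ob} (f : m ⟶ s) :
    f = ∑ p : Idx s.vec, (f ≫ D.π p) ≫ D.ι p := by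
  conv_lhs => rw [← Category.comp_id f, ← sum_π_ι, Preadditive.comp_sum]
  simp only [Category.assoc]

/-- The morphism `𝐞_{σ(i)} ⟶ 𝐞_{σ(j)}` that corresponds to a morphism `𝐞ᵢ ⟶ 𝐞ⱼ`. -/
def conj {i j : Fin n} (x : D.u i ⟶ D.u j) : D'.u (T.σ i) ⟶ D'.u (T.σ j) :=
  (T.uIso i).hom ≫ T.functor.map x ≫ (T.uIso j).inv

/-- Conjugation by the identifications reads off the single entry of the image matrix, and that
entry is obtained by applying `δ`. -/
theorem conj_elt {i j : Fin n} (x : A) :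
    T.conj (show D.u i ⟶ D.u j from D.S.elt j i x) = D'.S.elt (T.σ j) (T.σ i) (T.δ x) := by
  rw [conj, ← inc_pt, ← prj_pt]
  refine (ι_comp_π (D := D') (m := T.ob (D.u i)) (s := T.ob (D.u j)) _ (permIdx T.σ (pt i))
    (permIdx T.σ (pt j))).trans (u_hom_ext ?_)
  refine (congrArg (fun z => D'.S.e (T.σ j) * z * D'.S.e (T.σ i))
    (T.block_apply (D.S.elt j i x) (pt j) (pt i))).trans ?_
  change D'.S.e (T.σ j) * T.δ (D.S.e j * x * D.S.e i) * D'.S.e (T.σ i) =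
    D'.S.e (T.σ j) * T.δ x * D'.S.e (T.σ i)
  rw [map_mul, map_mul, T.map_e, T.map_e]
  simp only [← mul_assoc, IdempotentSystem.e_mul_self]
  simp only [mul_assoc, IdempotentSystem.e_mul_self]

theorem conj_uIso_hom {i j : Fin n} (x : D.u i ⟶ D.u j) :
    T.conj x ≫ (T.uIso j).hom = (T.uIso i).hom ≫ T.functor.map x := by
  rw [conj, Category.assoc, Category.assoc, Iso.inv_hom_id, Category.comp_id]

/-- The entries of the image of `f` are the conjugates of the entries of `f`. This reduces
naturality for arbitrary matrices to naturality for `1 × 1`-matrices. -/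
theorem inc_map {m s : D.Ob} (f : m ⟶ s) (p : Idx m.vec) :
    T.inc p ≫ T.functor.map f = ∑ q : Idx s.vec, T.conj (D.ι p ≫ f ≫ D.π q) ≫ T.inc q := by
  have h : ∀ q : Idx s.vec, T.conj (D.ι p ≫ f ≫ D.π q) ≫ T.inc q =
      T.inc p ≫ T.functor.map f ≫ T.functor.map (D.π q ≫ D.ι q) := by
    intro q
    rw [← uIso_hom_map_ι T q, ← Category.assoc, conj_uIso_hom, ← uIso_hom_map_ι T p]
    simp only [Functor.map_comp, Category.assoc]
  simp only [h, ← Preadditive.comp_sum, ← Functor.map_sum]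
  rw [sum_π_ι, CategoryTheory.Functor.map_id, Category.comp_id]

theorem ten_inc_ext {m s : D.Ob} {t : D'.Ob}
    {f g : D'.tO (T.functor.obj m) (T.functor.obj s) ⟶ t}
    (h : ∀ (p : Idx m.vec) (q : Idx s.vec),
      D'.ten (T.inc p) (T.inc q) ≫ f = D'.ten (T.inc p) (T.inc q) ≫ g) : f = g := by
  refine ten_ext fun P Q => ?_
  obtain ⟨p, rfl⟩ := permIdx_surjective (m := m.vec) T.σ P
  obtain ⟨q, rfl⟩ := permIdx_surjective (m := s.vec) T.σ Q
  exact h p q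

theorem ten_inc_ext_left {m s t : D.Ob} {l : D'.Ob}
    {f g : D'.tO (D'.tO (T.functor.obj m) (T.functor.obj s)) (T.functor.obj t) ⟶ l}
    (h : ∀ (p : Idx m.vec) (q : Idx s.vec) (r : Idx t.vec),
      D'.ten (D'.ten (T.inc p) (T.inc q)) (T.inc r) ≫ f =
        D'.ten (D'.ten (T.inc p) (T.inc q)) (T.inc r) ≫ g) : f = g := by
  refine ten_ext_left fun P Q U => ?_
  obtain ⟨p, rfl⟩ := permIdx_surjective (m := m.vec) T.σ P
  obtain ⟨q, rfl⟩ := permIdx_surjective (m := s.vec) T.σ Q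
  obtain ⟨r, rfl⟩ := permIdx_surjective (m := t.vec) T.σ U
  exact h p q r

section Tensorator

variable (Φ : ∀ i j, D'.tO (D'.u (T.σ i)) (D'.u (T.σ j)) ⟶ T.functor.obj (D.tO (D.u i) (D.u j)))
  (Ψ : ∀ i j, T.functor.obj (D.tO (D.u i) (D.u j)) ⟶ D'.tO (D'.u (T.σ i)) (D'.u (T.σ j)))

/-- The tensor constraint with given components at the objects `𝐞ᵢ`, `𝐞ⱼ`. -/
def tensorator (m s : D.Ob) :
    D'.tO (T.functor.obj m) (T.functor.obj s) ⟶ T.functor.obj (D.tO m s) :=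
  ∑ p : Idx m.vec, ∑ q : Idx s.vec,
    D'.ten (T.prj p) (T.prj q) ≫ Φ p.1 q.1 ≫ T.functor.map (D.ten (D.ι p) (D.ι q))

/-- The inverse tensor constraint. -/
def tensoratorInv (m s : D.Ob) :
    T.functor.obj (D.tO m s) ⟶ D'.tO (T.functor.obj m) (T.functor.obj s) :=
  ∑ p : Idx m.vec, ∑ q : Idx s.vec,
    T.functor.map (D.ten (D.π p) (D.π q)) ≫ Ψ p.1 q.1 ≫ D'.ten (T.inc p) (T.inc q)

/-- Orthogonality of inclusions and projections leaves a single term. This restriction formula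
determines the constraint, and later arguments use it as their hypothesis `hμ`. -/
theorem ten_inc_tensorator {m s : D.Ob} (p : Idx m.vec) (q : Idx s.vec) :
    D'.ten (T.inc p) (T.inc q) ≫ T.tensorator Φ m s =
      Φ p.1 q.1 ≫ T.functor.map (D.ten (D.ι p) (D.ι q)) := by
  simp only [tensorator, Preadditive.comp_sum]
  rw [Finset.sum_eq_single p, Finset.sum_eq_single q]
  · rw [← Category.assoc, ten_comp, inc_prj_self, inc_prj_self, ten_id, Category.id_comp]
  · intro b _ hb
    rw [← Category.assoc, ten_comp, T.inc_prj_ne hb.symm, ten_zero_right, Limits.zero_comp]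
  · simp
  · intro b _ hb
    refine Finset.sum_eq_zero fun c _ => ?_
    rw [← Category.assoc, ten_comp, T.inc_prj_ne hb.symm, ten_zero_left, Limits.zero_comp]
  · simp

theorem map_ten_tensoratorInv {m s : D.Ob} (p : Idx m.vec) (q : Idx s.vec) :
    T.functor.map (D.ten (D.ι p) (D.ι q)) ≫ T.tensoratorInv Ψ m s =
      Ψ p.1 q.1 ≫ D'.ten (T.inc p) (T.inc q) := by
  simp only [tensoratorInv, Preadditive.comp_sum]
  rw [Finset.sum_eq_single p, Finset.sum_eq_single q]
  · rw [← Category.assoc, ← Functor.map_comp, ten_comp, ι_π_self, ι_π_self, ten_id,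
      CategoryTheory.Functor.map_id, Category.id_comp]
  · intro b _ hb
    rw [← Category.assoc, ← Functor.map_comp, ten_comp, ι_π_ne hb.symm, ten_zero_right,
      Functor.map_zero, Limits.zero_comp]
  · simp
  · intro b _ hb
    refine Finset.sum_eq_zero fun c _ => ?_
    rw [← Category.assoc, ← Functor.map_comp, ten_comp, ι_π_ne hb.symm, ten_zero_left,
      Functor.map_zero, Limits.zero_comp]
  · simp

theorem map_ten_ext {m s : D.Ob} {t : D'.Ob} {f g : T.functor.obj (D.tO m s) ⟶ t}
    (h : ∀ (p : Idx m.vec) (q : Idx s.vec), T.functor.map (D.ten (D.ι p) (D.ι q)) ≫ f =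
      T.functor.map (D.ten (D.ι p) (D.ι q)) ≫ g) : f = g := by
  have key : ∀ f : T.functor.obj (D.tO m s) ⟶ t, f = ∑ q : Idx s.vec, ∑ p : Idx m.vec,
      T.functor.map (D.ten (D.π p) (D.π q)) ≫ T.functor.map (D.ten (D.ι p) (D.ι q)) ≫ f := by
    intro f
    conv_lhs => rw [← Category.id_comp f, ← CategoryTheory.Functor.map_id, ← ten_id, ← sum_π_ι m, ← sum_π_ι s]
    simp only [ten_sum_left, ten_sum_right, Preadditive.sum_comp, ← ten_comp, Category.assoc,
      Functor.map_sum, Functor.map_comp]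
  rw [key f, key g]
  simp only [h]

variable {Φ Ψ}

theorem tensorator_inv_id (h : ∀ i j, Φ i j ≫ Ψ i j = 𝟙 _) (m s : D.Ob) :
    T.tensorator Φ m s ≫ T.tensoratorInv Ψ m s = 𝟙 _ := by
  refine T.ten_inc_ext fun p q => ?_
  rw [← Category.assoc, ten_inc_tensorator, Category.assoc, map_ten_tensoratorInv,
    ← Category.assoc, h, Category.id_comp, Category.comp_id]

theorem tensorator_id_inv (h : ∀ i j, Ψ i j ≫ Φ i j = 𝟙 _) (m s : D.Ob) :
    T.tensoratorInv Ψ m s ≫ T.tensorator Φ m s = 𝟙 _ := by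
  refine T.map_ten_ext fun p q => ?_
  rw [← Category.assoc, map_ten_tensoratorInv, Category.assoc, ten_inc_tensorator,
    ← Category.assoc, h, Category.id_comp, Category.comp_id]

/-- Restricted to summands of the source and expanded over summands of the target, `f` and `g`
become sums of `1 × 1` entries, to which `hΦ` applies; both sides are biadditive. -/
theorem tensorator_natural
    (hΦ : ∀ {i i' j j' : Fin n} (x : D.u i ⟶ D.u i') (y : D.u j ⟶ D.u j'),
      D'.ten (T.conj x) (T.conj y) ≫ Φ i' j' = Φ i j ≫ T.functor.map (D.ten x y))
    {m m' s s' : D.Ob} (f : m ⟶ m') (g : s ⟶ s') :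
    D'.ten (T.functor.map f) (T.functor.map g) ≫ T.tensorator Φ m' s' =
      T.tensorator Φ m s ≫ T.functor.map (D.ten f g) := by
  refine T.ten_inc_ext fun p q => ?_
  rw [← Category.assoc, ten_comp, ← Category.assoc, ten_inc_tensorator, inc_map, inc_map,
    Category.assoc, ← Functor.map_comp, ten_comp, PreDatum.eq_sum_comp_π_ι (D.ι p ≫ f),
    PreDatum.eq_sum_comp_π_ι (D.ι q ≫ g)]
  simp only [ten_sum_left, ten_sum_right, Preadditive.sum_comp, Preadditive.comp_sum,
    Functor.map_sum]
  refine Finset.sum_congr rfl fun _ _ => Finset.sum_congr rfl fun _ _ => ?_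
  rw [← ten_comp, Category.assoc, ten_inc_tensorator, ← Category.assoc, hΦ, Category.assoc,
    ← Functor.map_comp, ten_comp]
  simp only [Category.assoc]

variable {μ : ∀ m s : D.Ob,
  D'.tO (T.functor.obj m) (T.functor.obj s) ⟶ T.functor.obj (D.tO m s)}

/-- With `m` equal to `𝐞ᵢ ⊗̂ 𝐞ⱼ` and `f` equal to `Φ i j`, this produces the sum on the left of (c).
It is the passage between `μ` at a composite object and the components of `μ`. -/
theorem ten_comp_inc (hμ : ∀ {m s : D.Ob} (p : Idx m.vec) (q : Idx s.vec),
      D'.ten (T.inc p) (T.inc q) ≫ μ m s = Φ p.1 q.1 ≫ T.functor.map (D.ten (D.ι p) (D.ι q)))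
    {m : D.Ob} {s : D'.Ob} (f : s ⟶ T.functor.obj m) (l : Fin n) :
    D'.ten f ((T.uIso l).hom) ≫ μ m (D.u l) =
      ∑ p : Idx m.vec, D'.ten (f ≫ T.prj p) (𝟙 _) ≫ Φ p.1 l ≫
        T.functor.map (D.ten (D.ι p) (𝟙 (D.u l))) := by
  conv_lhs => rw [T.comp_prj_inc f, ten_sum_left, Preadditive.sum_comp]
  have h : ∀ p : Idx m.vec, D'.ten (T.inc p) (T.uIso l).hom ≫ μ m (D.u l) =
      Φ p.1 l ≫ T.functor.map (D.ten (D.ι p) (𝟙 (D.u l))) := by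
    intro p
    rw [← ι_pt, ← inc_pt]
    exact hμ (s := D.u l) p (pt l)
  refine Finset.sum_congr rfl fun p _ => ?_
  rw [← h, ← Category.assoc, ten_comp, Category.id_comp]

/-- The mirror image of `ten_comp_inc`, which produces the sum on the right of (c). -/
theorem ten_inc_comp (hμ : ∀ {m s : D.Ob} (p : Idx m.vec) (q : Idx s.vec),
      D'.ten (T.inc p) (T.inc q) ≫ μ m s = Φ p.1 q.1 ≫ T.functor.map (D.ten (D.ι p) (D.ι q)))
    {m : D.Ob} {s : D'.Ob} (f : s ⟶ T.functor.obj m) (i : Fin n) :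
    D'.ten ((T.uIso i).hom) f ≫ μ (D.u i) m =
      ∑ p : Idx m.vec, D'.ten (𝟙 _) (f ≫ T.prj p) ≫ Φ i p.1 ≫
        T.functor.map (D.ten (𝟙 (D.u i)) (D.ι p)) := by
  conv_lhs => rw [T.comp_prj_inc f, ten_sum_right, Preadditive.sum_comp]
  have h : ∀ p : Idx m.vec, D'.ten (T.uIso i).hom (T.inc p) ≫ μ (D.u i) m =
      Φ i p.1 ≫ T.functor.map (D.ten (𝟙 (D.u i)) (D.ι p)) := by
    intro p
    rw [← ι_pt, ← inc_pt]
    exact hμ (m := D.u i) (pt i) p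
  refine Finset.sum_congr rfl fun p _ => ?_
  rw [← h, ← Category.assoc, ten_comp, Category.id_comp]

end Tensorator

end PreDatum

end SystemEquiv

end

/-! ### Unit and associativity axioms: from components to a monoidal functor -/

section

namespace SystemEquiv

variable {F R A R' A' : Type*} {n n' : ℕ} [NeZero n] [NeZero n'] [Field F] [Ring R] [Ring A]
  [Algebra F A] [Ring R'] [Ring A'] [Algebra F A']

open PreDatum

section Unit

variable {D : PreDatum F n R A} {D' : PreDatum F n' R' A'}
  (T : SystemEquiv D.S.toIdempotentSystem D'.S.toIdempotentSystem)
  {Φ : ∀ i j, D'.tO (D'.u (T.σ i)) (D'.u (T.σ j)) ⟶ T.functor.obj (D.tO (D.u i) (D.u j))}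
  {μ : ∀ m s : D.Ob, D'.tO (T.functor.obj m) (T.functor.obj s) ⟶ T.functor.obj (D.tO m s)}

theorem ten_unit_inc_ext {m : D.Ob} {t : D'.Ob} {f g : D'.tO (D'.u 0) (T.functor.obj m) ⟶ t}
    (h : ∀ q : Idx m.vec, D'.ten (𝟙 (D'.u 0)) (T.inc q) ≫ f =
      D'.ten (𝟙 (D'.u 0)) (T.inc q) ≫ g) : f = g := by
  refine ten_ext fun P Q => ?_
  obtain ⟨q, rfl⟩ := permIdx_surjective (m := m.vec) T.σ Q
  obtain rfl : P = pt 0 := Subsingleton.elim (α := Idx (unitVec (0 : Fin n'))) _ _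
  rw [ι_pt]
  exact h q

theorem ten_inc_unit_ext {m : D.Ob} {t : D'.Ob} {f g : D'.tO (T.functor.obj m) (D'.u 0) ⟶ t}
    (h : ∀ q : Idx m.vec, D'.ten (T.inc q) (𝟙 (D'.u 0)) ≫ f =
      D'.ten (T.inc q) (𝟙 (D'.u 0)) ≫ g) : f = g := by
  refine ten_ext fun Q P => ?_
  obtain ⟨q, rfl⟩ := permIdx_surjective (m := m.vec) T.σ Q
  obtain rfl : P = pt 0 := Subsingleton.elim (α := Idx (unitVec (0 : Fin n'))) _ _
  rw [ι_pt]
  exact h q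

theorem unit_eq (h0 : T.σ 0 = 0) : D'.u 0 = T.functor.obj (D.u 0) := by
  rw [← functor_u, h0]

theorem unit_tO_eq (h0 : T.σ 0 = 0) (i : Fin n) :
    D'.tO (D'.u (T.σ 0)) (D'.u (T.σ i)) = T.functor.obj (D.tO (D.u 0) (D.u i)) := by
  rw [h0, unit_tO, unit_tO, functor_u]

theorem tO_unit_eq (h0 : T.σ 0 = 0) (i : Fin n) :
    D'.tO (D'.u (T.σ i)) (D'.u (T.σ 0)) = T.functor.obj (D.tO (D.u i) (D.u 0)) := by
  rw [h0, tO_unit, tO_unit, functor_u]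

/-- On each summand the component `Φ 0 i` contributes a factor `α`. The unit constraint is therefore
`α⁻¹` times the canonical identification, so that the two scalars cancel. -/
theorem left_unit (h0 : T.σ 0 = 0) {α : F} (hα : α ≠ 0)
    (hl : ∀ i, Φ 0 i = α • eqToHom (T.unit_tO_eq h0 i))
    (hμ : ∀ {m s : D.Ob} (p : Idx m.vec) (q : Idx s.vec),
      D'.ten (T.inc p) (T.inc q) ≫ μ m s = Φ p.1 q.1 ≫ T.functor.map (D.ten (D.ι p) (D.ι q)))
    (m : D.Ob) :
    eqToHom (D'.unit_tO (T.functor.obj m)) =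
      D'.ten (α⁻¹ • eqToHom (T.unit_eq h0)) (𝟙 (T.functor.obj m)) ≫ μ (D.u 0) m ≫
        T.functor.map (eqToHom (D.unit_tO m)) := by
  refine T.ten_unit_inc_ext fun q => ?_
  have h1 : D'.ten (T.uIso 0).hom (T.inc q) ≫ μ (D.u 0) m =
      Φ 0 q.1 ≫ T.functor.map (D.ten (𝟙 (D.u 0)) (D.ι q)) := by
    rw [← ι_pt, ← inc_pt]
    exact hμ (m := D.u 0) (pt 0) q
  have h2 : eqToHom (T.unit_eq h0) =
      eqToHom (show D'.u 0 = D'.u (T.σ 0) by rw [h0]) ≫ (T.uIso 0).hom :=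
    (eqToHom_trans _ (T.functor_u 0)).symm
  have h3 : D'.ten (𝟙 (D'.u 0)) (T.inc q) ≫ D'.ten (α⁻¹ • eqToHom (T.unit_eq h0)) (𝟙 _) =
      α⁻¹ • eqToHom (by rw [h0]) ≫ D'.ten (T.uIso 0).hom (T.inc q) := by
    rw [ten_comp, Category.id_comp, Category.comp_id, ten_smul_left, h2,
      ← ten_eqToHom_left _ (show D'.u 0 = D'.u (T.σ 0) by rw [h0]), ten_comp, Category.id_comp]
  rw [unit_nat_left, ← Category.assoc, h3, Linear.smul_comp, Category.assoc, ← Category.assoc _ _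
    (T.functor.map _), h1, hl, Linear.smul_comp, Linear.smul_comp, Linear.comp_smul, smul_smul,
    inv_mul_cancel₀ hα, one_smul, Category.assoc, ← Functor.map_comp, unit_nat_left,
    Functor.map_comp, eqToHom_map, ← T.uIso_hom_map_ι]
  simp only [uIso, eqToIso.hom, eqToHom_trans_assoc]

theorem right_unit (h0 : T.σ 0 = 0) {α : F} (hα : α ≠ 0)
    (hr : ∀ i, Φ i 0 = α • eqToHom (T.tO_unit_eq h0 i))
    (hμ : ∀ {m s : D.Ob} (p : Idx m.vec) (q : Idx s.vec),
      D'.ten (T.inc p) (T.inc q) ≫ μ m s = Φ p.1 q.1 ≫ T.functor.map (D.ten (D.ι p) (D.ι q)))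
    (m : D.Ob) :
    eqToHom (D'.tO_unit (T.functor.obj m)) =
      D'.ten (𝟙 (T.functor.obj m)) (α⁻¹ • eqToHom (T.unit_eq h0)) ≫ μ m (D.u 0) ≫
        T.functor.map (eqToHom (D.tO_unit m)) := by
  refine T.ten_inc_unit_ext fun q => ?_
  have h1 : D'.ten (T.inc q) (T.uIso 0).hom ≫ μ m (D.u 0) =
      Φ q.1 0 ≫ T.functor.map (D.ten (D.ι q) (𝟙 (D.u 0))) := by
    rw [← ι_pt, ← inc_pt]
    exact hμ (s := D.u 0) q (pt 0)
  have h2 : eqToHom (T.unit_eq h0) =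
      eqToHom (show D'.u 0 = D'.u (T.σ 0) by rw [h0]) ≫ (T.uIso 0).hom :=
    (eqToHom_trans _ (T.functor_u 0)).symm
  have h3 : D'.ten (T.inc q) (𝟙 (D'.u 0)) ≫ D'.ten (𝟙 _) (α⁻¹ • eqToHom (T.unit_eq h0)) =
      α⁻¹ • eqToHom (by rw [h0]) ≫ D'.ten (T.inc q) (T.uIso 0).hom := by
    rw [ten_comp, Category.id_comp, Category.comp_id, ten_smul_right, h2,
      ← ten_eqToHom_right _ (show D'.u 0 = D'.u (T.σ 0) by rw [h0]), ten_comp, Category.id_comp]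
  rw [unit_nat_right, ← Category.assoc, h3, Linear.smul_comp, Category.assoc, ← Category.assoc _ _
    (T.functor.map _), h1, hr, Linear.smul_comp, Linear.smul_comp, Linear.comp_smul, smul_smul,
    inv_mul_cancel₀ hα, one_smul, Category.assoc, ← Functor.map_comp, unit_nat_right,
    Functor.map_comp, eqToHom_map, ← T.uIso_hom_map_ι]
  simp only [uIso, eqToIso.hom, eqToHom_trans_assoc]

end Unit

section Assoc

variable {D : Datum F n R A} {D' : Datum F n' R' A'}
  (T : SystemEquiv D.S.toIdempotentSystem D'.S.toIdempotentSystem)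
  {Φ : ∀ i j, D'.tO (D'.u (T.σ i)) (D'.u (T.σ j)) ⟶ T.functor.obj (D.tO (D.u i) (D.u j))}
  {μ : ∀ m s : D.Ob, D'.tO (T.functor.obj m) (T.functor.obj s) ⟶ T.functor.obj (D.tO m s)}

theorem inc_assoc {m s t : D.Ob} (p : Idx m.vec) (q : Idx s.vec) (r : Idx t.vec) :
    D'.ten (D'.ten (T.inc p) (T.inc q)) (T.inc r) ≫ D'.assoc _ _ _ =
      D'.aHom (T.σ p.1) (T.σ q.1) (T.σ r.1) ≫ D'.ten (T.inc p) (D'.ten (T.inc q) (T.inc r)) :=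
  Datum.ι_assoc (D := D') (m := T.ob m) (s := T.ob s) (t := T.ob t) (permIdx T.σ p)
    (permIdx T.σ q) (permIdx T.σ r)

/-- Both composites are determined by their restrictions to summands. There the inclusions are moved
past `μ` and past both associators by naturality, and what remains is `hc` for the labels of the
three summands. -/
theorem associativity
    (hnat : ∀ {m m' s s' : D.Ob} (f : m ⟶ m') (g : s ⟶ s'),
      D'.ten (T.functor.map f) (T.functor.map g) ≫ μ m' s' = μ m s ≫ T.functor.map (D.ten f g))
    (hμ : ∀ {m s : D.Ob} (p : Idx m.vec) (q : Idx s.vec),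
      D'.ten (T.inc p) (T.inc q) ≫ μ m s = Φ p.1 q.1 ≫ T.functor.map (D.ten (D.ι p) (D.ι q)))
    (hc : ∀ i j l, D'.ten (Φ i j) (T.uIso l).hom ≫ μ (D.tO (D.u i) (D.u j)) (D.u l) ≫
        T.functor.map (D.aHom i j l) =
      D'.aHom (T.σ i) (T.σ j) (T.σ l) ≫ D'.ten (T.uIso i).hom (Φ j l) ≫
        μ (D.u i) (D.tO (D.u j) (D.u l)))
    (m s t : D.Ob) :
    D'.ten (μ m s) (𝟙 (T.functor.obj t)) ≫ μ (D.tO m s) t ≫ T.functor.map (D.assoc m s t) =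
      D'.assoc (T.functor.obj m) (T.functor.obj s) (T.functor.obj t) ≫
        D'.ten (𝟙 (T.functor.obj m)) (μ s t) ≫ μ m (D.tO s t) := by
  refine T.ten_inc_ext_left fun p q r => ?_
  have hl : D'.ten (D'.ten (T.inc p) (T.inc q)) (T.inc r) ≫
      D'.ten (μ m s) (𝟙 (T.functor.obj t)) ≫ μ (D.tO m s) t ≫ T.functor.map (D.assoc m s t) =
      (D'.ten (Φ p.1 q.1) (T.uIso r.1).hom ≫ μ (D.tO (D.u p.1) (D.u q.1)) (D.u r.1) ≫
        T.functor.map (D.aHom p.1 q.1 r.1)) ≫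
        T.functor.map (D.ten (D.ι p) (D.ten (D.ι q) (D.ι r))) := by
    rw [← Category.assoc, ten_comp, hμ, Category.comp_id, ← T.uIso_hom_map_ι r, ← ten_comp,
      Category.assoc, ← Category.assoc _ (μ _ _), hnat]
    simp only [Category.assoc]
    rw [← Functor.map_comp, ← Functor.map_comp, Datum.ι_assoc]
  have hr : D'.ten (D'.ten (T.inc p) (T.inc q)) (T.inc r) ≫
      D'.assoc (T.functor.obj m) (T.functor.obj s) (T.functor.obj t) ≫
        D'.ten (𝟙 (T.functor.obj m)) (μ s t) ≫ μ m (D.tO s t) =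
      (D'.aHom (T.σ p.1) (T.σ q.1) (T.σ r.1) ≫ D'.ten (T.uIso p.1).hom (Φ q.1 r.1) ≫
        μ (D.u p.1) (D.tO (D.u q.1) (D.u r.1))) ≫
        T.functor.map (D.ten (D.ι p) (D.ten (D.ι q) (D.ι r))) := by
    rw [← Category.assoc, inc_assoc, Category.assoc, ← Category.assoc _ _ (μ _ _), ten_comp, hμ,
      Category.comp_id, ← T.uIso_hom_map_ι p, ← ten_comp, Category.assoc, hnat]
    simp only [Category.assoc]
  rw [hl, hr, hc]

/-- The functor `m ↦ m^σ` between the tensor categories. -/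
def chatFunctor : Chat D ⥤ Chat D' := T.functor

/-- Here `hl` and `hr` express (a), `hΦ` expresses (b) and `hc` expresses (c), all as equations
between morphisms. Together with the inverse components `Ψ` they are what the extended constraint
needs in order to be strong monoidal. -/
theorem nonempty_monoidal
    {Ψ : ∀ i j, T.functor.obj (D.tO (D.u i) (D.u j)) ⟶ D'.tO (D'.u (T.σ i)) (D'.u (T.σ j))}
    (hΦΨ : ∀ i j, Φ i j ≫ Ψ i j = 𝟙 _) (hΨΦ : ∀ i j, Ψ i j ≫ Φ i j = 𝟙 _)
    (h0 : T.σ 0 = 0) {α : F} (hα : α ≠ 0)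
    (hl : ∀ i, Φ 0 i = α • eqToHom (T.unit_tO_eq h0 i))
    (hr : ∀ i, Φ i 0 = α • eqToHom (T.tO_unit_eq h0 i))
    (hΦ : ∀ {i i' j j' : Fin n} (x : D.u i ⟶ D.u i') (y : D.u j ⟶ D.u j'),
      D'.ten (T.conj x) (T.conj y) ≫ Φ i' j' = Φ i j ≫ T.functor.map (D.ten x y))
    (hc : ∀ i j l, (∑ p : Idx (D.tO (D.u i) (D.u j)).vec,
        D'.ten (Φ i j ≫ T.prj p) (𝟙 (D'.u (T.σ l))) ≫ Φ p.1 l ≫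
          T.functor.map (D.ten (D.ι p) (𝟙 (D.u l)))) ≫ T.functor.map (D.aHom i j l) =
      D'.aHom (T.σ i) (T.σ j) (T.σ l) ≫ ∑ p : Idx (D.tO (D.u j) (D.u l)).vec,
        D'.ten (𝟙 (D'.u (T.σ i))) (Φ j l ≫ T.prj p) ≫ Φ i p.1 ≫
          T.functor.map (D.ten (𝟙 (D.u i)) (D.ι p))) :
    Nonempty T.chatFunctor.Monoidal := by
  have hμ : ∀ {m s : D.Ob} (p : Idx m.vec) (q : Idx s.vec),
      D'.ten (T.inc p) (T.inc q) ≫ T.tensorator Φ m s =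
        Φ p.1 q.1 ≫ T.functor.map (D.ten (D.ι p) (D.ι q)) := T.ten_inc_tensorator Φ
  have hnat : ∀ {m m' s s' : D.Ob} (f : m ⟶ m') (g : s ⟶ s'),
      D'.ten (T.functor.map f) (T.functor.map g) ≫ T.tensorator Φ m' s' =
        T.tensorator Φ m s ≫ T.functor.map (D.ten f g) := T.tensorator_natural hΦ
  have hnatl : ∀ {m s : D.Ob} (f : m ⟶ s) (t : D.Ob),
      D'.ten (T.functor.map f) (𝟙 (T.functor.obj t)) ≫ T.tensorator Φ s t =
        T.tensorator Φ m t ≫ T.functor.map (D.ten f (𝟙 t)) := by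
    intro m s f t
    rw [← CategoryTheory.Functor.map_id, hnat]
  have hnatr : ∀ {m s : D.Ob} (t : D.Ob) (f : m ⟶ s),
      D'.ten (𝟙 (T.functor.obj t)) (T.functor.map f) ≫ T.tensorator Φ t s =
        T.tensorator Φ t m ≫ T.functor.map (D.ten (𝟙 t) f) := by
    intro m s t f
    rw [← CategoryTheory.Functor.map_id, hnat]
  -- Expanding `μ` at the composite objects over their summands turns the required identity into
  -- `hc`.
  have hassoc := T.associativity hnat hμ fun i j l => by
    rw [← Category.assoc, T.ten_comp_inc hμ, hc, T.ten_inc_comp hμ]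
  exact ⟨Functor.CoreMonoidal.toMonoidal
    { εIso :=
        { hom := (α⁻¹ • eqToHom (T.unit_eq h0) : D'.u 0 ⟶ T.functor.obj (D.u 0))
          inv := (α • eqToHom (T.unit_eq h0).symm : T.functor.obj (D.u 0) ⟶ D'.u 0)
          hom_inv_id := by
            change (α⁻¹ • eqToHom (T.unit_eq h0)) ≫ (α • eqToHom (T.unit_eq h0).symm) = 𝟙 (D'.u 0)
            rw [Linear.smul_comp, Linear.comp_smul, smul_smul, inv_mul_cancel₀ hα, one_smul,
              eqToHom_trans, eqToHom_refl]
          inv_hom_id := by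
            change (α • eqToHom (T.unit_eq h0).symm) ≫ (α⁻¹ • eqToHom (T.unit_eq h0)) =
              𝟙 (T.functor.obj (D.u 0))
            rw [Linear.smul_comp, Linear.comp_smul, smul_smul, mul_inv_cancel₀ hα, one_smul,
              eqToHom_trans, eqToHom_refl] }
      μIso := fun m s =>
        { hom := T.tensorator Φ m s
          inv := T.tensoratorInv Ψ m s
          hom_inv_id := T.tensorator_inv_id hΦΨ m s
          inv_hom_id := T.tensorator_id_inv hΨΦ m s }
      μIso_hom_natural_left := hnatl
      μIso_hom_natural_right := hnatr
      associativity := hassoc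
      left_unitality := T.left_unit h0 hα hl hμ
      right_unitality := T.right_unit h0 hα hr hμ }⟩

end Assoc

end SystemEquiv

end

/-! ### From a monoidal structure to its components -/

section

namespace SystemEquiv

variable {F R A R' A' : Type*} {n n' : ℕ} [NeZero n] [NeZero n'] [Field F] [Ring R] [Ring A]
  [Algebra F A] [Ring R'] [Ring A'] [Algebra F A']

open PreDatum

/-- This is `e₁ A e₁ = F e₁`; it is the source of the scalar `α`. -/
theorem _root_.Recon.PreDatum.exists_eq_smul_id {D : PreDatum F n R A} (f : D.u 0 ⟶ D.u 0) :
    ∃ α : F, f = α • 𝟙 (D.u 0) := by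
  obtain ⟨α, hα⟩ := D.S.unit_endo _ (f.2 (pt 0) (pt 0))
  refine ⟨α, u_hom_ext (hα.trans (congrArg (fun z => α • z) ?_))⟩
  exact ((IdempotentSystem.E_apply (S := D.S.toIdempotentSystem) _ (pt 0) (pt 0)).trans (if_pos rfl)).symm

section Components

variable {D : Datum F n R A} {D' : Datum F n' R' A'}
  (T : SystemEquiv D.S.toIdempotentSystem D'.S.toIdempotentSystem)

/-- The axioms of a monoidal functor are unfolded into equations written with `ten`, `assoc` and
`eqToHom`, so that the calculus developed for these applies. -/
theorem exists_constraints (hT : T.chatFunctor.Monoidal) :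
    ∃ (μ : ∀ m s : D.Ob, D'.tO (T.functor.obj m) (T.functor.obj s) ⟶ T.functor.obj (D.tO m s))
      (ν : ∀ m s : D.Ob, T.functor.obj (D.tO m s) ⟶ D'.tO (T.functor.obj m) (T.functor.obj s))
      (ε : D'.u 0 ⟶ T.functor.obj (D.u 0)) (η : T.functor.obj (D.u 0) ⟶ D'.u 0),
      (∀ m s, μ m s ≫ ν m s = 𝟙 _) ∧ (∀ m s, ν m s ≫ μ m s = 𝟙 _) ∧ ε ≫ η = 𝟙 _ ∧ η ≫ ε = 𝟙 _ ∧
      (∀ {m m' s s' : D.Ob} (f : m ⟶ m') (g : s ⟶ s'),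
        D'.ten (T.functor.map f) (T.functor.map g) ≫ μ m' s' =
          μ m s ≫ T.functor.map (D.ten f g)) ∧
      (∀ m s t : D.Ob, D'.ten (μ m s) (𝟙 (T.functor.obj t)) ≫ μ (D.tO m s) t ≫
          T.functor.map (D.assoc m s t) =
        D'.assoc (T.functor.obj m) (T.functor.obj s) (T.functor.obj t) ≫
          D'.ten (𝟙 (T.functor.obj m)) (μ s t) ≫ μ m (D.tO s t)) ∧
      (∀ m : D.Ob, eqToHom (D'.unit_tO (T.functor.obj m)) =
        D'.ten ε (𝟙 (T.functor.obj m)) ≫ μ (D.u 0) m ≫ T.functor.map (eqToHom (D.unit_tO m))) ∧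
      (∀ m : D.Ob, eqToHom (D'.tO_unit (T.functor.obj m)) =
        D'.ten (𝟙 (T.functor.obj m)) ε ≫ μ m (D.u 0) ≫ T.functor.map (eqToHom (D.tO_unit m))) :=
  ⟨Functor.LaxMonoidal.μ T.chatFunctor, Functor.OplaxMonoidal.δ T.chatFunctor,
    Functor.LaxMonoidal.ε T.chatFunctor, Functor.OplaxMonoidal.η T.chatFunctor,
    Functor.Monoidal.μ_δ T.chatFunctor, Functor.Monoidal.δ_μ T.chatFunctor,
    Functor.Monoidal.ε_η T.chatFunctor, Functor.Monoidal.η_ε T.chatFunctor,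
    Functor.LaxMonoidal.μ_natural T.chatFunctor,
    Functor.LaxMonoidal.associativity (F := T.chatFunctor),
    Functor.LaxMonoidal.left_unitality (F := T.chatFunctor),
    Functor.LaxMonoidal.right_unitality (F := T.chatFunctor)⟩

/-- The components at the objects `𝐞ᵢ`, `𝐞ⱼ` of the constraints of a monoidal structure. -/
theorem exists_components [FiniteDimensional F A'] (hT : T.chatFunctor.Monoidal) :
    ∃ (Φ : ∀ i j, D'.tO (D'.u (T.σ i)) (D'.u (T.σ j)) ⟶ T.functor.obj (D.tO (D.u i) (D.u j)))
      (Ψ : ∀ i j, T.functor.obj (D.tO (D.u i) (D.u j)) ⟶ D'.tO (D'.u (T.σ i)) (D'.u (T.σ j)))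
      (h0 : T.σ 0 = 0) (α : F),
      (∀ i j, Φ i j ≫ Ψ i j = 𝟙 _) ∧ (∀ i j, Ψ i j ≫ Φ i j = 𝟙 _) ∧ α ≠ 0 ∧
      (∀ i, Φ 0 i = α • eqToHom (T.unit_tO_eq h0 i)) ∧
      (∀ i, Φ i 0 = α • eqToHom (T.tO_unit_eq h0 i)) ∧
      (∀ {i i' j j' : Fin n} (x : D.u i ⟶ D.u i') (y : D.u j ⟶ D.u j'),
        D'.ten (T.conj x) (T.conj y) ≫ Φ i' j' = Φ i j ≫ T.functor.map (D.ten x y)) ∧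
      (∀ i j l, (∑ p : Idx (D.tO (D.u i) (D.u j)).vec,
          D'.ten (Φ i j ≫ T.prj p) (𝟙 (D'.u (T.σ l))) ≫ Φ p.1 l ≫
            T.functor.map (D.ten (D.ι p) (𝟙 (D.u l)))) ≫ T.functor.map (D.aHom i j l) =
        D'.aHom (T.σ i) (T.σ j) (T.σ l) ≫ ∑ p : Idx (D.tO (D.u j) (D.u l)).vec,
          D'.ten (𝟙 (D'.u (T.σ i))) (Φ j l ≫ T.prj p) ≫ Φ i p.1 ≫
            T.functor.map (D.ten (𝟙 (D.u i)) (D.ι p))) := by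
  obtain ⟨μ, ν, ε, η, hμν, hνμ, hεη, hηε, hnat, hassoc, hl, hr⟩ := T.exists_constraints hT
  -- The unit constraint is an isomorphism between `𝐞'₁` and `(𝐞₁)^σ`, and skeletality makes the two
  -- objects equal.
  have h0 : T.σ 0 = 0 := by
    have h : D'.u 0 = T.functor.obj (D.u 0) := eq_of_iso ⟨ε, η, hεη, hηε⟩
    rw [← functor_u] at h
    exact (u_injective h).symm
  -- The scalar is read off from the inverse unit constraint `η`. Thus `ε` is `α⁻¹` times the
  -- identification, and unitality then puts the factor `α` itself into the components of `μ`.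
  obtain ⟨α, hα⟩ := PreDatum.exists_eq_smul_id (eqToHom (T.unit_eq h0) ≫ η)
  have hε : eqToHom (T.unit_eq h0) = α • ε := by
    rw [← Category.comp_id (eqToHom (T.unit_eq h0)), ← hηε, ← Category.assoc, hα, Linear.smul_comp,
      Category.id_comp]
  have hα0 : α ≠ 0 := by
    rintro rfl
    refine id_u_ne_zero (D := D'.toPreDatum) 0 ?_
    rw [← eqToHom_refl _ rfl, ← eqToHom_trans (T.unit_eq h0) (T.unit_eq h0).symm, hε, zero_smul,
      Limits.zero_comp]
  have h1 : (T.uIso 0).hom = α • (eqToHom (show D'.u (T.σ 0) = D'.u 0 by rw [h0]) ≫ ε) := by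
    rw [← Linear.comp_smul, ← hε, eqToHom_trans]
    rfl
  -- This is naturality of `μ` at the inclusions of summands: the components at the `𝐞ᵢ` determine
  -- `μ`.
  have hμ : ∀ {m s : D.Ob} (p : Idx m.vec) (q : Idx s.vec),
      D'.ten (T.inc p) (T.inc q) ≫ μ m s = (D'.ten (T.uIso p.1).hom (T.uIso q.1).hom ≫ μ _ _) ≫
        T.functor.map (D.ten (D.ι p) (D.ι q)) := by
    intro m s p q
    rw [← T.uIso_hom_map_ι p, ← T.uIso_hom_map_ι q, ← ten_comp, Category.assoc, hnat,
      Category.assoc]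
  -- The components of `μ` start at `(𝐞ᵢ)^σ ⊗̂ (𝐞ⱼ)^σ`; the factors `uIso` make them start at
  -- `𝐞_{σ(i)} ⊗̂ 𝐞_{σ(j)}`.
  refine ⟨fun i j => D'.ten (T.uIso i).hom (T.uIso j).hom ≫ μ _ _,
    fun i j => ν _ _ ≫ D'.ten (T.uIso i).inv (T.uIso j).inv, h0, α, ?_, ?_, hα0, ?_, ?_, ?_, ?_⟩
  · intro i j
    rw [Category.assoc, ← Category.assoc (μ _ _), hμν, Category.id_comp, ten_comp, Iso.hom_inv_id,
      Iso.hom_inv_id, ten_id]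
  · intro i j
    rw [Category.assoc, ← Category.assoc (D'.ten _ _), ten_comp, Iso.inv_hom_id, Iso.inv_hom_id,
      ten_id, Category.id_comp, hνμ]
  · intro i
    have h2 : D'.ten ε (𝟙 (T.functor.obj (D.u i))) ≫ μ (D.u 0) (D.u i) =
        eqToHom (D'.unit_tO (T.functor.obj (D.u i))) ≫
          T.functor.map (eqToHom (D.unit_tO (D.u i)).symm) := by
      rw [hl, Category.assoc, Category.assoc, ← Functor.map_comp, eqToHom_trans, eqToHom_refl,
        CategoryTheory.Functor.map_id, Category.comp_id]
    have h3 : D'.ten (eqToHom (show D'.u (T.σ 0) = D'.u 0 by rw [h0]) ≫ ε) (T.uIso i).hom =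
        eqToHom (by rw [h0]) ≫ D'.ten (𝟙 (D'.u 0)) (T.uIso i).hom ≫
          D'.ten ε (𝟙 (T.functor.obj (D.u i))) := by
      rw [ten_comp, Category.id_comp, Category.comp_id, ← ten_eqToHom_left (D'.u (T.σ i))
        (show D'.u (T.σ 0) = D'.u 0 by rw [h0]), ten_comp, Category.id_comp]
    beta_reduce
    rw [h1, ten_smul_left, h3, Linear.smul_comp]
    congr 1
    simp only [Category.assoc]
    rw [h2, ← Category.assoc (D'.ten _ _), unit_nat_left, eqToHom_map]
    simp only [uIso, eqToIso.hom, eqToHom_trans]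
  · intro i
    have h2 : D'.ten (𝟙 (T.functor.obj (D.u i))) ε ≫ μ (D.u i) (D.u 0) =
        eqToHom (D'.tO_unit (T.functor.obj (D.u i))) ≫
          T.functor.map (eqToHom (D.tO_unit (D.u i)).symm) := by
      rw [hr, Category.assoc, Category.assoc, ← Functor.map_comp, eqToHom_trans, eqToHom_refl,
        CategoryTheory.Functor.map_id, Category.comp_id]
    have h3 : D'.ten (T.uIso i).hom (eqToHom (show D'.u (T.σ 0) = D'.u 0 by rw [h0]) ≫ ε) =
        eqToHom (by rw [h0]) ≫ D'.ten (T.uIso i).hom (𝟙 (D'.u 0)) ≫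
          D'.ten (𝟙 (T.functor.obj (D.u i))) ε := by
      rw [ten_comp, Category.id_comp, Category.comp_id, ← ten_eqToHom_right (D'.u (T.σ i))
        (show D'.u (T.σ 0) = D'.u 0 by rw [h0]), ten_comp, Category.id_comp]
    beta_reduce
    rw [h1, ten_smul_right, h3, Linear.smul_comp]
    congr 1
    simp only [Category.assoc]
    rw [h2, ← Category.assoc (D'.ten _ _), unit_nat_right, eqToHom_map]
    simp only [uIso, eqToIso.hom, eqToHom_trans]
  · intro i i' j j' x y
    rw [← Category.assoc, ten_comp, conj_uIso_hom, conj_uIso_hom, ← ten_comp, Category.assoc, hnat,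
      Category.assoc]
  · intro i j l
    rw [← T.ten_comp_inc (Φ := fun i j => D'.ten (T.uIso i).hom (T.uIso j).hom ≫ μ _ _) hμ,
      ← T.ten_inc_comp (Φ := fun i j => D'.ten (T.uIso i).hom (T.uIso j).hom ≫ μ _ _) hμ]
    -- Condition (c) is the associativity axiom at three objects `𝐞ᵢ`. The remaining equations only
    -- move the identifications `uIso` across the associator.
    have h4 := hassoc (D.u i) (D.u j) (D.u l)
    rw [Datum.assoc_pt_eq] at h4
    have h5 : D'.ten (D'.ten (T.uIso i).hom (T.uIso j).hom) (T.uIso l).hom ≫ D'.assoc _ _ _ =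
        D'.aHom (T.σ i) (T.σ j) (T.σ l) ≫
          D'.ten (T.uIso i).hom (D'.ten (T.uIso j).hom (T.uIso l).hom) := by
      rw [Datum.assoc_nat, Datum.assoc_pt_eq]
    have h6 : D'.ten (D'.ten (T.uIso i).hom (T.uIso j).hom ≫ μ _ _) (T.uIso l).hom =
        D'.ten (D'.ten (T.uIso i).hom (T.uIso j).hom) (T.uIso l).hom ≫ D'.ten (μ _ _) (𝟙 _) := by
      rw [ten_comp, Category.comp_id]
    have h7 : D'.ten (T.uIso i).hom (D'.ten (T.uIso j).hom (T.uIso l).hom ≫ μ _ _) =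
        D'.ten (T.uIso i).hom (D'.ten (T.uIso j).hom (T.uIso l).hom) ≫ D'.ten (𝟙 _) (μ _ _) := by
      rw [ten_comp, Category.comp_id]
    rw [h6, h7, Category.assoc, Category.assoc, h4, ← Category.assoc, h5]
    simp only [Category.assoc]

end Components

/-! ### Translation between matrix identities and identities of morphisms -/

section Matrices

variable {D : Datum F n R A} {D' : Datum F n' R' A'}
  (T : SystemEquiv D.S.toIdempotentSystem D'.S.toIdempotentSystem)
  (Φ : ∀ i j : Fin n, D'.Mat (permVec T.σ (D.tObj (unitVec i) (unitVec j)))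
    (D'.tObj (unitVec (T.σ i)) (unitVec (T.σ j))))

/-- After `block_val` and `conj_elt` both equations have the same underlying matrices; composition
of morphisms is matrix multiplication in the opposite order. -/
theorem matrix_natural_iff {i i' j j' : Fin n} (x y : A) :
    (Φ i' j').1 * (D'.tHom (D'.S.elt (T.σ i') (T.σ i) (T.δ x))
        (D'.S.elt (T.σ j') (T.σ j) (T.δ y))).1 =
      permMat A' T.σ (D.tObj (unitVec i') (unitVec j')) *
        (D.tHom (D.S.elt i' i x) (D.S.elt j' j y)).1.map T.δ *
        (permMat A' T.σ (D.tObj (unitVec i) (unitVec j))).transpose * (Φ i j).1 ↔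
    D'.ten (T.conj (show D.u i ⟶ D.u i' from D.S.elt i' i x))
        (T.conj (show D.u j ⟶ D.u j' from D.S.elt j' j y)) ≫
        (show D'.tO (D'.u (T.σ i')) (D'.u (T.σ j')) ⟶ T.functor.obj (D.tO (D.u i') (D.u j')) from
          Φ i' j') =
      (show D'.tO (D'.u (T.σ i)) (D'.u (T.σ j)) ⟶ T.functor.obj (D.tO (D.u i) (D.u j)) from
        Φ i j) ≫ T.functor.map (D.ten (show D.u i ⟶ D.u i' from D.S.elt i' i x)
          (show D.u j ⟶ D.u j' from D.S.elt j' j y)) := by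
  rw [block_val, conj_elt, conj_elt]
  exact ⟨fun h => Subtype.ext h, fun h => congrArg Subtype.val h⟩

/-- The sides of (c) are untyped matrices with `σ` not yet applied to their rows. Multiplication on
the left by `P_σ` completes each `δ(X) P_σᵀ` to the typed matrix `T.block X`, and `P_σ` can be
cancelled again for the converse. -/
theorem matrix_assoc_iff (i j l : Fin n) :
    (∑ p : Idx (D.tObj (unitVec i) (unitVec j)),
      (D.a i j l).1.map T.δ * (D.tHom (D.S.inc p) (D.S.E (unitVec l))).1.map T.δ *
        (permMat A' T.σ (D.tObj (unitVec p.1) (unitVec l))).transpose * (Φ p.1 l).1 *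
        (D'.tHom (D'.S.prjPerm T.σ p * Φ i j) (D'.S.E (unitVec (T.σ l)))).1 =
    ∑ p : Idx (D.tObj (unitVec j) (unitVec l)),
      (D.tHom (D.S.E (unitVec i)) (D.S.inc p)).1.map T.δ *
        (permMat A' T.σ (D.tObj (unitVec i) (unitVec p.1))).transpose * (Φ i p.1).1 *
        (D'.tHom (D'.S.E (unitVec (T.σ i))) (D'.S.prjPerm T.σ p * Φ j l)).1 *
        (D'.a (T.σ i) (T.σ j) (T.σ l)).1) ↔
    (∑ p : Idx (D.tO (D.u i) (D.u j)).vec,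
        D'.ten ((show D'.tO (D'.u (T.σ i)) (D'.u (T.σ j)) ⟶ T.functor.obj (D.tO (D.u i) (D.u j))
            from Φ i j) ≫ T.prj p) (𝟙 (D'.u (T.σ l))) ≫
          (show D'.tO (D'.u (T.σ p.1)) (D'.u (T.σ l)) ⟶ T.functor.obj (D.tO (D.u p.1) (D.u l))
            from Φ p.1 l) ≫
          T.functor.map (D.ten (D.ι p) (𝟙 (D.u l)))) ≫ T.functor.map (D.aHom i j l) =
      D'.aHom (T.σ i) (T.σ j) (T.σ l) ≫ ∑ p : Idx (D.tO (D.u j) (D.u l)).vec,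
        D'.ten (𝟙 (D'.u (T.σ i)))
          ((show D'.tO (D'.u (T.σ j)) (D'.u (T.σ l)) ⟶ T.functor.obj (D.tO (D.u j) (D.u l))
            from Φ j l) ≫ T.prj p) ≫
          (show D'.tO (D'.u (T.σ i)) (D'.u (T.σ p.1)) ⟶ T.functor.obj (D.tO (D.u i) (D.u p.1))
            from Φ i p.1) ≫
          T.functor.map (D.ten (𝟙 (D.u i)) (D.ι p)) := by
  have hl : permMat A' T.σ (D.tObj (unitVec i) (D.tObj (unitVec j) (unitVec l))) *
      (∑ p : Idx (D.tObj (unitVec i) (unitVec j)),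
        (D.a i j l).1.map T.δ * (D.tHom (D.S.inc p) (D.S.E (unitVec l))).1.map T.δ *
          (permMat A' T.σ (D.tObj (unitVec p.1) (unitVec l))).transpose * (Φ p.1 l).1 *
          (D'.tHom (D'.S.prjPerm T.σ p * Φ i j) (D'.S.E (unitVec (T.σ l)))).1) =
      (∑ p : Idx (D.tObj (unitVec i) (unitVec j)),
        T.block (D.a i j l * D.tHom (D.S.inc p) (D.S.E (unitVec l))) * Φ p.1 l *
          D'.tHom (D'.S.prjPerm T.σ p * Φ i j) (D'.S.E (unitVec (T.σ l)))).1 := by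
    rw [AddSubmonoidClass.coe_finsetSum, Matrix.mul_sum]
    refine Finset.sum_congr rfl fun p _ => ?_
    rw [← Matrix.map_mul]
    simp only [← Matrix.mul_assoc]
    exact congrArg (fun M => M * (Φ p.1 l).1 *
        (D'.tHom (D'.S.prjPerm T.σ p * Φ i j) (D'.S.E (unitVec (T.σ l)))).1)
      (T.block_val (D.a i j l * D.tHom (D.S.inc p) (D.S.E (unitVec l))))
  have hr : permMat A' T.σ (D.tObj (unitVec i) (D.tObj (unitVec j) (unitVec l))) *
      (∑ p : Idx (D.tObj (unitVec j) (unitVec l)),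
        (D.tHom (D.S.E (unitVec i)) (D.S.inc p)).1.map T.δ *
          (permMat A' T.σ (D.tObj (unitVec i) (unitVec p.1))).transpose * (Φ i p.1).1 *
          (D'.tHom (D'.S.E (unitVec (T.σ i))) (D'.S.prjPerm T.σ p * Φ j l)).1 *
          (D'.a (T.σ i) (T.σ j) (T.σ l)).1) =
      (∑ p : Idx (D.tObj (unitVec j) (unitVec l)),
        T.block (D.tHom (D.S.E (unitVec i)) (D.S.inc p)) * Φ i p.1 *
          D'.tHom (D'.S.E (unitVec (T.σ i))) (D'.S.prjPerm T.σ p * Φ j l) *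
          D'.a (T.σ i) (T.σ j) (T.σ l)).1 := by
    rw [AddSubmonoidClass.coe_finsetSum, Matrix.mul_sum]
    refine Finset.sum_congr rfl fun p _ => ?_
    simp only [← Matrix.mul_assoc]
    exact congrArg (fun M => M * (Φ i p.1).1 *
        (D'.tHom (D'.S.E (unitVec (T.σ i))) (D'.S.prjPerm T.σ p * Φ j l)).1 *
        (D'.a (T.σ i) (T.σ j) (T.σ l)).1)
      (T.block_val (D.tHom (D.S.E (unitVec i)) (D.S.inc p)))
  have hl' : ∀ p : Idx (D.tObj (unitVec i) (unitVec j)),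
      (D'.ten ((show D'.tO (D'.u (T.σ i)) (D'.u (T.σ j)) ⟶ T.functor.obj (D.tO (D.u i) (D.u j))
            from Φ i j) ≫ T.prj (m := D.tO (D.u i) (D.u j)) p) (𝟙 (D'.u (T.σ l))) ≫
          (show D'.tO (D'.u (T.σ p.1)) (D'.u (T.σ l)) ⟶ T.functor.obj (D.tO (D.u p.1) (D.u l))
            from Φ p.1 l) ≫
          T.functor.map (D.ten (D.ι (m := D.tO (D.u i) (D.u j)) p) (𝟙 (D.u l)))) ≫ T.functor.map (D.aHom i j l) =
        T.block (D.a i j l * D.tHom (D.S.inc p) (D.S.E (unitVec l))) * Φ p.1 l *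
          D'.tHom (D'.S.prjPerm T.σ p * Φ i j) (D'.S.E (unitVec (T.σ l))) := by
    intro p
    rw [Category.assoc, Category.assoc, ← Functor.map_comp]
    rfl
  refine Iff.trans ?_ (Iff.of_eq (congrArg₂ Eq ((Preadditive.sum_comp _ _ _).trans
    (Finset.sum_congr rfl fun p _ => hl' p)) (Preadditive.comp_sum _ _ _))).symm
  exact ⟨fun h => Subtype.ext (hl.symm.trans ((congrArg _ h).trans hr)), fun h =>
    permMat_mul_injective A' T.σ (hl.trans ((congrArg Subtype.val h).trans hr.symm))⟩

end Matrices

end SystemEquiv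

end

/-! ### The permutation and the algebra isomorphism of an equivalence -/

section

/-- A nonzero object whose identity is not a sum of two nonzero orthogonal idempotents. -/
def IsIndec {C : Type*} [Category C] [Preadditive C] (X : C) : Prop :=
  𝟙 X ≠ 0 ∧ ∀ f g : X ⟶ X, f ≫ f = f → g ≫ g = g → f ≫ g = 0 → g ≫ f = 0 → f + g = 𝟙 X →
    f = 0 ∨ g = 0

section Indec

variable {C C' : Type*} [Category C] [Preadditive C] [Category C'] [Preadditive C']

theorem IsIndec.of_iso {X Y : C} (e : X ≅ Y) (h : IsIndec X) : IsIndec Y := by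
  refine ⟨fun h0 => h.1 ?_, fun f g hf hg hfg hgf h1 => ?_⟩
  · rw [← e.hom_inv_id, ← Category.id_comp e.inv, h0, Limits.zero_comp, Limits.comp_zero]
  · have hc : ∀ f g : Y ⟶ Y, (e.hom ≫ f ≫ e.inv) ≫ e.hom ≫ g ≫ e.inv =
        e.hom ≫ (f ≫ g) ≫ e.inv := by
      intro f g
      simp
    have hz : ∀ f : Y ⟶ Y, e.hom ≫ f ≫ e.inv = 0 → f = 0 := by
      intro f hf
      have : f = e.inv ≫ (e.hom ≫ f ≫ e.inv) ≫ e.hom := by simp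
      rw [this, hf, Limits.zero_comp, Limits.comp_zero]
    refine (h.2 (e.hom ≫ f ≫ e.inv) (e.hom ≫ g ≫ e.inv) ?_ ?_ ?_ ?_ ?_).imp (hz f) (hz g)
    · rw [hc, hf]
    · rw [hc, hg]
    · rw [hc, hfg, Limits.zero_comp, Limits.comp_zero]
    · rw [hc, hgf, Limits.zero_comp, Limits.comp_zero]
    · rw [← Preadditive.comp_add, ← Preadditive.add_comp, h1, Category.id_comp, e.hom_inv_id]

/-- A fully faithful additive functor identifies the endomorphism rings, and indecomposability
depends only on these. -/
theorem isIndec_obj_iff (G : C ⥤ C') [G.Additive] [G.Full] [G.Faithful] {X : C} :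
    IsIndec (G.obj X) ↔ IsIndec X := by
  have hz : ∀ f : X ⟶ X, G.map f = 0 ↔ f = 0 := fun f => G.map_eq_zero_iff
  refine and_congr (not_congr ?_) ⟨fun h f g hf hg hfg hgf h1 => ?_, fun h f g hf hg hfg hgf h1 => ?_⟩
  · rw [← G.map_id, hz]
  · refine (h (G.map f) (G.map g) ?_ ?_ ?_ ?_ ?_).imp (hz f).1 (hz g).1
    · rw [← G.map_comp, hf]
    · rw [← G.map_comp, hg]
    · rw [← G.map_comp, hfg, G.map_zero]
    · rw [← G.map_comp, hgf, G.map_zero]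
    · rw [← G.map_add, h1, G.map_id]
  · obtain ⟨f, rfl⟩ := G.map_surjective f
    obtain ⟨g, rfl⟩ := G.map_surjective g
    rw [hz, hz]
    rw [← G.map_comp, hz] at hfg hgf
    rw [← G.map_comp] at hf hg
    rw [← G.map_add, ← G.map_id] at h1
    exact h f g (G.map_injective hf) (G.map_injective hg) hfg hgf (G.map_injective h1)

end Indec

theorem IdempotentSystem.eq_sum_sandwich {F A : Type*} {n : ℕ} [Field F] [Ring A]
    [Algebra F A] (S : IdempotentSystem F A n) (a : A) :
    a = ∑ i, ∑ j, S.e i * a * S.e j := by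
  simp only [← Finset.mul_sum, ← Finset.sum_mul, S.complete.complete, one_mul, mul_one]

variable {F R A R' A' : Type*} {n n' : ℕ} [NeZero n] [NeZero n'] [Field F] [Ring R] [Ring A]
  [Algebra F A] [Ring R'] [Ring A'] [Algebra F A']

open PreDatum

theorem PreDatum.isIndec_u {D : PreDatum F n R A} (i : Fin n) : IsIndec (D.u i) :=
  ⟨id_u_ne_zero i, fun _ _ => u_orthogonal⟩

section Equivalence

variable {D : PreDatum F n R A} {D' : PreDatum F n' R' A'} (G : D.Ob ⥤ D'.Ob)

/-- The objects `𝐞ᵢ` are exactly the indecomposable ones, and an equivalence preserves and reflects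
indecomposability. Injectivity holds because a fully faithful functor reflects isomorphisms; for
surjectivity a preimage of `𝐞ₖ` under essential surjectivity is again indecomposable. Skeletality
turns the resulting isomorphisms into equalities. -/
theorem exists_perm [G.Additive] [FiniteDimensional F A] [FiniteDimensional F A']
    [G.IsEquivalence] :
    ∃ σ : Fin n ≃ Fin n', ∀ i, G.obj (D.u i) = D'.u (σ i) := by
  have h : ∀ i, ∃ k, G.obj (D.u i) = D'.u k := fun i =>
    have h := (isIndec_obj_iff G).2 (PreDatum.isIndec_u i)
    exists_eq_u h.1 h.2
  choose s hs using h
  have hinj : Function.Injective s := by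
    intro i j hij
    have e : G.obj (D.u i) ≅ G.obj (D.u j) := eqToIso (by rw [hs, hs, hij])
    exact u_injective (eq_of_iso (G.preimageIso e))
  have hsurj : Function.Surjective s := by
    intro k
    have h := (isIndec_obj_iff G).1 ((PreDatum.isIndec_u k).of_iso (G.objObjPreimageIso (D'.u k)).symm)
    obtain ⟨i, hi⟩ := exists_eq_u h.1 h.2
    refine ⟨i, u_injective (D := D') ?_⟩
    rw [← hs, ← hi]
    exact eq_of_iso (G.objObjPreimageIso (D'.u k))
  exact ⟨Equiv.ofBijective s ⟨hinj, hsurj⟩, hs⟩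

variable {G} {σ : Fin n ≃ Fin n'} (κ : ∀ i, G.obj (D.u i) ≅ D'.u (σ i))

/-- The morphism `𝐞_{σ(i)} ⟶ 𝐞_{σ(j)}` that corresponds to a morphism `𝐞ᵢ ⟶ 𝐞ⱼ`. -/
def conjBy {i j : Fin n} (f : D.u i ⟶ D.u j) : D'.u (σ i) ⟶ D'.u (σ j) :=
  (κ i).inv ≫ G.map f ≫ (κ j).hom

theorem conjBy_comp {i j k : Fin n} (f : D.u i ⟶ D.u j) (g : D.u j ⟶ D.u k) :
    conjBy κ (f ≫ g) = conjBy κ f ≫ conjBy κ g := by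
  simp [conjBy]

theorem conjBy_id (i : Fin n) : conjBy κ (𝟙 (D.u i)) = 𝟙 _ := by
  simp [conjBy]

theorem conjBy_zero [G.Additive] (i j : Fin n) : conjBy κ (0 : D.u i ⟶ D.u j) = 0 := by
  simp [conjBy]

theorem conjBy_add [G.Additive] {i j : Fin n} (f g : D.u i ⟶ D.u j) :
    conjBy κ (f + g) = conjBy κ f + conjBy κ g := by
  simp [conjBy, G.map_add]

theorem conjBy_smul [G.Linear F] {i j : Fin n} (r : F) (f : D.u i ⟶ D.u j) :
    conjBy κ (r • f) = r • conjBy κ f := by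
  simp [conjBy, G.map_smul]

theorem conjBy_injective [G.Faithful] {i j : Fin n} {f g : D.u i ⟶ D.u j}
    (h : conjBy κ f = conjBy κ g) : f = g := by
  exact G.map_injective (by simpa [conjBy] using h)

theorem conjBy_surjective [G.Full] {i j : Fin n} (g : D'.u (σ i) ⟶ D'.u (σ j)) :
    ∃ f : D.u i ⟶ D.u j, conjBy κ f = g := by
  obtain ⟨f, hf⟩ := G.map_surjective ((κ i).hom ≫ g ≫ (κ j).inv)
  exact ⟨f, by simp [conjBy, hf]⟩

theorem conjBy_hom {i j : Fin n} (f : D.u i ⟶ D.u j) :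
    (κ i).hom ≫ conjBy κ f = G.map f ≫ (κ j).hom := by
  simp [conjBy]

theorem map_ι_ext [G.Additive] {m : D.Ob} {t : D'.Ob} {f g : G.obj m ⟶ t}
    (h : ∀ p : Idx m.vec, G.map (D.ι p) ≫ f = G.map (D.ι p) ≫ g) : f = g := by
  have key : ∀ f : G.obj m ⟶ t, f = ∑ p : Idx m.vec, G.map (D.π p) ≫ G.map (D.ι p) ≫ f := by
    intro f
    conv_lhs => rw [← Category.id_comp f, ← G.map_id, ← sum_π_ι m]
    simp only [Functor.map_sum, Functor.map_comp, Preadditive.sum_comp, Category.assoc]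
  rw [key f, key g]
  simp only [h]

/-! ### Comparison of an equivalence with the standard functor -/

section Comparison

variable (T : SystemEquiv D.S.toIdempotentSystem D'.S.toIdempotentSystem)
  (κ : ∀ i, G.obj (D.u i) ≅ D'.u (T.σ i))

/-- The comparison morphism between `G(m)` and `m^σ`. -/
def comparison (m : D.Ob) : G.obj m ⟶ T.functor.obj m :=
  ∑ p : Idx m.vec, G.map (D.π p) ≫ (κ p.1).hom ≫ T.inc p

/-- The inverse of the comparison morphism. -/
def comparisonInv (m : D.Ob) : T.functor.obj m ⟶ G.obj m :=
  ∑ p : Idx m.vec, T.prj p ≫ (κ p.1).inv ≫ G.map (D.ι p)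

theorem map_ι_comparison [G.Additive] {m : D.Ob} (p : Idx m.vec) :
    G.map (D.ι p) ≫ comparison T κ m = (κ p.1).hom ≫ T.inc p := by
  rw [comparison, Preadditive.comp_sum, Finset.sum_eq_single p]
  · rw [← Category.assoc, ← G.map_comp, ι_π_self, G.map_id, Category.id_comp]
  · intro q _ hq
    rw [← Category.assoc, ← G.map_comp, ι_π_ne hq.symm, G.map_zero, Limits.zero_comp]
  · simp

theorem inc_comparisonInv {m : D.Ob} (p : Idx m.vec) :
    T.inc p ≫ comparisonInv T κ m = (κ p.1).inv ≫ G.map (D.ι p) := by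
  rw [comparisonInv, Preadditive.comp_sum, Finset.sum_eq_single p]
  · rw [← Category.assoc, SystemEquiv.inc_prj_self, Category.id_comp]
  · intro q _ hq
    rw [← Category.assoc, SystemEquiv.inc_prj_ne _ hq.symm, Limits.zero_comp]
  · simp

/-- An equivalence is isomorphic to the functor `m ↦ m^σ`, `X ↦ P_σ δ(X) P_σᵀ`. -/
def comparisonIso [G.Additive] (hT : ∀ {i j : Fin n} (f : D.u i ⟶ D.u j), T.conj f = conjBy κ f) :
    G ≅ T.functor :=
  NatIso.ofComponents
    (fun m =>
      { hom := comparison T κ m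
        inv := comparisonInv T κ m
        hom_inv_id := map_ι_ext fun p => by
          rw [← Category.assoc, map_ι_comparison, Category.assoc, inc_comparisonInv,
            ← Category.assoc, Iso.hom_inv_id, Category.id_comp, Category.comp_id]
        inv_hom_id := SystemEquiv.inc_ext _ fun p => by
          rw [← Category.assoc, inc_comparisonInv, Category.assoc, map_ι_comparison,
            ← Category.assoc, Iso.inv_hom_id, Category.id_comp, Category.comp_id] })
    -- Naturality is tested on a summand `p` of the source. Expanding `f` over the summands of the
    -- target leaves `1 × 1` entries, on which `hT` says that the two functors agree.
    (fun {m s} f => map_ι_ext fun p => by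
      rw [← Category.assoc (G.map (D.ι p)) (comparison T κ m), map_ι_comparison, Category.assoc,
        SystemEquiv.inc_map, ← Category.assoc, ← G.map_comp, eq_sum_comp_π_ι (D.ι p ≫ f),
        G.map_sum, Preadditive.sum_comp, Preadditive.comp_sum]
      refine Finset.sum_congr rfl fun q _ => ?_
      rw [G.map_comp, Category.assoc, map_ι_comparison, hT, ← Category.assoc,
        ← Category.assoc (κ p.1).hom, conjBy_hom, Category.assoc (D.ι p)])

end Comparison

/-! ### Gluing the action on `eᵢ A eⱼ` to an algebra isomorphism -/

/-- The element `eᵢ a eⱼ` of `A` as a morphism. -/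
def eltHom (D : PreDatum F n R A) (i j : Fin n) (a : A) : D.u j ⟶ D.u i := D.S.elt i j a

theorem eltHom_add (i j : Fin n) (a b : A) : eltHom D i j (a + b) = eltHom D i j a + eltHom D i j b := by
  refine u_hom_ext ?_
  change D.S.e i * (a + b) * D.S.e j = D.S.e i * a * D.S.e j + D.S.e i * b * D.S.e j
  noncomm_ring

theorem eltHom_smul (i j : Fin n) (r : F) (a : A) : eltHom D i j (r • a) = r • eltHom D i j a := by
  refine u_hom_ext ?_
  change D.S.e i * (r • a) * D.S.e j = r • (D.S.e i * a * D.S.e j)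
  rw [mul_smul_comm, smul_mul_assoc]

theorem eltHom_comp {i j k : Fin n} (a b : A) :
    eltHom D j k b ≫ eltHom D i j a = eltHom D i k (a * D.S.e j * b) := elt_comp a b

theorem eltHom_eq_zero {i j : Fin n} {a : A} (h : D.S.e i * a * D.S.e j = 0) :
    eltHom D i j a = 0 := u_hom_ext h

/-- The entry of the `1 × 1`-matrix that corresponds to `eᵢ a eⱼ`. -/
def corr [G.Additive] [G.Linear F] (i j : Fin n) : A →ₗ[F] A' where
  toFun a := (conjBy κ (eltHom D i j a)).1 (pt (σ i)) (pt (σ j))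
  map_add' a b := by rw [eltHom_add, conjBy_add]; rfl
  map_smul' r a := by rw [eltHom_smul, conjBy_smul]; rfl

variable [G.Additive] [G.Linear F]

theorem corr_apply (i j : Fin n) (a : A) :
    corr κ i j a = (conjBy κ (eltHom D i j a)).1 (pt (σ i)) (pt (σ j)) := rfl

theorem corr_mem (i j : Fin n) (a : A) : corr κ i j a ∈ D'.S.peirce (σ i) (σ j) :=
  (conjBy κ (eltHom D i j a)).2 (pt (σ i)) (pt (σ j))

theorem corr_eq_zero {i j : Fin n} {a : A} (h : D.S.e i * a * D.S.e j = 0) : corr κ i j a = 0 := by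
  rw [corr_apply, eltHom_eq_zero h, conjBy_zero]
  rfl

theorem corr_e (i : Fin n) : corr κ i i (D.S.e i) = D'.S.e (σ i) := by
  rw [corr_apply, show eltHom D i i (D.S.e i) = 𝟙 _ from elt_id i, conjBy_id]
  exact (IdempotentSystem.E_apply (S := D'.S.toIdempotentSystem) _ (pt (σ i)) (pt (σ i))).trans
    (if_pos rfl)

theorem corr_mul_corr (i j l : Fin n) (a b : A) :
    corr κ i j a * corr κ j l b = corr κ i l (a * D.S.e j * b) := by
  rw [corr_apply κ i l, ← eltHom_comp, conjBy_comp]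
  refine Eq.symm ((IdempotentSystem.hmul_apply _ _ _ _).trans ?_)
  refine Finset.sum_eq_single (pt (σ j)) (fun b _ hb => ?_) fun h => absurd (Finset.mem_univ _) h
  exact absurd (Subsingleton.elim (α := Idx (unitVec (σ j))) _ _) hb

theorem corr_mul_corr_ne {i j k l : Fin n} (h : j ≠ k) (a b : A) :
    corr κ i j a * corr κ k l b = 0 := by
  rw [← IdempotentSystem.mul_e_of_mem (corr_mem κ i j a),
    ← IdempotentSystem.e_mul_of_mem (corr_mem κ k l b), mul_assoc, ← mul_assoc (D'.S.e (σ j)),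
    IdempotentSystem.e_mul_e, if_neg fun hj => h (σ.injective hj), zero_mul, mul_zero]

/-- The map `A → A'` that is induced by the action of a functor on the morphisms `𝐞ⱼ ⟶ 𝐞ᵢ`. -/
def corrSum : A →ₗ[F] A' := ∑ i, ∑ j, corr κ i j

theorem corrSum_apply (a : A) : corrSum κ a = ∑ i, ∑ j, corr κ i j a := by
  simp [corrSum]

theorem corrSum_of_mem {i j : Fin n} {a : A} (ha : a ∈ D.S.peirce i j) :
    corrSum κ a = corr κ i j a := by
  rw [corrSum_apply, Finset.sum_eq_single i, Finset.sum_eq_single j]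
  · intro l _ hl
    refine corr_eq_zero κ ?_
    rw [← IdempotentSystem.mul_e_of_mem ha, mul_assoc, mul_assoc, IdempotentSystem.e_mul_e,
      if_neg hl.symm, mul_zero, mul_zero]
  · simp
  · intro k _ hk
    refine Finset.sum_eq_zero fun l _ => corr_eq_zero κ ?_
    rw [← IdempotentSystem.e_mul_of_mem ha, ← mul_assoc, IdempotentSystem.e_mul_e, if_neg hk,
      zero_mul, zero_mul]
  · simp

theorem corrSum_e (i : Fin n) : corrSum κ (D.S.e i) = D'.S.e (σ i) := by
  rw [corrSum_of_mem κ (D.S.e_mem i), corr_e]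

theorem corrSum_one : corrSum κ 1 = 1 := by
  rw [← D.S.complete.complete, map_sum]
  simp only [corrSum_e]
  rw [σ.sum_comp, D'.S.complete.complete]

/-- Products of components with different inner labels vanish by orthogonality of the `e'ₖ`. The
others are given by functoriality, and summing them over the inner label uses `∑ⱼ eⱼ = 1`. -/
theorem corrSum_mul (a b : A) : corrSum κ (a * b) = corrSum κ a * corrSum κ b := by
  simp only [corrSum_apply, Finset.sum_mul_sum]
  refine Finset.sum_congr rfl fun i _ => ?_
  have h1 : ∀ k j l, corr κ i j a * corr κ k l b =
      if j = k then corr κ i l (a * D.S.e j * b) else 0 := by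
    intro k j l
    split_ifs with h
    · subst h; exact corr_mul_corr κ i j l a b
    · exact corr_mul_corr_ne κ h a b
  have h2 : ∀ l, corr κ i l (a * b) = ∑ j, corr κ i l (a * D.S.e j * b) := by
    intro l
    rw [← map_sum, ← Finset.sum_mul, ← Finset.mul_sum, D.S.complete.complete, mul_one]
  simp only [h1, h2]
  rw [Finset.sum_comm]
  refine Finset.sum_congr rfl fun j _ => ?_
  rw [Finset.sum_comm]
  simp

theorem e_mul_corrSum_mul_e (i j : Fin n) (a : A) :
    D'.S.e (σ i) * corrSum κ a * D'.S.e (σ j) = corr κ i j a := by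
  rw [← corrSum_e κ, ← corrSum_e κ, ← corrSum_mul, ← corrSum_mul,
    corrSum_of_mem κ (D.S.sandwich_mem i j a), corr_apply, corr_apply]
  have : eltHom D i j (D.S.e i * a * D.S.e j) = eltHom D i j a := by
    refine u_hom_ext ?_
    change D.S.e i * (D.S.e i * a * D.S.e j) * D.S.e j = D.S.e i * a * D.S.e j
    simp only [← mul_assoc, IdempotentSystem.e_mul_self]
    simp only [mul_assoc, IdempotentSystem.e_mul_self]
  rw [this]

/-- A fully faithful functor is bijective on each `Hom(𝐞ⱼ, 𝐞ᵢ)`, hence on each Peirce component, and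
`σ` permutes the components bijectively. -/
theorem corrSum_bijective [G.Full] [G.Faithful] : Function.Bijective (corrSum κ) := by
  refine ⟨(injective_iff_map_eq_zero _).2 fun a ha => ?_, fun b => ?_⟩
  · rw [D.S.toIdempotentSystem.eq_sum_sandwich a]
    refine Finset.sum_eq_zero fun i _ => Finset.sum_eq_zero fun j _ => ?_
    have h : conjBy κ (eltHom D i j a) = conjBy κ 0 := by
      rw [conjBy_zero]
      refine u_hom_ext ?_
      have := e_mul_corrSum_mul_e κ i j a
      rw [ha, mul_zero, zero_mul] at this
      exact this.symm
    exact congrArg (fun f => f.1 (pt i) (pt j)) (conjBy_injective κ h)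
  · have h : ∀ i j, ∃ a, corrSum κ a = D'.S.e (σ i) * b * D'.S.e (σ j) := by
      intro i j
      obtain ⟨f, hf⟩ := conjBy_surjective κ (eltHom D' (σ i) (σ j) b)
      obtain ⟨x, hx, rfl⟩ := IdempotentSystem.exists_eq_elt (S := D.S.toIdempotentSystem) f
      exact ⟨x, (corrSum_of_mem κ hx).trans (congrArg (fun f => f.1 (pt (σ i)) (pt (σ j))) hf)⟩
    choose x hx using h
    refine ⟨∑ i, ∑ j, x i j, ?_⟩
    simp only [map_sum, hx]
    conv_rhs => rw [D'.S.toIdempotentSystem.eq_sum_sandwich b, ← σ.sum_comp]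
    exact Finset.sum_congr rfl fun i _ => σ.sum_comp fun k => D'.S.e (σ i) * b * D'.S.e k

/-- The bijection of index sets and the algebra isomorphism that are induced by an equivalence. -/
def inducedEquiv [G.Full] [G.Faithful] :
    SystemEquiv D.S.toIdempotentSystem D'.S.toIdempotentSystem where
  σ := σ
  δ := AlgEquiv.ofBijective (AlgHom.ofLinearMap (corrSum κ) (corrSum_one κ) (corrSum_mul κ))
    (corrSum_bijective κ)
  map_e := corrSum_e κ

/-- On morphisms between the `𝐞ᵢ` the standard functor built from the induced `δ` reproduces the
given functor, which is the hypothesis of `comparisonIso`. -/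
theorem inducedEquiv_conj [G.Full] [G.Faithful] {i j : Fin n} (f : D.u i ⟶ D.u j) :
    (inducedEquiv κ).conj f = conjBy κ f := by
  obtain ⟨x, hx, rfl⟩ := IdempotentSystem.exists_eq_elt (S := D.S.toIdempotentSystem) f
  refine (SystemEquiv.conj_elt _ x).trans (u_hom_ext ?_)
  change D'.S.e (σ j) * corrSum κ x * D'.S.e (σ i) = _
  rw [e_mul_corrSum_mul_e]
  rfl

end Equivalence

end

/-! ### The ring isomorphism and the assembly of both directions -/

section

namespace ZPlusRing

variable {n n' : ℕ} [NeZero n] [NeZero n'] {R R' : Type*} [Ring R] [Ring R'] (Z : ZPlusRing n R)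
  (Z' : ZPlusRing n' R') (σ : Fin n ≃ Fin n')

/-- Bases with the same structure constants give a ring isomorphism. -/
theorem exists_ringEquiv (h : ∀ i j, permVec σ (Z.c i j) = Z'.c (σ i) (σ j)) :
    ∃ f : R ≃+* R', ∀ i, f (Z.r i) = Z'.r (σ i) := by
  let f : R ≃ₗ[ℤ] R' := Z.r.equiv Z'.r σ
  have hf : ∀ i, f (Z.r i) = Z'.r (σ i) := fun i => Z.r.equiv_apply i Z'.r σ
  have hmul : ∀ x y, f (x * y) = f x * f y := by
    -- By bilinearity multiplicativity may be checked on basis elements, where it is the equality of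
    -- structure constants.
    have : (LinearMap.mul ℤ R).compr₂ f.toLinearMap =
        (LinearMap.mul ℤ R').compl₁₂ f.toLinearMap f.toLinearMap := by
      refine Z.r.ext fun i => Z.r.ext fun j => ?_
      change f (Z.r i * Z.r j) = f (Z.r i) * f (Z.r j)
      rw [hf, hf, Z.r_mul_r, Z'.r_mul_r, map_sum, ← σ.sum_comp]
      refine Finset.sum_congr rfl fun k _ => ?_
      rw [map_smul, hf, ← h]
      simp only [permVec, Equiv.symm_apply_apply]
    exact fun x y => LinearMap.congr_fun₂ this x y
  exact ⟨{ f with map_mul' := hmul }, hf⟩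

variable {Z Z' σ}

/-- A ring isomorphism preserves the unit, which is a basis element on both sides; so (1) already
forces `σ` to fix the unit index. -/
theorem map_zero_of_ringEquiv {f : R ≃+* R'} (hf : ∀ i, f (Z.r i) = Z'.r (σ i)) : σ 0 = 0 := by
  refine Z'.r.injective ?_
  rw [← hf, Z.r_zero, Z'.r_zero, map_one]

end ZPlusRing

namespace SystemEquiv

variable {F R A R' A' : Type*} {n n' : ℕ} [NeZero n] [NeZero n'] [Field F] [Ring R] [Ring A]
  [Algebra F A] [Ring R'] [Ring A'] [Algebra F A']
  {D : Datum F n R A} {D' : Datum F n' R' A'}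
  (T : SystemEquiv D.S.toIdempotentSystem D'.S.toIdempotentSystem)

open PreDatum

/-- By skeletality the isomorphisms become the equalities `(𝐜ᵢⱼ)^σ = 𝐜'_{σ(i)σ(j)}`, so the two
bases have the same structure constants. -/
theorem exists_ringEquiv_of_iso [FiniteDimensional F A']
    (e : ∀ i j, D'.tO (D'.u (T.σ i)) (D'.u (T.σ j)) ≅ T.functor.obj (D.tO (D.u i) (D.u j))) :
    ∃ f : R ≃+* R', ∀ i, f (D.Z.r i) = D'.Z.r (T.σ i) := by
  refine D.Z.exists_ringEquiv D'.Z T.σ fun i j => ?_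
  have h : D'.Z.tObj (unitVec (T.σ i)) (unitVec (T.σ j)) =
      permVec T.σ (D.Z.tObj (unitVec i) (unitVec j)) := congrArg Ob.vec (eq_of_iso (e i j))
  rw [ZPlusRing.tObj_unitVec, ZPlusRing.tObj_unitVec] at h
  exact h.symm

theorem unit_tO_u (h0 : T.σ 0 = 0) (i : Fin n) :
    D'.tO (D'.u (T.σ 0)) (D'.u (T.σ i)) = D'.u (T.σ i) := by
  rw [h0, unit_tO]

theorem tO_unit_u (h0 : T.σ 0 = 0) (i : Fin n) :
    D'.tO (D'.u (T.σ i)) (D'.u (T.σ 0)) = D'.u (T.σ i) := by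
  rw [h0, tO_unit]

theorem exists_matrices [FiniteDimensional F A'] (hT : T.chatFunctor.Monoidal) :
    (∃ f : R ≃+* R', ∀ i, f (D.Z.r i) = D'.Z.r (T.σ i)) ∧
    ∃ (α : F) (φ : ∀ i j : Fin n, D'.Mat (permVec T.σ (D.tObj (unitVec i) (unitVec j)))
        (D'.tObj (unitVec (T.σ i)) (unitVec (T.σ j)))),
      α ≠ 0 ∧
      (∀ i j, ∃ ψ : D'.Mat (D'.tObj (unitVec (T.σ i)) (unitVec (T.σ j)))
        (permVec T.σ (D.tObj (unitVec i) (unitVec j))),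
        φ i j * ψ = D'.S.E _ ∧ ψ * φ i j = D'.S.E _) ∧
      (∀ i, (∀ p q, (φ 0 i).1 p q = α • D'.S.e (T.σ i)) ∧
        (∀ p q, (φ i 0).1 p q = α • D'.S.e (T.σ i))) ∧
      (∀ i j i' j' : Fin n, ∀ x ∈ D.S.peirce i' i, ∀ y ∈ D.S.peirce j' j,
        (φ i' j').1 * (D'.tHom (D'.S.elt (T.σ i') (T.σ i) (T.δ x))
            (D'.S.elt (T.σ j') (T.σ j) (T.δ y))).1 =
          permMat A' T.σ (D.tObj (unitVec i') (unitVec j')) *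
            (D.tHom (D.S.elt i' i x) (D.S.elt j' j y)).1.map T.δ *
            (permMat A' T.σ (D.tObj (unitVec i) (unitVec j))).transpose * (φ i j).1) ∧
      (∀ i j l : Fin n,
        ∑ p : Idx (D.tObj (unitVec i) (unitVec j)),
          (D.a i j l).1.map T.δ * (D.tHom (D.S.inc p) (D.S.E (unitVec l))).1.map T.δ *
            (permMat A' T.σ (D.tObj (unitVec p.1) (unitVec l))).transpose * (φ p.1 l).1 *
            (D'.tHom (D'.S.prjPerm T.σ p * φ i j) (D'.S.E (unitVec (T.σ l)))).1 =
        ∑ p : Idx (D.tObj (unitVec j) (unitVec l)),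
          (D.tHom (D.S.E (unitVec i)) (D.S.inc p)).1.map T.δ *
            (permMat A' T.σ (D.tObj (unitVec i) (unitVec p.1))).transpose * (φ i p.1).1 *
            (D'.tHom (D'.S.E (unitVec (T.σ i))) (D'.S.prjPerm T.σ p * φ j l)).1 *
            (D'.a (T.σ i) (T.σ j) (T.σ l)).1) := by
  obtain ⟨Φ, Ψ, h0, α, hΦΨ, hΨΦ, hα, hl, hr, hnat, hc⟩ := T.exists_components hT
  refine ⟨T.exists_ringEquiv_of_iso fun i j => ⟨Φ i j, Ψ i j, hΦΨ i j, hΨΦ i j⟩, α, Φ, hα,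
    fun i j => ⟨Ψ i j, hΨΦ i j, hΦΨ i j⟩, fun i => ⟨fun p q => ?_, fun p q => ?_⟩, ?_, ?_⟩
  · rw [hl i]
    exact congrArg (α • ·) (eqToHom_apply (T.unit_tO_eq h0 i) (T.unit_tO_u h0 i) p q)
  · rw [hr i]
    exact congrArg (α • ·) (eqToHom_apply (T.tO_unit_eq h0 i) (T.tO_unit_u h0 i) p q)
  · intro i j i' j' x _ y _
    exact (T.matrix_natural_iff Φ x y).2 (hnat _ _)
  · intro i j l
    exact (T.matrix_assoc_iff Φ i j l).2 (hc i j l)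

theorem nonempty_monoidal_of_matrices
    (hf : ∃ f : R ≃+* R', ∀ i, f (D.Z.r i) = D'.Z.r (T.σ i)) {α : F}
    {φ : ∀ i j : Fin n, D'.Mat (permVec T.σ (D.tObj (unitVec i) (unitVec j)))
        (D'.tObj (unitVec (T.σ i)) (unitVec (T.σ j)))}
    (hα : α ≠ 0)
    (hφ : ∀ i j, ∃ ψ : D'.Mat (D'.tObj (unitVec (T.σ i)) (unitVec (T.σ j)))
        (permVec T.σ (D.tObj (unitVec i) (unitVec j))),
        φ i j * ψ = D'.S.E _ ∧ ψ * φ i j = D'.S.E _)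
    (ha : ∀ i, (∀ p q, (φ 0 i).1 p q = α • D'.S.e (T.σ i)) ∧
        (∀ p q, (φ i 0).1 p q = α • D'.S.e (T.σ i)))
    (hb : ∀ i j i' j' : Fin n, ∀ x ∈ D.S.peirce i' i, ∀ y ∈ D.S.peirce j' j,
        (φ i' j').1 * (D'.tHom (D'.S.elt (T.σ i') (T.σ i) (T.δ x))
            (D'.S.elt (T.σ j') (T.σ j) (T.δ y))).1 =
          permMat A' T.σ (D.tObj (unitVec i') (unitVec j')) *
            (D.tHom (D.S.elt i' i x) (D.S.elt j' j y)).1.map T.δ *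
            (permMat A' T.σ (D.tObj (unitVec i) (unitVec j))).transpose * (φ i j).1)
    (hc : ∀ i j l : Fin n,
        ∑ p : Idx (D.tObj (unitVec i) (unitVec j)),
          (D.a i j l).1.map T.δ * (D.tHom (D.S.inc p) (D.S.E (unitVec l))).1.map T.δ *
            (permMat A' T.σ (D.tObj (unitVec p.1) (unitVec l))).transpose * (φ p.1 l).1 *
            (D'.tHom (D'.S.prjPerm T.σ p * φ i j) (D'.S.E (unitVec (T.σ l)))).1 =
        ∑ p : Idx (D.tObj (unitVec j) (unitVec l)),
          (D.tHom (D.S.E (unitVec i)) (D.S.inc p)).1.map T.δ *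
            (permMat A' T.σ (D.tObj (unitVec i) (unitVec p.1))).transpose * (φ i p.1).1 *
            (D'.tHom (D'.S.E (unitVec (T.σ i))) (D'.S.prjPerm T.σ p * φ j l)).1 *
            (D'.a (T.σ i) (T.σ j) (T.σ l)).1) :
    Nonempty T.chatFunctor.Monoidal := by
  obtain ⟨f, hf⟩ := hf
  have h0 := ZPlusRing.map_zero_of_ringEquiv hf
  choose ψ hφψ hψφ using hφ
  let Φ : ∀ i j, D'.tO (D'.u (T.σ i)) (D'.u (T.σ j)) ⟶ T.functor.obj (D.tO (D.u i) (D.u j)) := φ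
  refine T.nonempty_monoidal (Φ := Φ) (Ψ := ψ) hψφ hφψ h0 hα (fun i => ?_) (fun i => ?_) ?_
    fun i j l => ?_
  · exact eq_smul_eqToHom (T.unit_tO_eq h0 i) (T.unit_tO_u h0 i) (ha i).1
  · exact eq_smul_eqToHom (T.tO_unit_eq h0 i) (T.tO_unit_u h0 i) (ha i).2
  · intro i i' j j' f g
    obtain ⟨x, hx, rfl⟩ := Datum.exists_elt f
    obtain ⟨y, hy, rfl⟩ := Datum.exists_elt g
    exact (T.matrix_natural_iff φ x y).1 (hb i j i' j' x hx y hy)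
  · exact (T.matrix_assoc_iff φ i j l).1 (hc i j l)

instance : T.chatFunctor.Additive := inferInstanceAs T.functor.Additive

instance : T.chatFunctor.Linear F := inferInstanceAs (T.functor.Linear F)

instance : T.chatFunctor.IsEquivalence :=
  { faithful := inferInstanceAs T.functor.Faithful
    full := inferInstanceAs T.functor.Full
    essSurj := inferInstanceAs T.functor.EssSurj }

end SystemEquiv

/-- Up to isomorphism every tensor equivalence is a standard functor, and monoidal structures are
transported along natural isomorphisms. -/
theorem exists_systemEquiv {F R A R' A' : Type*} {n n' : ℕ} [NeZero n] [NeZero n'] [Field F]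
    [Ring R] [Ring A] [Algebra F A] [Ring R'] [Ring A'] [Algebra F A'] [FiniteDimensional F A]
    [FiniteDimensional F A'] {D : Datum F n R A} {D' : Datum F n' R' A'}
    (h : TensorEquivalent F (Chat D) (Chat D')) :
    ∃ T : SystemEquiv D.S.toIdempotentSystem D'.S.toIdempotentSystem,
      Nonempty T.chatFunctor.Monoidal := by
  obtain ⟨G, hA, hL, hE, ⟨hM⟩⟩ := h
  -- The construction of `σ` and `δ` takes place in the underlying linear categories; the tensor
  -- product returns only when the monoidal structure is transported.
  let G₁ : D.Ob ⥤ D'.Ob := G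
  have : G₁.Additive := hA
  have : G₁.Linear F := hL
  have : G₁.IsEquivalence := hE
  obtain ⟨σ, hσ⟩ := exists_perm G₁
  let κ : ∀ i, G₁.obj (D.u i) ≅ D'.u (σ i) := fun i => eqToIso (hσ i)
  let T := inducedEquiv κ
  let e : G₁ ≅ T.functor := comparisonIso T κ (inducedEquiv_conj κ)
  let e' : G ≅ T.chatFunctor := e
  exact ⟨T, ⟨Functor.Monoidal.transport e'⟩⟩

end

end Recon

end

theorem mainTheorem3 {F : Type*} [Field F] [IsAlgClosed F] {n n' : ℕ} [NeZero n] [NeZero n']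
    {R A R' A' : Type*} [Ring R] [Ring A] [Algebra F A] [FiniteDimensional F A]
    [Ring R'] [Ring A'] [Algebra F A'] [FiniteDimensional F A']
    (D : Datum F n R A) (D' : Datum F n' R' A') :
    TensorEquivalent F (Chat D) (Chat D') ↔
      n' = n ∧ ∃ σ : Fin n ≃ Fin n',
        -- (1)
        (∃ f : R ≃+* R', ∀ i, f (D.Z.r i) = D'.Z.r (σ i)) ∧
        -- (2)
        ∃ δ : A ≃ₐ[F] A', (∀ i, δ (D.S.e i) = D'.S.e (σ i)) ∧
        -- (3), where `(𝐞ᵢ ⊗̂ 𝐞ⱼ)^σ = 𝐞_{σ(i)} ⊗̂ 𝐞_{σ(j)}` by (1)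
        ∃ (α : F) (φ : ∀ i j : Fin n, D'.Mat (permVec σ (D.tObj (unitVec i) (unitVec j)))
            (D'.tObj (unitVec (σ i)) (unitVec (σ j)))),
          α ≠ 0 ∧
          (∀ i j, ∃ ψ : D'.Mat (D'.tObj (unitVec (σ i)) (unitVec (σ j)))
            (permVec σ (D.tObj (unitVec i) (unitVec j))),
            φ i j * ψ = D'.S.E _ ∧ ψ * φ i j = D'.S.E _) ∧
          -- (a)
          (∀ i, (∀ p q, (φ 0 i).1 p q = α • D'.S.e (σ i)) ∧
            (∀ p q, (φ i 0).1 p q = α • D'.S.e (σ i))) ∧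
          -- (b)
          (∀ i j i' j' : Fin n, ∀ x ∈ D.S.peirce i' i, ∀ y ∈ D.S.peirce j' j,
            (φ i' j').1 * (D'.tHom (D'.S.elt (σ i') (σ i) (δ x)) (D'.S.elt (σ j') (σ j) (δ y))).1 =
              permMat A' σ (D.tObj (unitVec i') (unitVec j')) *
                (D.tHom (D.S.elt i' i x) (D.S.elt j' j y)).1.map δ *
                (permMat A' σ (D.tObj (unitVec i) (unitVec j))).transpose * (φ i j).1) ∧
          -- (c)
          (∀ i j l : Fin n,
            ∑ p : Idx (D.tObj (unitVec i) (unitVec j)),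
              (D.a i j l).1.map δ * (D.tHom (D.S.inc p) (D.S.E (unitVec l))).1.map δ *
                (permMat A' σ (D.tObj (unitVec p.1) (unitVec l))).transpose * (φ p.1 l).1 *
                (D'.tHom (D'.S.prjPerm σ p * φ i j) (D'.S.E (unitVec (σ l)))).1 =
            ∑ p : Idx (D.tObj (unitVec j) (unitVec l)),
              (D.tHom (D.S.E (unitVec i)) (D.S.inc p)).1.map δ *
                (permMat A' σ (D.tObj (unitVec i) (unitVec p.1))).transpose * (φ i p.1).1 *
                (D'.tHom (D'.S.E (unitVec (σ i))) (D'.S.prjPerm σ p * φ j l)).1 *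
                (D'.a (σ i) (σ j) (σ l)).1) := by
  refine ⟨fun h => ?_, ?_⟩
  · obtain ⟨T, ⟨hT⟩⟩ := exists_systemEquiv h
    obtain ⟨hf, α, φ, hα, hφ, ha, hb, hc⟩ := T.exists_matrices hT
    -- The bijection of index sets found from the equivalence forces `n' = n`.
    exact ⟨(Fin.equiv_iff_eq.1 ⟨T.σ⟩).symm, T.σ, hf, T.δ, T.map_e, α, φ, hα, hφ, ha, hb, hc⟩
  · rintro ⟨-, σ, hf, δ, hδ, α, φ, hα, hφ, ha, hb, hc⟩
    let T : SystemEquiv D.S.toIdempotentSystem D'.S.toIdempotentSystem := ⟨σ, δ, hδ⟩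
    exact ⟨T.chatFunctor, inferInstance, inferInstance, inferInstance,
      T.nonempty_monoidal_of_matrices hf hα hφ ha hb hc⟩
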